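/- Let $M$ be a smooth $4$-manifold and let $g^E$ be a smooth Lorentzian metric on $M$ of signature $(-,+,+,+)$ with $\mathrm{Ric}(g^E)=0$ that is static, i.e. there is a smooth timelike hypersurface-orthogonal Killing field $\xi$, and asymptotically flat: there is a chart (an end) whose range contains $\{(t,x)\in\mathbb R\times\mathbb R^3:\ r=|x|>R\}$ for some $R$, in which, for $r>R$, $\xi=\partial_t$, and in which $g^E_{ij}=\eta_{ij}+O(r^{-1})$, $\partial g^E_{ij}=O(r^{-2})$, $\partial\partial g^E_{ij}=O(r^{-3})$ as $r\to\infty$, with $\eta=\mathrm{diag}(-1,1,1,1)$. Define $\chi$ by $e^{2\chi}=-g^E(\xi,\xi)$. Let $\alpha\in\mathbb R$, let $\omega_\alpha=\arcsin\!\big(\alpha/\sqrt{1+\alpha^2}\big)$, and let the functions $u,\varphi,\Phi$ on $M$ be given by one of the following three families. (1) For parameters $\Gamma,\omega$ with $\Gamma^2<1$, and $D:=1-\Gamma^2e^{2\chi\sqrt{1+\alpha^2}\cos\omega}>0$ on $M$: $$e^{2u}=(1-\Gamma^2)^{\frac{2}{1+\alpha^2}}\frac{e^{2\chi\cos(\omega-\omega_\alpha)}}{D^{\frac{2}{1+\alpha^2}}},\quad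 e^{2\varphi}=(1-\Gamma^2)^{\frac{2\alpha}{1+\alpha^2}}\frac{e^{-2\chi\sin(\omega-\omega_\alpha)}}{D^{\frac{2\alpha}{1+\alpha^2}}},\quad \Phi=\frac{\Gamma}{\sqrt{1+\alpha^2}}\,\frac{1-e^{2\chi\sqrt{1+\alpha^2}\cos\omega}}{D}.$$ (2) For a parameter $b$ with $1-b\chi>0$ on $M$: $$e^{2u}=\frac{e^{\frac{2\alpha}{\sqrt{1+\alpha^2}}\chi}}{(1-b\chi)^{\frac{2}{1+\alpha^2}}},\quad e^{2\varphi}=\frac{e^{-\frac{2}{\sqrt{1+\alpha^2}}\chi}}{(1-b\chi)^{\frac{2\alpha}{1+\alpha^2}}},\quad \Phi=-\frac{1}{\sqrt{1+\alpha^2}}\,\frac{b\chi}{1-b\chi}.$$ (3) For parameters $\psi,\vartheta$ with $\cos\vartheta>0$, and $C:=\cos(\chi\sqrt{1+\alpha^2}\sinh\psi+\vartheta)>0$ on $M$: $$e^{2u}=e^{\frac{2\alpha\chi}{\sqrt{1+\alpha^2}}\cosh\psi}\frac{\cos^{\frac{2}{1+\alpha^2}}\vartheta}{C^{\frac{2}{1+\alpha^2}}},\quad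 e^{2\varphi}=e^{-\frac{2\chi}{\sqrt{1+\alpha^2}}\cosh\psi}\frac{\cos^{\frac{2\alpha}{1+\alpha^2}}\vartheta}{C^{\frac{2\alpha}{1+\alpha^2}}},\quad \Phi=-\frac{1}{\sqrt{1+\alpha^2}}\,\frac{\sin(\chi\sqrt{1+\alpha^2}\sinh\psi)}{C}.$$ Put $$g=e^{2\chi-2u}g^E+\big(e^{-2u}-e^{2u-4\chi}\big)\,\xi\otimes\xi,\qquad F=e^{-2u}\,\xi\wedge d\Phi,$$ where $\xi$ stands for the one-form $g^E(\xi,\cdot)$ in the first formula and for $g(\xi,\cdot)$ in the second, and $\beta\wedge\gamma=\beta\otimes\gamma-\gamma\otimes\beta$ for one-forms. Then $g$ is a smooth Lorentzian metric with $-g(\xi,\xi)=e^{2u}$, and $(g,F,\varphi)$ is a static, asymptotically flat solution of Einstein–Maxwell–dilaton gravity with coupling $\alpha$, i.e. of the field equations of the action $\int\sqrt{-g}\,(R-2\partial_\mu\varphi\,\partial^\mu\varphi-e^{-2\alpha\varphi}F_{\mu\nu}F^{\mu\nu})$: the two-form $F$ is $dA$ for a smooth one-form $A$ on $M$, $\varphi$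 is smooth, and $$R_{\mu\nu}=2\partial_\mu\varphi\,\partial_\nu\varphi+2e^{-2\alpha\varphi}\big(F_{\mu\rho}F_\nu{}^\rho-\tfrac14g_{\mu\nu}F_{\rho\sigma}F^{\rho\sigma}\big),\quad \nabla_\mu\big(e^{-2\alpha\varphi}F^{\mu\nu}\big)=0,\quad \nabla_\mu\nabla^\mu\varphi=-\tfrac{\alpha}{2}e^{-2\alpha\varphi}F_{\mu\nu}F^{\mu\nu}.$$ Here static means that $\xi$ is a timelike hypersurface-orthogonal Killing field of $g$ that leaves $F$ and $\varphi$ invariant, and asymptotically flat means that, in the given end, $g$ satisfies the same fall-off conditions as $g^E$, $\varphi=O(r^{-1})$, $\partial\varphi=O(r^{-2})$, $\partial\partial\varphi=O(r^{-3})$, and $F_{ij}=O(r^{-2})$, $\partial F_{ij}=O(r^{-3})$. Moreover, in each family the matrix $$S=\begin{pmatrix}e^{(1+\alpha)u+(\alpha-1)\varphi}-(1+\alpha^2)\Phi^2e^{(\alpha-1)u-(1+\alpha)\varphi}&-\sqrt{1+\alpha^2}\,\Phi e^{(\alpha-1)u-(1+\alpha)\varphi}\\-\sqrt{1+\alpha^2}\,\Phi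 e^{(\alpha-1)u-(1+\alpha)\varphi}&-e^{(\alpha-1)u-(1+\alpha)\varphi}\end{pmatrix}$$ equals $\sigma_3e^{Q\chi}$, $\sigma_3=\mathrm{diag}(1,-1)$, for a constant real matrix $Q=\begin{pmatrix}a&b'\\-b'&c\end{pmatrix}$ with $\mathrm{tr}\,Q^2=2(1+\alpha^2)$, where $\det Q<1+\alpha^2$ in family (1) if $\cos\omega\neq0$, $\det Q=1+\alpha^2$ in family (2), and $\det Q>1+\alpha^2$ in family (3) if $\psi\neq0$. -/

import Mathlib

open scoped Manifold ContDiff Matrix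

noncomputable section

namespace EMD

/-- The model space `ℝ⁴` of coordinates `(y⁰, y¹, y², y³)`. -/
abbrev E4 : Type := EuclideanSpace ℝ (Fin 4)

/-! ### Calculus of component functions on `ℝ⁴` -/

/-- The partial derivative `∂ᵢ f`. -/
def pd (i : Fin 4) (f : E4 → ℝ) (y : E4) : ℝ :=
  fderiv ℝ f y (EuclideanSpace.single i 1)

/-- The Christoffel symbol `Γᵏᵢⱼ` of the metric with component matrix `G`. -/
def christoffel (G : E4 → Matrix (Fin 4) (Fin 4) ℝ) (k i j : Fin 4) (y : E4) : ℝ :=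
  (1 / 2) * ∑ l, (G y)⁻¹ k l *
    (pd i (fun z => G z j l) y + pd j (fun z => G z i l) y - pd l (fun z => G z i j) y)

/-- The Ricci tensor
`Rᵢⱼ = ∂ₖ Γᵏᵢⱼ - ∂ⱼ Γᵏᵢₖ + Γᵏₖₗ Γˡᵢⱼ - Γᵏⱼₗ Γˡᵢₖ`. -/
def ricci (G : E4 → Matrix (Fin 4) (Fin 4) ℝ) (i j : Fin 4) (y : E4) : ℝ :=
  (∑ k, (pd k (christoffel G k i j) y - pd j (christoffel G k i k) y)) +
    ∑ k, ∑ l, (christoffel G k k l y * christoffel G l i j y -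
      christoffel G k j l y * christoffel G l i k y)

/-- The wave operator `□f = gⁱʲ (∂ᵢ∂ⱼ f - Γˡᵢⱼ ∂ₗ f)`. -/
def box (G : E4 → Matrix (Fin 4) (Fin 4) ℝ) (f : E4 → ℝ) (y : E4) : ℝ :=
  ∑ i, ∑ j, (G y)⁻¹ i j * (pd i (pd j f) y - ∑ l, christoffel G l i j y * pd l f y)

/-- The divergence `∇ᵢ Hⁱʲ = ∂ᵢ Hⁱʲ + Γⁱᵢₗ Hˡʲ + Γʲᵢₗ Hⁱˡ` of a contravariant 2-tensor. -/
def divergence (G H : E4 → Matrix (Fin 4) (Fin 4) ℝ) (j : Fin 4) (y : E4) : ℝ :=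
  ∑ i, (pd i (fun z => H z i j) y +
    ∑ l, (christoffel G i i l y * H y l j + christoffel G j i l y * H y i l))

/-- `Fⁱʲ = gⁱᵏ gʲˡ Fₖₗ`. -/
def raise (G F : E4 → Matrix (Fin 4) (Fin 4) ℝ) (y : E4) : Matrix (Fin 4) (Fin 4) ℝ :=
  fun i j => ∑ k, ∑ l, (G y)⁻¹ i k * (G y)⁻¹ j l * F y k l

/-- `F² = Fᵢⱼ Fⁱʲ`. -/
def normSq (G F : E4 → Matrix (Fin 4) (Fin 4) ℝ) (y : E4) : ℝ :=
  ∑ i, ∑ j, F y i j * raise G F y i j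

/-- The Lie derivative `(L_X T)ᵢⱼ = Xᵏ ∂ₖ Tᵢⱼ + Tₖⱼ ∂ᵢ Xᵏ + Tᵢₖ ∂ⱼ Xᵏ`. -/
def lieDeriv (X : Fin 4 → E4 → ℝ) (T : E4 → Matrix (Fin 4) (Fin 4) ℝ) (i j : Fin 4)
    (y : E4) : ℝ :=
  ∑ k, (X k y * pd k (fun z => T z i j) y + T y k j * pd i (X k) y + T y i k * pd j (X k) y)

/-- The Einstein-Maxwell-dilaton field equations with dilaton coupling `α`, the Euler-Lagrange
equations of `∫ √(-g) (R - 2 ∂ᵢφ ∂ⁱφ - exp(-2αφ) Fᵢⱼ Fⁱʲ)`, at the coordinate point `y`: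
* `Rᵢⱼ = 2 ∂ᵢφ ∂ⱼφ + 2 exp(-2αφ) (gᵏˡ Fᵢₖ Fⱼₗ - (1/4) gᵢⱼ F²)`,
* `∇ᵢ (exp(-2αφ) Fⁱʲ) = 0`,
* `□φ = -(α/2) exp(-2αφ) F²`. -/
structure FieldEquationsAt (α : ℝ) (G F : E4 → Matrix (Fin 4) (Fin 4) ℝ) (φ : E4 → ℝ)
    (y : E4) : Prop where
  einstein : ∀ i j, ricci G i j y = 2 * pd i φ y * pd j φ y +
    2 * Real.exp (-2 * α * φ y) *
      ((∑ k, ∑ l, (G y)⁻¹ k l * F y i k * F y j l) - (1 / 4) * G y i j * normSq G F y)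
  maxwell : ∀ j, divergence G (fun z => Real.exp (-2 * α * φ z) • raise G F z) j y = 0
  dilaton : box G φ y = -(α / 2) * Real.exp (-2 * α * φ y) * normSq G F y

/-! ### Tensor fields on a 4-manifold and their components in charts -/

section Manifold

variable {M : Type*} [TopologicalSpace M] [ChartedSpace E4 M]

variable (M) in
/-- (Not necessarily continuous) vector fields. -/
abbrev VectorField : Type _ := ∀ p : M, TangentSpace (𝓡 4) p

variable (M) in
/-- (Not necessarily continuous) one-forms. -/
abbrev OneForm : Type _ := ∀ p : M, TangentSpace (𝓡 4) p →ₗ[ℝ] ℝ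

variable (M) in
/-- (Not necessarily continuous) covariant 2-tensor fields. -/
abbrev TwoTensor : Type _ :=
  ∀ p : M, TangentSpace (𝓡 4) p →ₗ[ℝ] TangentSpace (𝓡 4) p →ₗ[ℝ] ℝ

/-- The differential `df`. -/
def differential (f : M → ℝ) : OneForm M := fun p =>
  let L : TangentSpace (𝓡 4) p →L[ℝ] ℝ := mfderiv (𝓡 4) 𝓘(ℝ, ℝ) f p
  L.toLinearMap

/-- The one-form `g(X, ·)`, that is, `X` with its index lowered by `g`. -/
def lower (g : TwoTensor M) (X : VectorField M) : OneForm M := fun p => g p (X p)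

/-- The tensor product `η ⊗ θ`. -/
def tmul (η θ : OneForm M) : TwoTensor M := fun p => (η p).smulRight (θ p)

/-- The wedge product `η ∧ θ = η ⊗ θ - θ ⊗ η`. -/
def wedge (η θ : OneForm M) : TwoTensor M := fun p => tmul η θ p - tmul θ η p

/-- The coordinate vector `∂ᵢ` of the chart `e`, at the point with coordinates `y`. -/
def coordVec (e : OpenPartialHomeomorph M E4) (i : Fin 4) (y : E4) :
    TangentSpace (𝓡 4) (e.symm y) :=
  mfderiv (𝓡 4) (𝓡 4) e.symm y (EuclideanSpace.single i (1 : ℝ) : E4)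

/-- The coordinate expression of a function. -/
def funComp (e : OpenPartialHomeomorph M E4) (f : M → ℝ) (y : E4) : ℝ := f (e.symm y)

/-- The components `Xⁱ` of a vector field in the chart `e`. -/
def vecComp (e : OpenPartialHomeomorph M E4) (X : VectorField M) (i : Fin 4) (y : E4) : ℝ :=
  let v : E4 := mfderiv (𝓡 4) (𝓡 4) e (e.symm y) (X (e.symm y))
  v i

/-- The components `ηᵢ` of a one-form in the chart `e`. -/
def formComp (e : OpenPartialHomeomorph M E4) (η : OneForm M) (i : Fin 4) (y : E4) : ℝ :=
  η (e.symm y) (coordVec e i y)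

/-- The components `Tᵢⱼ` of a covariant 2-tensor field in the chart `e`. -/
def tensorComp (e : OpenPartialHomeomorph M E4) (T : TwoTensor M) (y : E4) :
    Matrix (Fin 4) (Fin 4) ℝ :=
  fun i j => T (e.symm y) (coordVec e i y) (coordVec e j y)

variable (M) in
/-- The smooth charts of `M`: all charts of the maximal `C^∞` atlas. -/
abbrev smoothCharts : Set (OpenPartialHomeomorph M E4) := IsManifold.maximalAtlas (𝓡 4) ∞ M

/-- A smooth Lorentzian metric of signature `(-,+,+,+)`. -/
structure IsLorentzMetric (g : TwoTensor M) : Prop where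
  symm : ∀ (p : M) (v w : TangentSpace (𝓡 4) p), g p v w = g p w v
  signature : ∀ p : M, ∃ v : TangentSpace (𝓡 4) p, g p v v < 0 ∧
    ∀ w : TangentSpace (𝓡 4) p, g p v w = 0 → w ≠ 0 → 0 < g p w w
  smooth : ∀ e ∈ smoothCharts M, ∀ i j, ContDiffOn ℝ ∞ (fun y => tensorComp e g y i j) e.target

/-- The metric `g` is static with respect to `ξ`: `ξ` is a smooth timelike Killing field that is
hypersurface-orthogonal, i.e. `ξ♭ ∧ dξ♭ = 0` for `ξ♭ = g(ξ, ·)`. -/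
structure IsStatic (g : TwoTensor M) (ξ : VectorField M) : Prop where
  smooth : ∀ e ∈ smoothCharts M, ∀ i, ContDiffOn ℝ ∞ (vecComp e ξ i) e.target
  timelike : ∀ p, g p (ξ p) (ξ p) < 0
  killing : ∀ e ∈ smoothCharts M, ∀ y ∈ e.target, ∀ i j,
    lieDeriv (vecComp e ξ) (tensorComp e g) i j y = 0
  orthogonal : ∀ e ∈ smoothCharts M, ∀ y ∈ e.target, ∀ i j k,
    let η := formComp e (lower g ξ)
    η i y * (pd j (η k) y - pd k (η j) y) + η j y * (pd k (η i) y - pd i (η k) y) +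
      η k y * (pd i (η j) y - pd j (η i) y) = 0

/-- The vacuum Einstein equations `Ric(g) = 0`. -/
def IsVacuum (g : TwoTensor M) : Prop :=
  ∀ e ∈ smoothCharts M, ∀ y ∈ e.target, ∀ i j, ricci (tensorComp e g) i j y = 0

/-- `F = dA` for a smooth one-form `A` on `M`. -/
def HasPotential (F : TwoTensor M) : Prop :=
  ∃ A : OneForm M, ∀ e ∈ smoothCharts M,
    (∀ i, ContDiffOn ℝ ∞ (formComp e A i) e.target) ∧
    ∀ y ∈ e.target, ∀ i j,
      tensorComp e F y i j = pd i (formComp e A j) y - pd j (formComp e A i) y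

/-- `(g, F, φ)` is a smooth solution of Einstein-Maxwell-dilaton gravity with coupling `α`. -/
structure IsEMDSolution (α : ℝ) (g F : TwoTensor M) (φ : M → ℝ) : Prop where
  lorentz : IsLorentzMetric g
  potential : HasPotential F
  smooth : ContMDiff (𝓡 4) 𝓘(ℝ, ℝ) ∞ φ
  equations : ∀ e ∈ smoothCharts M, ∀ y ∈ e.target,
    FieldEquationsAt α (tensorComp e g) (tensorComp e F) (funComp e φ) y

/-- The solution `(g, F, φ)` is static with respect to `ξ`: the metric is static, and `F` and `φ`
are invariant under `ξ`. -/
structure IsStaticSolution (g F : TwoTensor M) (φ : M → ℝ) (ξ : VectorField M) : Prop where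
  metric : IsStatic g ξ
  maxwell : ∀ e ∈ smoothCharts M, ∀ y ∈ e.target, ∀ i j,
    lieDeriv (vecComp e ξ) (tensorComp e F) i j y = 0
  dilaton : ∀ p, differential φ p (ξ p) = 0

/-! ### Asymptotic flatness -/

/-- The spatial coordinate radius `r`. -/
def radius (y : E4) : ℝ := √(y 1 ^ 2 + y 2 ^ 2 + y 3 ^ 2)

/-- `f = O(r⁻ⁿ)` as `r → ∞` (uniformly in time and direction), `∂f = O(r⁻ⁿ⁻¹)`, and so on up to
the derivatives of order `k`, which are `O(r⁻ⁿ⁻ᵏ)`. -/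
def FallsOff : ℕ → ℕ → (E4 → ℝ) → Prop
  | 0, n, f => f =O[Filter.comap radius Filter.atTop] fun y => (radius y ^ n)⁻¹
  | k + 1, n, f => (f =O[Filter.comap radius Filter.atTop] fun y => (radius y ^ n)⁻¹) ∧
      ∀ i, FallsOff k (n + 1) (pd i f)

/-- The chart `e` is an asymptotic end adapted to `ξ`: its range contains the region outside a
coordinate ball, `ℝ × {x ∈ ℝ³ : |x| > R}`, where `ξ = ∂/∂y⁰`. -/
def IsEnd (e : OpenPartialHomeomorph M E4) (ξ : VectorField M) : Prop :=
  e ∈ smoothCharts M ∧ ∃ R : ℝ, ∀ y, R < radius y →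
    y ∈ e.target ∧ ∀ i, vecComp e ξ i y = if i = 0 then 1 else 0

/-- The metric is asymptotically flat in the end `e`: `gᵢⱼ = ηᵢⱼ + O(r⁻¹)` with
`η = diag(-1,1,1,1)`, `∂gᵢⱼ = O(r⁻²)` and `∂∂gᵢⱼ = O(r⁻³)`. -/
def IsAsymptoticallyFlat (e : OpenPartialHomeomorph M E4) (g : TwoTensor M) : Prop :=
  ∀ i j, FallsOff 2 1 fun y =>
    tensorComp e g y i j - (Matrix.diagonal ![-1, 1, 1, 1] : Matrix (Fin 4) (Fin 4) ℝ) i j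

/-- The solution `(g, F, φ)` is asymptotically flat in the end `e`: the metric is, and the matter
fields fall off as `φ = O(r⁻¹)` (with two derivatives) and `Fᵢⱼ = O(r⁻²)` (with one). -/
structure IsAsymptoticallyFlatSolution (e : OpenPartialHomeomorph M E4) (g F : TwoTensor M)
    (φ : M → ℝ) : Prop where
  metric : IsAsymptoticallyFlat e g
  maxwell : ∀ i j, FallsOff 1 2 fun y => tensorComp e F y i j
  dilaton : FallsOff 2 1 (funComp e φ)

/-! ### The generated fields -/

/-- `g = e^{2χ-2u} gᴱ + (e^{-2u} - e^{2u-4χ}) ξ♭ ⊗ ξ♭` with `ξ♭ = gᴱ(ξ, ·)`. -/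
def newMetric (gE : TwoTensor M) (ξ : VectorField M) (χ u : M → ℝ) : TwoTensor M := fun p =>
  Real.exp (2 * χ p - 2 * u p) • gE p +
    (Real.exp (-2 * u p) - Real.exp (2 * u p - 4 * χ p)) • tmul (lower gE ξ) (lower gE ξ) p

/-- `F = e^{-2u} ξ♭ ∧ dΦ` with `ξ♭ = g(ξ, ·)`. -/
def electricField (g : TwoTensor M) (ξ : VectorField M) (u Φ : M → ℝ) : TwoTensor M := fun p =>
  Real.exp (-2 * u p) • wedge (lower g ξ) (differential Φ) p

end Manifold

/-! ### The three families -/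

/-- The first family, with parameters `Γ, θ`; the expressions are real as `Γ² < 1` and
`1 - Γ² e^{2χ√(1+α²) cos θ} > 0`. -/
def FirstClass {M : Type*} (α Γ θ : ℝ) (χ u φ Φ : M → ℝ) : Prop :=
  let k := √(1 + α ^ 2)
  let θα := Real.arcsin (α / k)
  Γ ^ 2 < 1 ∧ ∀ p,
    0 < 1 - Γ ^ 2 * Real.exp (2 * χ p * k * Real.cos θ) ∧
    Real.exp (2 * u p) = (1 - Γ ^ 2) ^ (2 / (1 + α ^ 2)) *
      (Real.exp (2 * χ p * Real.cos (θ - θα)) /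
        (1 - Γ ^ 2 * Real.exp (2 * χ p * k * Real.cos θ)) ^ (2 / (1 + α ^ 2))) ∧
    Real.exp (2 * φ p) = (1 - Γ ^ 2) ^ (2 * α / (1 + α ^ 2)) *
      (Real.exp (-2 * χ p * Real.sin (θ - θα)) /
        (1 - Γ ^ 2 * Real.exp (2 * χ p * k * Real.cos θ)) ^ (2 * α / (1 + α ^ 2))) ∧
    Φ p = Γ / k * ((1 - Real.exp (2 * χ p * k * Real.cos θ)) /
      (1 - Γ ^ 2 * Real.exp (2 * χ p * k * Real.cos θ)))

/-- The second family, with parameter `b`; the expressions are real as `1 - bχ > 0`. -/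
def SecondClass {M : Type*} (α b : ℝ) (χ u φ Φ : M → ℝ) : Prop :=
  let k := √(1 + α ^ 2)
  ∀ p,
    0 < 1 - b * χ p ∧
    Real.exp (2 * u p) =
      Real.exp (2 * α / k * χ p) / (1 - b * χ p) ^ (2 / (1 + α ^ 2)) ∧
    Real.exp (2 * φ p) =
      Real.exp (-(2 / k) * χ p) / (1 - b * χ p) ^ (2 * α / (1 + α ^ 2)) ∧
    Φ p = -(1 / k) * (b * χ p / (1 - b * χ p))

/-- The third family, with parameters `ψ, ϑ`; the expressions are real as `cos ϑ > 0` and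
`cos(χ√(1+α²) sinh ψ + ϑ) > 0`. -/
def ThirdClass {M : Type*} (α ψ ϑ : ℝ) (χ u φ Φ : M → ℝ) : Prop :=
  let k := √(1 + α ^ 2)
  0 < Real.cos ϑ ∧ ∀ p,
    0 < Real.cos (χ p * k * Real.sinh ψ + ϑ) ∧
    Real.exp (2 * u p) = Real.exp (2 * α * χ p / k * Real.cosh ψ) *
      (Real.cos ϑ ^ (2 / (1 + α ^ 2)) /
        Real.cos (χ p * k * Real.sinh ψ + ϑ) ^ (2 / (1 + α ^ 2))) ∧
    Real.exp (2 * φ p) = Real.exp (-(2 * χ p / k) * Real.cosh ψ) *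
      (Real.cos ϑ ^ (2 * α / (1 + α ^ 2)) /
        Real.cos (χ p * k * Real.sinh ψ + ϑ) ^ (2 * α / (1 + α ^ 2))) ∧
    Φ p = -(1 / k) * (Real.sin (χ p * k * Real.sinh ψ) /
      Real.cos (χ p * k * Real.sinh ψ + ϑ))

/-- The symmetric matrix `S` of the three potentials. -/
def potentialMatrix (α u φ Φ : ℝ) : Matrix (Fin 2) (Fin 2) ℝ :=
  !![Real.exp ((1 + α) * u + (α - 1) * φ) -
        (1 + α ^ 2) * Φ ^ 2 * Real.exp ((α - 1) * u - (1 + α) * φ),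
      -√(1 + α ^ 2) * Φ * Real.exp ((α - 1) * u - (1 + α) * φ);
     -√(1 + α ^ 2) * Φ * Real.exp ((α - 1) * u - (1 + α) * φ),
      -Real.exp ((α - 1) * u - (1 + α) * φ)]

/-- `S = σ₃ e^{Qχ}` with `Q = (a b; -b c)` subject to the normalization `tr Q² = 2 (1 + α²)`,
which is the condition `-(1/(2(1+α²))) tr (S' (S⁻¹)') = 1` on `S` as a function of `χ`. -/
def IsGeneratedBy {M : Type*} (α : ℝ) (Q : Matrix (Fin 2) (Fin 2) ℝ) (χ u φ Φ : M → ℝ) : Prop :=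
  (∃ a b c : ℝ, Q = !![a, b; -b, c]) ∧ (Q * Q).trace = 2 * (1 + α ^ 2) ∧
    ∀ p, potentialMatrix α (u p) (φ p) (Φ p) =
      !![1, 0; 0, -1] * NormedSpace.exp (χ p • Q)

end EMD

end

/-!
Locally a static metric with `ξ♭ = g(ξ, ·)` and `-g(ξ, ξ) = e^{2u}` has the form
`e^{-2u} γ - e^{2u} τ ⊗ τ`, where `τ = e^{-2u} ξ♭` is closed, `τ(ξ) = -1`, and `γ` is an invariant
symmetric form with kernel `ξ` (`staticFrame_of_static`, `staticMetric`). Passing from `gᴱ` to `g`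
keeps `γ` and `τ` and only replaces the function `χ` by `u` (`tensorComp_newMetric`), and the
electric field becomes `F = τ ∧ dΦ`. So everything can be compared with the one auxiliary
Lorentzian metric `B = γ - τ ⊗ τ` (`baseMetric`), for which `ξ` and `τ` are parallel.

The Christoffel symbols of the static metric of an invariant function `u` differ from those of `B`
by an explicit tensor (`connectionShift`), and the Ricci tensors are related by
`Ric = Ric(B) - 2 du ⊗ du + □u (γ + e^{4u} τ ⊗ τ)` (`StaticFrame.ricci_staticMetric`), with `□`
the wave operator of `B`. In vacuum, contraction with `ξ` twice shows that `χ` is harmonic,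
`□χ = 0`, and then `Ric(B) = 2 dχ ⊗ dχ`. For functions `u = U(χ)`, `φ = V(χ)`, `Φ = W(χ)` one has
`□u = U''(χ) |dχ|²`, and so on, so that all field equations reduce to the ordinary differential
equations `U'' = c² e^{2(U+αV)}`, `V'' = α U''`, `W' = c e^{2(U+αV)}` and to the conservation law
`U'² + V'² - U'' = 1` (`GeneratingCurve`, `StaticFrame.fieldEquations`). Each of the three families
is of the form `U = a t - log w / (1 + α²)`, `V = b t - α log w / (1 + α²)`, for a function `w`
that is affine in an exponential, affine, or a phase-shifted cosine, and solves this system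
(`generatingCurve_of_profile`, `exists_generatingCurve`).

For the asymptotics, `χ = ½ log (-gᴱ₀₀)` is `O(1/r)` in the end, with its derivatives. The
functions with fall-off are closed under sums, products, and composition with smooth functions
(`FallsOff.mul`, `FallsOff.comp`), and `U`, `V`, `W` vanish at `0`, so the new fields decay as well.

The matrix `Q` of each family is `n + N` for a scalar `n` and a traceless matrix `N` whose square
is a nonnegative multiple of `1` in the first family, zero in the second and a nonpositive
multiple of `1` in the third. Its exponential is therefore given by hyperbolic functions, by an
affine function, or by trigonometric functions, and the sign of `N²` decides the comparison of
`det Q` with `1 + α²`.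
-/

noncomputable section

namespace EMD

/-! ### Partial derivatives of component functions -/

section PartialDerivatives

variable {s : Set E4} {f f' : E4 → ℝ} {y : E4}

lemma pd_congr (h : f =ᶠ[nhds y] f') (i : Fin 4) : pd i f y = pd i f' y := by
  simp only [pd, h.fderiv_eq]

lemma pd_congr_on (hs : IsOpen s) (h : ∀ z ∈ s, f z = f' z) (hy : y ∈ s) (i : Fin 4) :
    pd i f y = pd i f' y :=
  pd_congr (Filter.eventually_of_mem (hs.mem_nhds hy) h) i

@[simp] lemma pd_const (i : Fin 4) (c : ℝ) (y : E4) : pd i (fun _ => c) y = 0 := by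
  simp [pd]

lemma pd_add (i : Fin 4) (hf : DifferentiableAt ℝ f y) (hf' : DifferentiableAt ℝ f' y) :
    pd i (fun z => f z + f' z) y = pd i f y + pd i f' y := by
  simp only [pd, fderiv_fun_add hf hf', add_apply]

lemma pd_sub (i : Fin 4) (hf : DifferentiableAt ℝ f y) (hf' : DifferentiableAt ℝ f' y) :
    pd i (fun z => f z - f' z) y = pd i f y - pd i f' y := by
  simp only [pd, fderiv_fun_sub hf hf', sub_apply]

lemma pd_neg (i : Fin 4) : pd i (fun z => -f z) y = -pd i f y := by
  simp only [pd, fderiv_fun_neg, neg_apply]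

lemma pd_mul (i : Fin 4) (hf : DifferentiableAt ℝ f y) (hf' : DifferentiableAt ℝ f' y) :
    pd i (fun z => f z * f' z) y = f y * pd i f' y + f' y * pd i f y := by
  simp only [pd, fderiv_fun_mul hf hf', add_apply,
    _root_.smul_apply, smul_eq_mul]

lemma pd_sum {ι : Type*} (t : Finset ι) {f : ι → E4 → ℝ} (i : Fin 4)
    (hf : ∀ k ∈ t, DifferentiableAt ℝ (f k) y) :
    pd i (fun z => ∑ k ∈ t, f k z) y = ∑ k ∈ t, pd i (f k) y := by
  simp only [pd, fderiv_fun_sum hf, sum_apply]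

/-- The chain rule for a function of one real variable. -/
lemma pd_comp {Ψ : ℝ → ℝ} {Ψ' : ℝ} (i : Fin 4) (hΨ : HasDerivAt Ψ Ψ' (f y))
    (hf : DifferentiableAt ℝ f y) : pd i (fun z => Ψ (f z)) y = Ψ' * pd i f y := by
  have := (hΨ.comp_hasFDerivAt y hf.hasFDerivAt).fderiv
  simp only [pd]
  rw [show (fun z => Ψ (f z)) = Ψ ∘ f from rfl, this]
  simp

lemma contDiffOn_pd (hs : IsOpen s) (hf : ContDiffOn ℝ ∞ f s) (i : Fin 4) :
    ContDiffOn ℝ ∞ (pd i f) s :=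
  (hf.fderiv_of_isOpen hs (m := ∞) (by simp)).clm_apply contDiffOn_const

lemma differentiableAt_of_contDiffOn (hs : IsOpen s) (hf : ContDiffOn ℝ ∞ f s) (hy : y ∈ s) :
    DifferentiableAt ℝ f y :=
  (hf.differentiableOn (by simp)).differentiableAt (hs.mem_nhds hy)

lemma pd_comm (hs : IsOpen s) (hf : ContDiffOn ℝ ∞ f s) (hy : y ∈ s) (i j : Fin 4) :
    pd i (pd j f) y = pd j (pd i f) y := by
  have h2 : ContDiffAt ℝ ∞ f y := hf.contDiffAt (hs.mem_nhds hy)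
  have hd : DifferentiableAt ℝ (fderiv ℝ f) y :=
    ((hf.fderiv_of_isOpen hs (m := ∞) (by simp)).differentiableOn
      (by simp)).differentiableAt (hs.mem_nhds hy)
  have key : ∀ a b : Fin 4, pd a (pd b f) y =
      fderiv ℝ (fderiv ℝ f) y (EuclideanSpace.single a 1) (EuclideanSpace.single b 1) := by
    intro a b
    have : fderiv ℝ (pd b f) y = (fderiv ℝ (fderiv ℝ f) y).flip (EuclideanSpace.single b 1) := by
      have := fderiv_clm_apply hd (differentiableAt_const (EuclideanSpace.single b (1 : ℝ) : E4))
      rw [show pd b f = fun z => fderiv ℝ f z (EuclideanSpace.single b 1) from rfl]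
      simpa using this
    change fderiv ℝ (pd b f) y _ = _
    rw [this]; rfl
  rw [key, key]
  refine (h2.isSymmSndFDerivAt ?_).eq _ _
  rw [minSmoothness_of_isRCLikeNormedField]
  exact WithTop.coe_le_coe.2 le_top

end PartialDerivatives

lemma contDiffOn_matrix_inv {s : Set E4} {B : E4 → Matrix (Fin 4) (Fin 4) ℝ}
    (hB : ∀ i j, ContDiffOn ℝ ∞ (fun y => B y i j) s) (hdet : ∀ y ∈ s, (B y).det ≠ 0)
    (i j : Fin 4) : ContDiffOn ℝ ∞ (fun y => (B y)⁻¹ i j) s := by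
  have hd : ∀ A : E4 → Matrix (Fin 4) (Fin 4) ℝ,
      (∀ i j, ContDiffOn ℝ ∞ (fun y => A y i j) s) → ContDiffOn ℝ ∞ (fun y => (A y).det) s := by
    intro A hA
    simp only [Matrix.det_apply']
    exact ContDiffOn.sum fun σ _ => contDiffOn_const.mul (contDiffOn_prod fun k _ => hA _ _)
  have ha : ContDiffOn ℝ ∞ (fun y => (B y).adjugate i j) s := by
    simp only [Matrix.adjugate_apply]
    refine hd _ fun k l => ?_
    by_cases hk : k = j
    · subst hk; simpa using contDiffOn_const
    · simpa [Matrix.updateRow_ne hk] using hB k l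
  have : (fun y => (B y)⁻¹ i j) = fun y => ((B y).det)⁻¹ * (B y).adjugate i j := by
    funext y
    simp [Matrix.inv_def]
  rw [this]
  exact ((hd B hB).inv hdet).mul ha

/-! ### The Levi-Civita connection in coordinates -/

section LeviCivita

variable {s : Set E4} {G : E4 → Matrix (Fin 4) (Fin 4) ℝ} {y : E4}

/-- Metric compatibility and symmetry determine the Christoffel symbols. -/
lemma christoffel_eq_of_compatible (hdet : (G y).det ≠ 0)
    (hG : ∀ i j, G y i j = G y j i) {A : Fin 4 → Fin 4 → Fin 4 → ℝ}
    (hA : ∀ k i j, A k i j = A k j i)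
    (hcomp : ∀ l i j, pd l (fun z => G z i j) y =
      ∑ m, (A m l i * G y m j + A m l j * G y i m)) (k i j : Fin 4) :
    christoffel G k i j y = A k i j := by
  have hK : ∀ m, ∑ l, (G y)⁻¹ k l * G y l m = if k = m then 1 else 0 := by
    intro m
    rw [← Matrix.mul_apply, Matrix.nonsing_inv_mul _ (isUnit_iff_ne_zero.2 hdet),
      Matrix.one_apply]
  have hbr : ∀ l, pd i (fun z => G z j l) y + pd j (fun z => G z i l) y -
      pd l (fun z => G z i j) y = 2 * ∑ m, A m i j * G y l m := by
    intro l
    rw [hcomp, hcomp, hcomp, Finset.mul_sum, ← Finset.sum_add_distrib, ← Finset.sum_sub_distrib]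
    refine Finset.sum_congr rfl fun m _ => ?_
    rw [hA m j i, hA m l i, hA m l j, hG m l, hG j m]
    ring
  calc christoffel G k i j y
      = ∑ l, ∑ m, A m i j * ((G y)⁻¹ k l * G y l m) := by
        simp only [christoffel, hbr, Finset.mul_sum]
        refine Finset.sum_congr rfl fun l _ => Finset.sum_congr rfl fun m _ => ?_
        ring
    _ = ∑ m, A m i j * ∑ l, (G y)⁻¹ k l * G y l m := by
        rw [Finset.sum_comm]; simp only [Finset.mul_sum]
    _ = A k i j := by simp [hK]

lemma christoffel_symm (hs : IsOpen s) (hG : ∀ z ∈ s, ∀ i j, G z i j = G z j i) (hy : y ∈ s)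
    (k i j : Fin 4) : christoffel G k i j y = christoffel G k j i y := by
  simp only [christoffel]
  congr 1
  refine Finset.sum_congr rfl fun l _ => ?_
  rw [pd_congr_on hs (fun z hz => hG z hz i j) hy l]
  ring

/-- The lowered Christoffel symbols `Γⱼₗᵢ`. -/
lemma sum_mul_christoffel (hdet : (G y).det ≠ 0) (j l i : Fin 4) :
    ∑ m, G y j m * christoffel G m l i y = (1 / 2) * (pd l (fun z => G z i j) y +
      pd i (fun z => G z l j) y - pd j (fun z => G z l i) y) := by
  have hK : ∀ m, ∑ l, G y j l * (G y)⁻¹ l m = if j = m then 1 else 0 := by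
    intro m
    rw [← Matrix.mul_apply, Matrix.mul_nonsing_inv _ (isUnit_iff_ne_zero.2 hdet),
      Matrix.one_apply]
  set b : Fin 4 → ℝ := fun a => pd l (fun z => G z i a) y + pd i (fun z => G z l a) y -
    pd a (fun z => G z l i) y with hb
  calc ∑ m, G y j m * christoffel G m l i y
      = ∑ m, ∑ a, (1 / 2) * b a * (G y j m * (G y)⁻¹ m a) := by
        simp only [christoffel, Finset.mul_sum, hb]
        refine Finset.sum_congr rfl fun l _ => Finset.sum_congr rfl fun m _ => ?_
        ring
    _ = ∑ a, (1 / 2) * b a * ∑ m, G y j m * (G y)⁻¹ m a := by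
        rw [Finset.sum_comm]; simp only [Finset.mul_sum]
    _ = (1 / 2) * b j := by simp [hK]

/-- The Levi-Civita connection is compatible with the metric. -/
lemma pd_metric (hs : IsOpen s) (hG : ∀ z ∈ s, ∀ i j, G z i j = G z j i)
    (hdet : (G y).det ≠ 0) (hy : y ∈ s) (l i j : Fin 4) :
    pd l (fun z => G z i j) y =
      ∑ m, (christoffel G m l i y * G y m j + christoffel G m l j y * G y i m) := by
  have h1 := sum_mul_christoffel hdet j l i
  have h2 := sum_mul_christoffel hdet i l j
  rw [pd_congr_on hs (fun z hz => hG z hz j i) hy l] at h2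
  rw [pd_congr_on hs (fun z hz => hG z hz l i) hy j,
    pd_congr_on hs (fun z hz => hG z hz l j) hy i] at h1
  rw [pd_congr_on hs (fun z hz => hG z hz j l) hy i] at h1
  have h3 : ∑ m, (christoffel G m l i y * G y m j + christoffel G m l j y * G y i m) =
      ∑ m, G y j m * christoffel G m l i y + ∑ m, G y i m * christoffel G m l j y := by
    rw [← Finset.sum_add_distrib]
    refine Finset.sum_congr rfl fun m _ => ?_
    rw [hG y hy m j]; ring
  rw [h3, h1, h2, pd_congr_on hs (fun z hz => hG z hz i l) hy j,
    pd_congr_on hs (fun z hz => hG z hz l j) hy i,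
    pd_congr_on hs (fun z hz => hG z hz j l) hy i]
  ring

lemma contDiffOn_christoffel (hs : IsOpen s)
    (hsm : ∀ i j, ContDiffOn ℝ ∞ (fun y => G y i j) s) (hdet : ∀ y ∈ s, (G y).det ≠ 0)
    (k i j : Fin 4) : ContDiffOn ℝ ∞ (christoffel G k i j) s := by
  unfold christoffel
  exact contDiffOn_const.mul (ContDiffOn.sum fun l _ => (contDiffOn_matrix_inv hsm hdet k l).mul
    (((contDiffOn_pd hs (hsm j l) i).add (contDiffOn_pd hs (hsm i l) j)).sub
      (contDiffOn_pd hs (hsm i j) l)))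

lemma inv_symm (hG : ∀ i j, G y i j = G y j i) (i j : Fin 4) :
    (G y)⁻¹ i j = (G y)⁻¹ j i := by
  have : (G y)ᵀ = G y := by ext a b; exact hG b a
  calc (G y)⁻¹ i j = ((G y)ᵀ)⁻¹ i j := by rw [this]
    _ = (G y)⁻¹ j i := by rw [← Matrix.transpose_nonsing_inv]; rfl

/-- The inverse metric is covariantly constant. -/
lemma pd_inv (hs : IsOpen s) (hG : ∀ z ∈ s, ∀ i j, G z i j = G z j i)
    (hsm : ∀ i j, ContDiffOn ℝ ∞ (fun y => G y i j) s)
    (hdet : ∀ y ∈ s, (G y).det ≠ 0) (hy : y ∈ s) (k a b : Fin 4) :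
    pd k (fun z => (G z)⁻¹ a b) y = -∑ l, (christoffel G a k l y * (G y)⁻¹ l b +
      christoffel G b k l y * (G y)⁻¹ a l) := by
  have hu := isUnit_iff_ne_zero.2 (hdet y hy)
  have hd : ∀ c d, DifferentiableAt ℝ (fun z => G z c d) y := fun c d =>
    differentiableAt_of_contDiffOn hs (hsm c d) hy
  have hd' : ∀ c d, DifferentiableAt ℝ (fun z => (G z)⁻¹ c d) y := fun c d =>
    differentiableAt_of_contDiffOn hs (contDiffOn_matrix_inv hsm hdet c d) hy
  -- differentiate `G⁻¹ G = 1`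
  have h0 : ∀ c, ∑ l, ((G y)⁻¹ a l * pd k (fun z => G z l c) y +
      G y l c * pd k (fun z => (G z)⁻¹ a l) y) = 0 := by
    intro c
    have h1 : pd k (fun z => ∑ l, (G z)⁻¹ a l * G z l c) y = 0 := by
      rw [pd_congr_on hs (f' := fun _ => if a = c then 1 else 0) ?_ hy, pd_const]
      intro z hz
      rw [← Matrix.mul_apply, Matrix.nonsing_inv_mul _ (isUnit_iff_ne_zero.2 (hdet z hz)),
        Matrix.one_apply]
    rw [pd_sum _ _ fun l _ => (hd' a l).fun_mul (hd l c)] at h1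
    rw [← h1]
    exact Finset.sum_congr rfl fun l _ => (pd_mul k (hd' a l) (hd l c)).symm
  obtain ⟨D, hDD⟩ : ∃ D : Matrix (Fin 4) (Fin 4) ℝ, ∀ c d, D c d = pd k (fun z => (G z)⁻¹ c d) y :=
    ⟨Matrix.of fun c d => pd k (fun z => (G z)⁻¹ c d) y, fun _ _ => rfl⟩
  obtain ⟨A, hAA⟩ : ∃ A : Matrix (Fin 4) (Fin 4) ℝ, ∀ c d, A c d = christoffel G c k d y :=
    ⟨Matrix.of fun c d => christoffel G c k d y, fun _ _ => rfl⟩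
  obtain ⟨P, hPP⟩ : ∃ P : Matrix (Fin 4) (Fin 4) ℝ, ∀ c d, P c d = pd k (fun z => G z c d) y :=
    ⟨Matrix.of fun c d => pd k (fun z => G z c d) y, fun _ _ => rfl⟩
  have hP : P = Aᵀ * G y + G y * A := by
    ext c d
    simp only [hPP, pd_metric hs hG (hdet y hy) hy, Matrix.add_apply, Matrix.mul_apply,
      Matrix.transpose_apply, hAA, ← Finset.sum_add_distrib]
    exact Finset.sum_congr rfl fun m _ => by ring
  have h1 : ∀ c, ((G y)⁻¹ * P + D * G y) a c = 0 := by
    intro c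
    rw [← h0 c]
    simp only [Matrix.add_apply, Matrix.mul_apply, hDD, hPP, ← Finset.sum_add_distrib]
    exact Finset.sum_congr rfl fun m _ => by ring
  have h2 : (((G y)⁻¹ * P + D * G y) * (G y)⁻¹) a b = 0 := by
    simp [Matrix.mul_apply (M := _ + _), h1]
  have h3 : ((G y)⁻¹ * P + D * G y) * (G y)⁻¹ = (G y)⁻¹ * Aᵀ + A * (G y)⁻¹ + D := by
    rw [hP, Matrix.add_mul, Matrix.mul_nonsing_inv_cancel_right _ _ hu, Matrix.mul_add,
      Matrix.nonsing_inv_mul_cancel_left _ _ hu, Matrix.add_mul, ← Matrix.mul_assoc,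
      Matrix.mul_nonsing_inv_cancel_right _ _ hu]
  rw [h3] at h2
  simp only [Matrix.add_apply, Matrix.mul_apply, Matrix.transpose_apply, hAA, hDD] at h2
  rw [Finset.sum_add_distrib]
  have h4 : ∑ l, christoffel G b k l y * (G y)⁻¹ a l =
    ∑ l, (G y)⁻¹ a l * christoffel G b k l y := Finset.sum_congr rfl fun m _ => mul_comm _ _
  linarith

end LeviCivita

/-! ### Static metrics over a fixed spatial geometry -/

/-- The metric `γ - τ ⊗ τ`. -/
def baseMetric (γ : E4 → Matrix (Fin 4) (Fin 4) ℝ) (τ : Fin 4 → E4 → ℝ) (y : E4) :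
    Matrix (Fin 4) (Fin 4) ℝ :=
  Matrix.of fun i j => γ y i j - τ i y * τ j y

/-- The metric `e^{-2u} γ - e^{2u} τ ⊗ τ`. -/
def staticMetric (γ : E4 → Matrix (Fin 4) (Fin 4) ℝ) (τ : Fin 4 → E4 → ℝ) (u : E4 → ℝ) (y : E4) :
    Matrix (Fin 4) (Fin 4) ℝ :=
  Matrix.of fun i j => Real.exp (-2 * u y) * γ y i j - Real.exp (2 * u y) * (τ i y * τ j y)

/-- Coordinate data of a static geometry on the open set `s`: a vector field `ξ`, a closed one-form
`τ` with `τ(ξ) = -1`, and a `ξ`-invariant symmetric tensor `γ` whose kernel is spanned by `ξ`.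
In coordinates adapted to `ξ` one has `ξ = ∂ₜ`, `τ = -dt`, and `γ` is a spatial metric. -/
structure StaticFrame (s : Set E4) (γ : E4 → Matrix (Fin 4) (Fin 4) ℝ)
    (τ ξ : Fin 4 → E4 → ℝ) : Prop where
  isOpen : IsOpen s
  smooth_γ : ∀ i j, ContDiffOn ℝ ∞ (fun y => γ y i j) s
  smooth_τ : ∀ i, ContDiffOn ℝ ∞ (τ i) s
  smooth_ξ : ∀ i, ContDiffOn ℝ ∞ (ξ i) s
  symm : ∀ y ∈ s, ∀ i j, γ y i j = γ y j i
  ker : ∀ y ∈ s, ∀ i, ∑ j, γ y i j * ξ j y = 0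
  pairing : ∀ y ∈ s, ∑ i, τ i y * ξ i y = -1
  closed : ∀ y ∈ s, ∀ i j, pd i (τ j) y = pd j (τ i) y
  invariant : ∀ y ∈ s, ∀ i j, lieDeriv ξ γ i j y = 0
  nondeg : ∀ y ∈ s, (baseMetric γ τ y).det ≠ 0

/-- The gradient of `f` with respect to `B`. -/
def gradient (B : E4 → Matrix (Fin 4) (Fin 4) ℝ) (f : E4 → ℝ) (a : Fin 4) (y : E4) : ℝ :=
  ∑ l, (B y)⁻¹ a l * pd l f y

/-- The Hessian `∂ᵢ∂ⱼ f - Γˡᵢⱼ ∂ₗ f` of `f` with respect to `B`. -/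
def hessian (B : E4 → Matrix (Fin 4) (Fin 4) ℝ) (f : E4 → ℝ) (i j : Fin 4) (y : E4) : ℝ :=
  pd i (pd j f) y - ∑ l, christoffel B l i j y * pd l f y

lemma pd_pd_eq_hessian_add (B : E4 → Matrix (Fin 4) (Fin 4) ℝ) (f : E4 → ℝ) (i j : Fin 4)
    (y : E4) :
    pd i (pd j f) y = hessian B f i j y + ∑ l, christoffel B l i j y * pd l f y := by
  simp only [hessian]; ring

namespace StaticFrame

variable {s : Set E4} {γ : E4 → Matrix (Fin 4) (Fin 4) ℝ} {τ ξ : Fin 4 → E4 → ℝ}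
  (h : StaticFrame s γ τ ξ) {y : E4} {f : E4 → ℝ}
include h

lemma diff_γ (hy : y ∈ s) (i j : Fin 4) : DifferentiableAt ℝ (fun z => γ z i j) y :=
  differentiableAt_of_contDiffOn h.isOpen (h.smooth_γ i j) hy

lemma diff_τ (hy : y ∈ s) (i : Fin 4) : DifferentiableAt ℝ (τ i) y :=
  differentiableAt_of_contDiffOn h.isOpen (h.smooth_τ i) hy

lemma diff_ξ (hy : y ∈ s) (i : Fin 4) : DifferentiableAt ℝ (ξ i) y :=
  differentiableAt_of_contDiffOn h.isOpen (h.smooth_ξ i) hy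

lemma base_symm (z : E4) (hz : z ∈ s) (i j : Fin 4) :
    baseMetric γ τ z i j = baseMetric γ τ z j i := by
  simp only [baseMetric, Matrix.of_apply, h.symm z hz i j]; ring

lemma base_smooth (i j : Fin 4) : ContDiffOn ℝ ∞ (fun y => baseMetric γ τ y i j) s :=
  (h.smooth_γ i j).sub ((h.smooth_τ i).mul (h.smooth_τ j))

lemma base_mul_ξ (hy : y ∈ s) (i : Fin 4) : ∑ j, baseMetric γ τ y i j * ξ j y = τ i y := by
  have h1 := h.ker y hy i
  have h2 := h.pairing y hy
  simp only [baseMetric, Matrix.of_apply, Fin.sum_univ_four] at *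
  linear_combination h1 - τ i y * h2

lemma inv_mul_τ (hy : y ∈ s) (i : Fin 4) : ∑ j, (baseMetric γ τ y)⁻¹ i j * τ j y = ξ i y := by
  have h1 : (baseMetric γ τ y) *ᵥ (fun j => ξ j y) = fun j => τ j y := by
    ext i; exact h.base_mul_ξ hy i
  have h2 : (baseMetric γ τ y)⁻¹ *ᵥ (fun j => τ j y) = fun j => ξ j y := by
    rw [← h1, Matrix.mulVec_mulVec,
      Matrix.nonsing_inv_mul _ (isUnit_iff_ne_zero.2 (h.nondeg y hy)), Matrix.one_mulVec]
  exact congrFun h2 i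

lemma inv_base_symm (hy : y ∈ s) (i j : Fin 4) :
    (baseMetric γ τ y)⁻¹ i j = (baseMetric γ τ y)⁻¹ j i :=
  inv_symm (h.base_symm y hy) i j

lemma conn_symm (hy : y ∈ s) (k i j : Fin 4) :
    christoffel (baseMetric γ τ) k i j y = christoffel (baseMetric γ τ) k j i y :=
  christoffel_symm h.isOpen h.base_symm hy k i j

lemma pd_base (hy : y ∈ s) (l i j : Fin 4) : pd l (fun z => baseMetric γ τ z i j) y =
    ∑ m, (christoffel (baseMetric γ τ) m l i y * baseMetric γ τ y m j +
      christoffel (baseMetric γ τ) m l j y * baseMetric γ τ y i m) :=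
  pd_metric h.isOpen h.base_symm (h.nondeg y hy) hy l i j

lemma pd_base_eq (hy : y ∈ s) (l i j : Fin 4) : pd l (fun z => baseMetric γ τ z i j) y =
    pd l (fun z => γ z i j) y - (τ i y * pd l (τ j) y + τ j y * pd l (τ i) y) := by
  simp only [baseMetric, Matrix.of_apply]
  rw [pd_sub l (h.diff_γ hy i j) ((h.diff_τ hy i).fun_mul (h.diff_τ hy j)),
    pd_mul l (h.diff_τ hy i) (h.diff_τ hy j)]

/-- `d (τ(ξ)) = 0`. -/
lemma pd_pairing (hy : y ∈ s) (l : Fin 4) :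
    ∑ i, (τ i y * pd l (ξ i) y + ξ i y * pd l (τ i) y) = 0 := by
  have h1 : pd l (fun z => ∑ i, τ i z * ξ i z) y = 0 := by
    rw [pd_congr_on h.isOpen (f' := fun _ => -1) (fun z hz => h.pairing z hz) hy, pd_const]
  rw [pd_sum _ _ fun i _ => (h.diff_τ hy i).fun_mul (h.diff_ξ hy i)] at h1
  rw [← h1]
  exact Finset.sum_congr rfl fun i _ => (pd_mul l (h.diff_τ hy i) (h.diff_ξ hy i)).symm

/-- A closed one-form with constant pairing with `ξ` is `ξ`-invariant. -/
lemma lie_τ (hy : y ∈ s) (i : Fin 4) :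
    ∑ k, (ξ k y * pd k (τ i) y + τ k y * pd i (ξ k) y) = 0 := by
  rw [← h.pd_pairing hy i]
  exact Finset.sum_congr rfl fun k _ => by rw [h.closed y hy k i]; ring

/-- The one-form `τ` is parallel for the base metric. -/
lemma pd_τ (hy : y ∈ s) (i j : Fin 4) :
    pd i (τ j) y = ∑ k, christoffel (baseMetric γ τ) k i j y * τ k y := by
  have hi := h.lie_τ hy i
  have hj := h.lie_τ hy j
  have hinv := h.invariant y hy i j
  have hb : ∀ l, ξ l y * ((1 / 2) * (pd i (fun z => baseMetric γ τ z j l) y +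
      pd j (fun z => baseMetric γ τ z i l) y - pd l (fun z => baseMetric γ τ z i j) y)) =
      ξ l y * ∑ m, baseMetric γ τ y l m * christoffel (baseMetric γ τ) m i j y := by
    intro l
    rw [sum_mul_christoffel (h.nondeg y hy),
      pd_congr_on h.isOpen (fun z hz => h.base_symm z hz j l) hy i]
  have hs := Finset.sum_congr (rfl : (Finset.univ : Finset (Fin 4)) = _) fun l _ => hb l
  have hr : ∑ l, ξ l y * ∑ m, baseMetric γ τ y l m * christoffel (baseMetric γ τ) m i j y =
      ∑ k, christoffel (baseMetric γ τ) k i j y * τ k y := by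
    simp only [← h.base_mul_ξ hy, Finset.mul_sum]
    rw [Finset.sum_comm]
    refine Finset.sum_congr rfl fun m _ => Finset.sum_congr rfl fun l _ => ?_
    rw [h.base_symm y hy l m]; ring
  rw [← hr, ← hs]
  -- the derivatives of `τ = B ξ`
  have hτ : ∀ a b, ∑ l, (baseMetric γ τ y a l * pd b (ξ l) y +
      ξ l y * pd b (fun z => baseMetric γ τ z a l) y) = pd b (τ a) y := by
    intro a b
    have hd : ∀ l, DifferentiableAt ℝ (fun z => baseMetric γ τ z a l) y := fun l =>
      differentiableAt_of_contDiffOn h.isOpen (h.base_smooth a l) hy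
    rw [← pd_congr_on h.isOpen (fun z hz => h.base_mul_ξ hz a) hy b,
      pd_sum _ _ fun l _ => (hd l).fun_mul (h.diff_ξ hy l)]
    exact Finset.sum_congr rfl fun l _ => by rw [pd_mul b (hd l) (h.diff_ξ hy l)]
  have h1 := hτ j i
  have h2 := hτ i j
  have hc := h.closed y hy i j
  simp only [lieDeriv] at hinv
  simp only [h.pd_base_eq hy] at h1 h2 ⊢
  simp only [h.symm y hy _ j] at hinv
  simp only [baseMetric, Matrix.of_apply, Fin.sum_univ_four] at *
  linear_combination (-1/2) * h1 - (1/2) * h2 + (1/2) * hinv - (1/2) * τ j y * hi -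
    (1/2) * τ i y * hj + (1/2) * hc

/-- The vector field `ξ` is parallel for the base metric. -/
lemma pd_ξ (hy : y ∈ s) (i j : Fin 4) :
    pd i (ξ j) y = -∑ k, christoffel (baseMetric γ τ) j i k y * ξ k y := by
  have hd : ∀ l, DifferentiableAt ℝ (fun z => (baseMetric γ τ z)⁻¹ j l) y := fun l =>
    differentiableAt_of_contDiffOn h.isOpen
      (contDiffOn_matrix_inv h.base_smooth h.nondeg j l) hy
  rw [← pd_congr_on h.isOpen (fun z hz => h.inv_mul_τ hz j) hy i,
    pd_sum _ _ fun l _ => (hd l).fun_mul (h.diff_τ hy l)]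
  simp only [pd_mul i (hd _) (h.diff_τ hy _), h.pd_τ hy,
    pd_inv h.isOpen h.base_symm h.base_smooth h.nondeg hy, ← h.inv_mul_τ hy]
  simp only [Fin.sum_univ_four]
  ring

lemma pd_γ (hy : y ∈ s) (l i j : Fin 4) : pd l (fun z => γ z i j) y =
    ∑ m, (christoffel (baseMetric γ τ) m l i y * γ y m j +
      christoffel (baseMetric γ τ) m l j y * γ y i m) := by
  have h1 := h.pd_base_eq hy l i j
  rw [h.pd_base hy, h.pd_τ hy, h.pd_τ hy] at h1
  simp only [Fin.sum_univ_four] at *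
  simp only [show ∀ a b, baseMetric γ τ y a b = γ y a b - τ a y * τ b y from fun _ _ => rfl] at h1
  linear_combination -h1

lemma hessian_symm (hf : ContDiffOn ℝ ∞ f s) (hy : y ∈ s) (i j : Fin 4) :
    hessian (baseMetric γ τ) f i j y = hessian (baseMetric γ τ) f j i y := by
  simp only [hessian, pd_comm h.isOpen hf hy i j, h.conn_symm hy _ i j]

lemma gradient_smooth (hf : ContDiffOn ℝ ∞ f s) (a : Fin 4) :
    ContDiffOn ℝ ∞ (gradient (baseMetric γ τ) f a) s :=
  ContDiffOn.sum fun l _ => (contDiffOn_matrix_inv h.base_smooth h.nondeg a l).mul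
    (contDiffOn_pd h.isOpen hf l)

lemma pd_gradient (hf : ContDiffOn ℝ ∞ f s) (hy : y ∈ s) (k a : Fin 4) :
    pd k (gradient (baseMetric γ τ) f a) y =
      -∑ l, christoffel (baseMetric γ τ) a k l y * gradient (baseMetric γ τ) f l y +
      ∑ l, (baseMetric γ τ y)⁻¹ a l * hessian (baseMetric γ τ) f k l y := by
  have hd : ∀ l, DifferentiableAt ℝ (fun z => (baseMetric γ τ z)⁻¹ a l) y := fun l =>
    differentiableAt_of_contDiffOn h.isOpen
      (contDiffOn_matrix_inv h.base_smooth h.nondeg a l) hy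
  have hf' : ∀ l, DifferentiableAt ℝ (pd l f) y := fun l =>
    differentiableAt_of_contDiffOn h.isOpen (contDiffOn_pd h.isOpen hf l) hy
  unfold gradient
  rw [pd_sum _ _ fun l _ => (hd l).fun_mul (hf' l)]
  simp only [pd_mul k (hd _) (hf' _), hessian,
    pd_inv h.isOpen h.base_symm h.base_smooth h.nondeg hy]
  simp only [Fin.sum_univ_four]
  ring

/-- The Hessian of a `ξ`-invariant function annihilates `ξ`. -/
lemma hessian_ξ (hf : ContDiffOn ℝ ∞ f s) (hinv : ∀ z ∈ s, ∑ k, ξ k z * pd k f z = 0)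
    (hy : y ∈ s) (i : Fin 4) : ∑ j, hessian (baseMetric γ τ) f i j y * ξ j y = 0 := by
  have hf' : ∀ l, DifferentiableAt ℝ (pd l f) y := fun l =>
    differentiableAt_of_contDiffOn h.isOpen (contDiffOn_pd h.isOpen hf l) hy
  have h1 : pd i (fun z => ∑ k, ξ k z * pd k f z) y = 0 := by
    rw [pd_congr_on h.isOpen hinv hy, pd_const]
  rw [pd_sum _ _ fun l _ => (h.diff_ξ hy l).fun_mul (hf' l)] at h1
  simp only [pd_mul i (h.diff_ξ hy _) (hf' _), h.pd_ξ hy] at h1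
  simp only [hessian, Fin.sum_univ_four] at *
  linear_combination h1

lemma τ_gradient (hinv : ∀ z ∈ s, ∑ k, ξ k z * pd k f z = 0)
    (hy : y ∈ s) : ∑ a, τ a y * gradient (baseMetric γ τ) f a y = 0 := by
  have h1 := hinv y hy
  simp only [← h.inv_mul_τ hy, Finset.sum_mul] at h1
  simp only [gradient, Finset.mul_sum]
  rw [Finset.sum_comm, ← h1]
  refine Finset.sum_congr rfl fun l _ => Finset.sum_congr rfl fun a _ => ?_
  rw [h.inv_base_symm hy a l]; ring

lemma base_mul_gradient (hy : y ∈ s) (i : Fin 4) :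
    ∑ j, baseMetric γ τ y i j * gradient (baseMetric γ τ) f j y = pd i f y := by
  have h1 : (baseMetric γ τ y) *ᵥ ((baseMetric γ τ y)⁻¹ *ᵥ fun l => pd l f y) =
      fun l => pd l f y := by
    rw [Matrix.mulVec_mulVec, Matrix.mul_nonsing_inv _ (isUnit_iff_ne_zero.2 (h.nondeg y hy)),
      Matrix.one_mulVec]
  exact congrFun h1 i

lemma γ_gradient (hinv : ∀ z ∈ s, ∑ k, ξ k z * pd k f z = 0) (hy : y ∈ s) (i : Fin 4) :
    ∑ j, γ y i j * gradient (baseMetric γ τ) f j y = pd i f y := by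
  have h1 := h.base_mul_gradient (f := f) hy i
  have h2 := h.τ_gradient hinv hy
  simp only [baseMetric, Matrix.of_apply, Fin.sum_univ_four] at *
  linear_combination h1 + τ i y * h2

end StaticFrame

/-! ### The Ricci tensor of a static metric -/

/-- The reflection `δᵏⱼ + 2 ξᵏ τⱼ`, which is `-1` on `ξ` and `1` on the kernel of `τ`. It is
parallel for the base metric and fixes `γ` and the gradients and Hessians of invariant functions,
which keeps the contractions of the connection shift short. -/
def reflection (τ ξ : Fin 4 → E4 → ℝ) (k j : Fin 4) (y : E4) : ℝ :=
  (if k = j then 1 else 0) + 2 * (ξ k y * τ j y)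

/-- The tensor `γ + e^{4u} τ ⊗ τ`: up to the factor `e^{-2u}`, the static metric with the sign of
its time part reversed. -/
def wickForm (γ : E4 → Matrix (Fin 4) (Fin 4) ℝ) (τ : Fin 4 → E4 → ℝ) (u : E4 → ℝ)
    (i j : Fin 4) (y : E4) : ℝ :=
  γ y i j + Real.exp (4 * u y) * (τ i y * τ j y)

/-- The difference of the Levi-Civita connections of `e^{-2u} γ - e^{2u} τ ⊗ τ` and of the base
metric `γ - τ ⊗ τ`. -/
def connectionShift (γ : E4 → Matrix (Fin 4) (Fin 4) ℝ) (τ ξ : Fin 4 → E4 → ℝ) (u : E4 → ℝ)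
    (k i j : Fin 4) (y : E4) : ℝ :=
  gradient (baseMetric γ τ) u k y * wickForm γ τ u i j y -
    pd i u y * reflection τ ξ k j y - pd j u y * reflection τ ξ k i y

lemma sum_ite_mul_left (j : Fin 4) (v : Fin 4 → ℝ) :
    ∑ k, (if k = j then 1 else 0) * v k = v j := by simp

lemma reflection_pd (τ : Fin 4 → E4 → ℝ) {ξ : Fin 4 → E4 → ℝ} {f : E4 → ℝ} {y : E4}
    (hinv : ∑ k, ξ k y * pd k f y = 0) (i : Fin 4) :
    ∑ m, reflection τ ξ m i y * pd m f y = pd i f y := by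
  have h2 := sum_ite_mul_left i fun m => pd m f y
  simp only [reflection, Fin.sum_univ_four] at *
  linear_combination h2 + 2 * τ i y * hinv

namespace StaticFrame

variable {s : Set E4} {γ : E4 → Matrix (Fin 4) (Fin 4) ℝ} {τ ξ : Fin 4 → E4 → ℝ}
  (h : StaticFrame s γ τ ξ) {y : E4} {f u : E4 → ℝ}
include h

lemma ker' (hy : y ∈ s) (j : Fin 4) : ∑ i, ξ i y * γ y i j = 0 := by
  rw [← h.ker y hy j]
  exact Finset.sum_congr rfl fun i _ => by rw [h.symm y hy i j]; ring

lemma reflection_γ (hy : y ∈ s) (i j : Fin 4) :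
    ∑ m, reflection τ ξ m i y * γ y m j = γ y i j := by
  have h1 := h.ker' hy j
  have h2 := sum_ite_mul_left i fun m => γ y m j
  simp only [reflection, Fin.sum_univ_four] at *
  linear_combination h2 + 2 * τ i y * h1

lemma reflection_τ (hy : y ∈ s) (i : Fin 4) :
    ∑ m, reflection τ ξ m i y * τ m y = -τ i y := by
  have h1 := h.pairing y hy
  have h2 := sum_ite_mul_left i fun m => τ m y
  simp only [reflection, Fin.sum_univ_four] at *
  linear_combination h2 + 2 * τ i y * h1

lemma reflection_hessian (hf : ContDiffOn ℝ ∞ f s)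
    (hinv : ∀ z ∈ s, ∑ k, ξ k z * pd k f z = 0) (hy : y ∈ s) (i j : Fin 4) :
    ∑ m, reflection τ ξ m i y * hessian (baseMetric γ τ) f m j y =
      hessian (baseMetric γ τ) f i j y := by
  have h1 := h.hessian_ξ hf hinv hy j
  have h2 := sum_ite_mul_left i fun m => hessian (baseMetric γ τ) f m j y
  simp only [h.hessian_symm hf hy j] at h1
  simp only [reflection, Fin.sum_univ_four] at *
  linear_combination h2 + 2 * τ i y * h1

lemma reflection_gradient (hinv : ∀ z ∈ s, ∑ k, ξ k z * pd k f z = 0) (hy : y ∈ s)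
    (i : Fin 4) : ∑ m, reflection τ ξ i m y * gradient (baseMetric γ τ) f m y =
      gradient (baseMetric γ τ) f i y := by
  have h1 := h.τ_gradient hinv hy
  have h2 := sum_ite_mul_left i fun m => gradient (baseMetric γ τ) f m y
  simp only [reflection, eq_comm (a := i), Fin.sum_univ_four] at *
  linear_combination h2 + 2 * ξ i y * h1

lemma reflection_sq (hy : y ∈ s) (i j : Fin 4) :
    ∑ m, reflection τ ξ i m y * reflection τ ξ m j y = if i = j then 1 else 0 := by
  have h1 := h.reflection_τ hy j
  have h2 := sum_ite_mul_left i fun m => reflection τ ξ m j y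
  have h3 : reflection τ ξ i j y = (if i = j then 1 else 0) + 2 * (ξ i y * τ j y) := rfl
  have h4 : ∀ m, reflection τ ξ i m y = (if m = i then 1 else 0) + 2 * (ξ i y * τ m y) := by
    intro m; simp only [reflection, eq_comm]
  simp only [h4]
  simp only [Fin.sum_univ_four] at *
  linear_combination h2 + h3 + 2 * ξ i y * h1

lemma reflection_trace (hy : y ∈ s) : ∑ m, reflection τ ξ m m y = 2 := by
  have h1 := h.pairing y hy
  simp only [reflection, Fin.sum_univ_four, if_true] at *
  linear_combination 2 * h1

lemma wickForm_symm (hy : y ∈ s) (i j : Fin 4) : wickForm γ τ u i j y = wickForm γ τ u j i y := by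
  simp only [wickForm, h.symm y hy i j]; ring

lemma wickForm_gradient (hinv : ∀ z ∈ s, ∑ k, ξ k z * pd k f z = 0) (hy : y ∈ s) (i : Fin 4) :
    ∑ m, wickForm γ τ u i m y * gradient (baseMetric γ τ) f m y = pd i f y := by
  have h1 := h.γ_gradient hinv hy i
  have h2 := h.τ_gradient hinv hy
  simp only [wickForm, Fin.sum_univ_four] at *
  linear_combination h1 + Real.exp (4 * u y) * τ i y * h2

lemma wickForm_reflection (hy : y ∈ s) (i j : Fin 4) :
    ∑ m, wickForm γ τ u i m y * reflection τ ξ m j y =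
      γ y i j - Real.exp (4 * u y) * (τ i y * τ j y) := by
  have h1 := h.reflection_γ hy j i
  have h2 := h.reflection_τ hy j
  rw [h.symm y hy j i] at h1
  simp only [wickForm, h.symm y hy i] at *
  simp only [Fin.sum_univ_four] at *
  linear_combination h1 + Real.exp (4 * u y) * τ i y * h2

lemma staticMetric_mul_inv (hy : y ∈ s) :
    staticMetric γ τ u y * Matrix.of (fun i j => Real.exp (2 * u y) * (baseMetric γ τ y)⁻¹ i j +
      (Real.exp (2 * u y) - Real.exp (-2 * u y)) * (ξ i y * ξ j y)) = 1 := by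
  ext i k
  have h1 : ∑ j, baseMetric γ τ y i j * (baseMetric γ τ y)⁻¹ j k = if i = k then 1 else 0 := by
    rw [← Matrix.mul_apply, Matrix.mul_nonsing_inv _ (isUnit_iff_ne_zero.2 (h.nondeg y hy)),
      Matrix.one_apply]
  have h2 := h.base_mul_ξ hy i
  have h3 := h.inv_mul_τ hy k
  simp only [h.inv_base_symm hy k] at h3
  have h4 := h.pairing y hy
  have hx : Real.exp (2 * u y) * Real.exp (-2 * u y) = 1 := by
    rw [← Real.exp_add]; simp
  rw [Matrix.mul_apply, Matrix.one_apply, ← h1]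
  simp only [staticMetric, baseMetric, Matrix.of_apply] at *
  generalize (Matrix.of fun i j => γ y i j - τ i y * τ j y)⁻¹ = K at *
  generalize Real.exp (2 * u y) = a at *
  generalize Real.exp (-2 * u y) = b at *
  simp only [Fin.sum_univ_four] at *
  linear_combination b * (a - b) * ξ k y * h2 + (b - a) * τ i y * a * h3 +
    (b - a) * (a - b) * τ i y * ξ k y * h4 +
    (γ y i 0 * K 0 k + γ y i 1 * K 1 k + γ y i 2 * K 2 k + γ y i 3 * K 3 k
     - τ i y * (τ 0 y * K 0 k + τ 1 y * K 1 k + τ 2 y * K 2 k + τ 3 y * K 3 k)) * hx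

lemma staticMetric_det_ne_zero (hy : y ∈ s) : (staticMetric γ τ u y).det ≠ 0 :=
  Matrix.det_ne_zero_of_right_inverse (h.staticMetric_mul_inv hy)

lemma staticMetric_inv (hy : y ∈ s) (i j : Fin 4) : (staticMetric γ τ u y)⁻¹ i j =
    Real.exp (2 * u y) * (baseMetric γ τ y)⁻¹ i j +
      (Real.exp (2 * u y) - Real.exp (-2 * u y)) * (ξ i y * ξ j y) := by
  rw [Matrix.inv_eq_right_inv (h.staticMetric_mul_inv hy)]; rfl

lemma staticMetric_symm (hy : y ∈ s) (i j : Fin 4) :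
    staticMetric γ τ u y i j = staticMetric γ τ u y j i := by
  simp only [staticMetric, Matrix.of_apply, h.symm y hy i j]; ring

lemma connectionShift_symm (hy : y ∈ s) (k i j : Fin 4) :
    connectionShift γ τ ξ u k i j y = connectionShift γ τ ξ u k j i y := by
  simp only [connectionShift, h.wickForm_symm hy i j]; ring

lemma pd_staticMetric (hu : ContDiffOn ℝ ∞ u s) (hy : y ∈ s) (l i j : Fin 4) :
    pd l (fun z => staticMetric γ τ u z i j) y =
      Real.exp (-2 * u y) * (pd l (fun z => γ z i j) y - 2 * pd l u y * γ y i j) -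
      Real.exp (2 * u y) * (τ i y * pd l (τ j) y + τ j y * pd l (τ i) y +
        2 * pd l u y * (τ i y * τ j y)) := by
  have hu' := differentiableAt_of_contDiffOn h.isOpen hu hy
  have he : ∀ c : ℝ, DifferentiableAt ℝ (fun z => Real.exp (c * u z)) y := fun c =>
    (hu'.const_mul c).exp
  have hpe : ∀ c : ℝ, pd l (fun z => Real.exp (c * u z)) y =
      Real.exp (c * u y) * c * pd l u y := fun c =>
    pd_comp l (Ψ := fun t => Real.exp (c * t))
      (by simpa using ((hasDerivAt_id (u y)).const_mul c).exp) hu'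
  simp only [staticMetric, Matrix.of_apply]
  rw [pd_sub l ((he _).fun_mul (h.diff_γ hy i j))
      ((he _).fun_mul ((h.diff_τ hy i).fun_mul (h.diff_τ hy j))),
    pd_mul l (he _) (h.diff_γ hy i j), pd_mul l (he _) ((h.diff_τ hy i).fun_mul (h.diff_τ hy j)),
    pd_mul l (h.diff_τ hy i) (h.diff_τ hy j), hpe, hpe]
  ring

/-- The base connection plus the shift is symmetric, and compatible with the static metric. -/
lemma christoffel_staticMetric (hu : ContDiffOn ℝ ∞ u s)
    (hinv : ∀ z ∈ s, ∑ k, ξ k z * pd k u z = 0) (hy : y ∈ s) (k i j : Fin 4) :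
    christoffel (staticMetric γ τ u) k i j y =
      christoffel (baseMetric γ τ) k i j y + connectionShift γ τ ξ u k i j y := by
  refine christoffel_eq_of_compatible (h.staticMetric_det_ne_zero hy)
    (h.staticMetric_symm hy)
    (A := fun k i j => christoffel (baseMetric γ τ) k i j y + connectionShift γ τ ξ u k i j y)
    (fun k i j => by simp only [h.conn_symm hy k i j, h.connectionShift_symm hy k i j]) ?_ k i j
  intro l i j
  rw [h.pd_staticMetric hu hy, h.pd_γ hy, h.pd_τ hy, h.pd_τ hy]
  -- the connection shift with its upper index lowered by the static metric
  have key : ∀ i j, ∑ m, connectionShift γ τ ξ u m l i y * staticMetric γ τ u y m j =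
      Real.exp (-2 * u y) * (pd j u y * wickForm γ τ u l i y - pd l u y * wickForm γ τ u i j y -
        pd i u y * wickForm γ τ u l j y) := by
    intro i j
    have h1 := h.γ_gradient hinv hy j
    simp only [h.symm y hy j] at h1
    have h2 := h.τ_gradient hinv hy
    have h3 := h.reflection_γ hy l j
    have h4 := h.reflection_γ hy i j
    have h5 := h.reflection_τ hy l
    have h6 := h.reflection_τ hy i
    have hx : Real.exp (2 * u y) = Real.exp (-2 * u y) * Real.exp (4 * u y) := by
      rw [← Real.exp_add]; ring_nf
    simp only [connectionShift, staticMetric, Matrix.of_apply, hx]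
    simp only [show ∀ a b, wickForm γ τ u a b y = γ y a b + Real.exp (4 * u y) *
      (τ a y * τ b y) from fun _ _ => rfl]
    generalize Real.exp (4 * u y) = b at *
    generalize Real.exp (-2 * u y) = a at *
    simp only [Fin.sum_univ_four] at *
    linear_combination a * (γ y l i + b * (τ l y * τ i y)) * (h1 - b * τ j y * h2) -
      a * pd i u y * h3 - a * pd l u y * h4 + a * b * pd i u y * τ j y * h5 +
      a * b * pd l u y * τ j y * h6
  have k1 := key i j
  have k2 := key j i
  rw [h.wickForm_symm hy j i] at k2
  simp only [h.staticMetric_symm hy _ i] at k2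
  have hx : Real.exp (2 * u y) = Real.exp (-2 * u y) * Real.exp (4 * u y) := by
    rw [← Real.exp_add]; ring_nf
  simp only [add_mul, Finset.sum_add_distrib, k1, k2]
  simp only [staticMetric, wickForm, Matrix.of_apply, Fin.sum_univ_four, hx]
  ring

/-- The connection shift is traced to `-2 du`: the logarithm of the volume density of the static
metric is that of the base metric minus `2u`. -/
lemma connectionShift_trace (hinv : ∀ z ∈ s, ∑ k, ξ k z * pd k u z = 0) (hy : y ∈ s)
    (i : Fin 4) : ∑ k, connectionShift γ τ ξ u k k i y = -2 * pd i u y := by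
  have h1 := h.wickForm_gradient (u := u) hinv hy i
  have h2 := reflection_pd τ (hinv y hy) i
  have h3 := h.reflection_trace hy
  simp only [connectionShift, h.wickForm_symm hy _ i] at *
  simp only [Fin.sum_univ_four] at *
  linear_combination h1 - h2 - pd i u y * h3

/-- The term of the Ricci tensor quadratic in the connection shift. -/
lemma connectionShift_sq (hinv : ∀ z ∈ s, ∑ k, ξ k z * pd k u z = 0) (hy : y ∈ s)
    (i j : Fin 4) :
    ∑ k, ∑ l, connectionShift γ τ ξ u k j l y * connectionShift γ τ ξ u l i k y =
      6 * (pd i u y * pd j u y) -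
        2 * (∑ k, pd k u y * gradient (baseMetric γ τ) u k y) *
          (γ y i j - Real.exp (4 * u y) * (τ i y * τ j y)) := by
  have hstep : ∀ k, ∑ l, connectionShift γ τ ξ u k j l y * connectionShift γ τ ξ u l i k y =
      pd j u y * pd i u y + pd j u y * ((if k = i then 1 else 0) * pd k u y) -
        pd j u y * (wickForm γ τ u i k y * gradient (baseMetric γ τ) u k y) +
        2 * pd i u y * (reflection τ ξ k j y * pd k u y) -
        (∑ k, pd k u y * gradient (baseMetric γ τ) u k y) *
          (wickForm γ τ u i k y * reflection τ ξ k j y) -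
        pd i u y * (gradient (baseMetric γ τ) u k y *
          (γ y j k - Real.exp (4 * u y) * (τ j y * τ k y))) -
        (pd k u y * gradient (baseMetric γ τ) u k y) *
          (γ y j i - Real.exp (4 * u y) * (τ j y * τ i y)) +
        pd j u y * (wickForm γ τ u i k y * gradient (baseMetric γ τ) u k y) := by
    -- expand the product into nine terms and contract each over `l`
    intro k
    have h1 := h.reflection_sq hy k k
    rw [if_pos rfl] at h1
    have h2 := h.reflection_sq hy k i
    have h3 := h.reflection_gradient hinv hy k
    have h4 := reflection_pd τ (hinv y hy) k
    have h5 := reflection_pd τ (hinv y hy) i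
    have h6 := h.wickForm_reflection (u := u) hy j k
    have h7 := h.wickForm_reflection (u := u) hy j i
    have h8 := h.wickForm_gradient (u := u) hinv hy j
    rw [← h2, ← h6, ← h7]
    simp only [connectionShift]
    simp only [Fin.sum_univ_four] at *
    linear_combination pd j u y * pd i u y * h1 - pd j u y * wickForm γ τ u i k y * h3 +
      pd i u y * reflection τ ξ k j y * h4 + pd k u y * reflection τ ξ k j y * h5 +
      gradient (baseMetric γ τ) u k y * wickForm γ τ u i k y * h8
  rw [Finset.sum_congr rfl fun k _ => hstep k]
  have h1 := sum_ite_mul_left i fun k => pd k u y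
  have h3 := reflection_pd τ (hinv y hy) j
  have h4 := h.wickForm_reflection (u := u) hy i j
  have h5 := h.γ_gradient hinv hy j
  have h6 := h.τ_gradient hinv hy
  have hs := h.symm y hy j i
  rw [← h4]
  have h4' := h4
  simp only [Fin.sum_univ_four] at *
  linear_combination pd j u y * h1 + 2 * pd i u y * h3 - pd i u y * h5 +
    pd i u y * Real.exp (4 * u y) * τ j y * h6 +
    (pd 0 u y * gradient (baseMetric γ τ) u 0 y + pd 1 u y * gradient (baseMetric γ τ) u 1 y +
      pd 2 u y * gradient (baseMetric γ τ) u 2 y + pd 3 u y * gradient (baseMetric γ τ) u 3 y) *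
      (h4' - hs)

end StaticFrame

namespace StaticFrame

variable {s : Set E4} {γ : E4 → Matrix (Fin 4) (Fin 4) ℝ} {τ ξ : Fin 4 → E4 → ℝ}
  (h : StaticFrame s γ τ ξ) {y : E4} {f u : E4 → ℝ}
include h

lemma reflection_smooth (i j : Fin 4) : ContDiffOn ℝ ∞ (reflection τ ξ i j) s :=
  contDiffOn_const.add (contDiffOn_const.mul ((h.smooth_ξ i).mul (h.smooth_τ j)))

lemma wickForm_smooth (hu : ContDiffOn ℝ ∞ u s) (i j : Fin 4) :
    ContDiffOn ℝ ∞ (wickForm γ τ u i j) s :=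
  (h.smooth_γ i j).add ((contDiffOn_const.mul hu).exp.mul ((h.smooth_τ i).mul (h.smooth_τ j)))

lemma connectionShift_smooth (hu : ContDiffOn ℝ ∞ u s) (k i j : Fin 4) :
    ContDiffOn ℝ ∞ (connectionShift γ τ ξ u k i j) s :=
  (((h.gradient_smooth hu k).mul (h.wickForm_smooth hu i j)).sub
    ((contDiffOn_pd h.isOpen hu i).mul (h.reflection_smooth k j))).sub
    ((contDiffOn_pd h.isOpen hu j).mul (h.reflection_smooth k i))

lemma pd_reflection (hy : y ∈ s) (k a j : Fin 4) : pd k (reflection τ ξ a j) y =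
    ∑ l, (christoffel (baseMetric γ τ) l k j y * reflection τ ξ a l y -
      christoffel (baseMetric γ τ) a k l y * reflection τ ξ l j y) := by
  have h1 : pd k (reflection τ ξ a j) y =
      2 * (ξ a y * pd k (τ j) y + τ j y * pd k (ξ a) y) := by
    have hd := (h.diff_ξ hy a).fun_mul (h.diff_τ hy j)
    unfold reflection
    rw [pd_add k (differentiableAt_const _) (hd.const_mul 2), pd_const,
      pd_mul k (differentiableAt_const _) hd, pd_const, pd_mul k (h.diff_ξ hy a) (h.diff_τ hy j)]
    ring
  have h2 := sum_ite_mul_left j fun l => christoffel (baseMetric γ τ) a k l y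
  have h3 := sum_ite_mul_left a fun l => christoffel (baseMetric γ τ) l k j y
  rw [h1, h.pd_τ hy, h.pd_ξ hy]
  simp only [reflection, eq_comm (a := a)]
  simp only [Fin.sum_univ_four] at *
  linear_combination h2 - h3

lemma pd_wickForm (hu : ContDiffOn ℝ ∞ u s) (hy : y ∈ s) (k i j : Fin 4) :
    pd k (wickForm γ τ u i j) y =
      ∑ l, (christoffel (baseMetric γ τ) l k i y * wickForm γ τ u l j y +
        christoffel (baseMetric γ τ) l k j y * wickForm γ τ u i l y) +
      4 * pd k u y * (Real.exp (4 * u y) * (τ i y * τ j y)) := by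
  have hu' := differentiableAt_of_contDiffOn h.isOpen hu hy
  have he : DifferentiableAt ℝ (fun z => Real.exp (4 * u z)) y := (hu'.const_mul 4).exp
  have hpe : pd k (fun z => Real.exp (4 * u z)) y = Real.exp (4 * u y) * 4 * pd k u y :=
    pd_comp k (Ψ := fun t => Real.exp (4 * t))
      (by simpa using ((hasDerivAt_id (u y)).const_mul 4).exp) hu'
  have hd := (h.diff_τ hy i).fun_mul (h.diff_τ hy j)
  unfold wickForm
  rw [pd_add k (h.diff_γ hy i j) (he.fun_mul hd), pd_mul k he hd,
    pd_mul k (h.diff_τ hy i) (h.diff_τ hy j), hpe, h.pd_γ hy, h.pd_τ hy, h.pd_τ hy]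
  simp only [Fin.sum_univ_four]
  ring

/-- The covariant derivative of the connection shift with respect to the base metric. -/
lemma pd_connectionShift (hu : ContDiffOn ℝ ∞ u s) (hy : y ∈ s) (k a i j : Fin 4) :
    pd k (connectionShift γ τ ξ u a i j) y =
      ∑ l, (christoffel (baseMetric γ τ) l k i y * connectionShift γ τ ξ u a l j y +
        christoffel (baseMetric γ τ) l k j y * connectionShift γ τ ξ u a i l y -
        christoffel (baseMetric γ τ) a k l y * connectionShift γ τ ξ u l i j y) +
      (∑ l, (baseMetric γ τ y)⁻¹ a l * hessian (baseMetric γ τ) u k l y) * wickForm γ τ u i j y +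
      4 * (pd k u y * gradient (baseMetric γ τ) u a y) *
        (Real.exp (4 * u y) * (τ i y * τ j y)) -
      hessian (baseMetric γ τ) u k i y * reflection τ ξ a j y -
      hessian (baseMetric γ τ) u k j y * reflection τ ξ a i y := by
  have hd : ∀ {f : E4 → ℝ}, ContDiffOn ℝ ∞ f s → DifferentiableAt ℝ f y := fun hf =>
    differentiableAt_of_contDiffOn h.isOpen hf hy
  have hg := hd (h.gradient_smooth hu a)
  have hw := hd (h.wickForm_smooth hu i j)
  have hr := fun j => hd (h.reflection_smooth a j)
  have hp := fun j => hd (contDiffOn_pd h.isOpen hu j)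
  have h1 : pd k (connectionShift γ τ ξ u a i j) y =
      (gradient (baseMetric γ τ) u a y * pd k (wickForm γ τ u i j) y +
        wickForm γ τ u i j y * pd k (gradient (baseMetric γ τ) u a) y) -
      (pd i u y * pd k (reflection τ ξ a j) y + reflection τ ξ a j y * pd k (pd i u) y) -
      (pd j u y * pd k (reflection τ ξ a i) y + reflection τ ξ a i y * pd k (pd j u) y) := by
    unfold connectionShift
    rw [pd_sub k ((hg.fun_mul hw).fun_sub ((hp i).fun_mul (hr j))) ((hp j).fun_mul (hr i)),
      pd_sub k (hg.fun_mul hw) ((hp i).fun_mul (hr j)), pd_mul k hg hw, pd_mul k (hp i) (hr j),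
      pd_mul k (hp j) (hr i)]
  rw [h1, h.pd_wickForm hu hy, h.pd_gradient hu hy, h.pd_reflection hy, h.pd_reflection hy,
    pd_pd_eq_hessian_add (baseMetric γ τ) u k i, pd_pd_eq_hessian_add (baseMetric γ τ) u k j]
  simp only [connectionShift]
  simp only [Fin.sum_univ_four]
  ring

/-- The covariant divergence of the connection shift, for the base metric. -/
lemma div_connectionShift (hu : ContDiffOn ℝ ∞ u s)
    (hinv : ∀ z ∈ s, ∑ k, ξ k z * pd k u z = 0) (hy : y ∈ s) (i j : Fin 4) :
    ∑ k, pd k (connectionShift γ τ ξ u k i j) y +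
      ∑ k, ∑ l, (christoffel (baseMetric γ τ) k k l y * connectionShift γ τ ξ u l i j y -
        christoffel (baseMetric γ τ) k j l y * connectionShift γ τ ξ u l i k y -
        connectionShift γ τ ξ u k j l y * christoffel (baseMetric γ τ) l i k y) =
      -2 * hessian (baseMetric γ τ) u i j y +
      (∑ k, ∑ l, (baseMetric γ τ y)⁻¹ k l * hessian (baseMetric γ τ) u k l y) *
        wickForm γ τ u i j y +
      4 * (∑ k, pd k u y * gradient (baseMetric γ τ) u k y) *
        (Real.exp (4 * u y) * (τ i y * τ j y)) := by
  have hsum : ∑ k, ∑ l, (christoffel (baseMetric γ τ) k j l y * connectionShift γ τ ξ u l i k y +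
        connectionShift γ τ ξ u k j l y * christoffel (baseMetric γ τ) l i k y) =
      ∑ k, ∑ l, (christoffel (baseMetric γ τ) l k i y * connectionShift γ τ ξ u k l j y +
        christoffel (baseMetric γ τ) l k j y * connectionShift γ τ ξ u k i l y) := by
    simp only [Finset.sum_add_distrib]
    rw [add_comm, Finset.sum_comm (f := fun k l => christoffel (baseMetric γ τ) k j l y *
      connectionShift γ τ ξ u l i k y)]
    congr 1
    · refine Finset.sum_congr rfl fun k _ => Finset.sum_congr rfl fun l _ => ?_
      rw [h.conn_symm hy l k i, h.connectionShift_symm hy k l j]; ring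
    · refine Finset.sum_congr rfl fun k _ => Finset.sum_congr rfl fun l _ => ?_
      rw [h.conn_symm hy l k j]
  have h1 := h.reflection_hessian hu hinv hy i j
  have h2 := h.reflection_hessian hu hinv hy j i
  rw [h.hessian_symm hu hy j i] at h2
  simp only [h.pd_connectionShift hu hy, Finset.sum_add_distrib, Finset.sum_sub_distrib,
    ← Finset.sum_mul, ← Finset.mul_sum] at hsum ⊢
  have h3 : ∀ i j, ∑ k, hessian (baseMetric γ τ) u k i y * reflection τ ξ k j y =
      ∑ m, reflection τ ξ m j y * hessian (baseMetric γ τ) u m i y := fun i j =>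
    Finset.sum_congr rfl fun m _ => mul_comm _ _
  rw [h3, h3, h1, h2]
  linear_combination -hsum

/-- `Ric = Ric(B) - 2 du ⊗ du + □u (γ + e^{4u} τ ⊗ τ)`, with `□` the wave operator of the base
metric `B`. For a connection shift `C` the Ricci tensor changes by
`∇ₖ Cᵏᵢⱼ - ∇ⱼ Cᵏᵢₖ + Cᵏₖₗ Cˡᵢⱼ - Cᵏⱼₗ Cˡᵢₖ`, in which the Hessians from the first two terms cancel,
and so do the multiples of `|du|²`. -/
theorem ricci_staticMetric (hu : ContDiffOn ℝ ∞ u s)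
    (hinv : ∀ z ∈ s, ∑ k, ξ k z * pd k u z = 0) (hy : y ∈ s) (i j : Fin 4) :
    ricci (staticMetric γ τ u) i j y = ricci (baseMetric γ τ) i j y - 2 * (pd i u y * pd j u y) +
      (∑ k, ∑ l, (baseMetric γ τ y)⁻¹ k l * hessian (baseMetric γ τ) u k l y) *
        wickForm γ τ u i j y := by
  have hd : ∀ {f : E4 → ℝ}, ContDiffOn ℝ ∞ f s → DifferentiableAt ℝ f y := fun hf =>
    differentiableAt_of_contDiffOn h.isOpen hf hy
  have hp : ∀ m k i j, pd m (christoffel (staticMetric γ τ u) k i j) y =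
      pd m (christoffel (baseMetric γ τ) k i j) y + pd m (connectionShift γ τ ξ u k i j) y := by
    intro m k i j
    rw [pd_congr_on h.isOpen (fun z hz => h.christoffel_staticMetric hu hinv hz k i j) hy,
      pd_add m (hd (contDiffOn_christoffel h.isOpen h.base_smooth h.nondeg k i j))
        (hd (h.connectionShift_smooth hu k i j))]
  -- the traced shift is `-2 du`, so its derivative is minus twice the second derivative of `u`
  have htr : ∑ k, pd j (connectionShift γ τ ξ u k i k) y = -2 * pd j (pd i u) y := by
    rw [← pd_sum _ _ fun k _ => hd (h.connectionShift_smooth hu k i k),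
      pd_congr_on (f' := fun z => -2 * pd i u z) h.isOpen ?_ hy,
      pd_mul j (differentiableAt_const _) (hd (contDiffOn_pd h.isOpen hu i)), pd_const]
    · ring
    · intro z hz
      rw [← h.connectionShift_trace hinv hz i]
      exact Finset.sum_congr rfl fun k _ => h.connectionShift_symm hz k i k
  have htr2 : ∀ v : Fin 4 → ℝ, ∑ k, ∑ l, connectionShift γ τ ξ u k k l y * v l =
      ∑ l, -2 * pd l u y * v l := by
    intro v
    rw [Finset.sum_comm]
    simp only [← Finset.sum_mul, h.connectionShift_trace hinv hy]
  have hdiv := h.div_connectionShift hu hinv hy i j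
  have hsq := h.connectionShift_sq hinv hy i j
  have hS : ∑ l, pd l u y * connectionShift γ τ ξ u l i j y =
      (∑ k, pd k u y * gradient (baseMetric γ τ) u k y) * wickForm γ τ u i j y -
        2 * (pd i u y * pd j u y) := by
    have h1 := reflection_pd τ (hinv y hy) i
    have h2 := reflection_pd τ (hinv y hy) j
    simp only [connectionShift]
    simp only [Fin.sum_univ_four] at *
    linear_combination -pd i u y * h2 - pd j u y * h1
  have h1 := htr2 fun l => connectionShift γ τ ξ u l i j y
  have h2 := htr2 fun l => christoffel (baseMetric γ τ) l i j y
  have hH := pd_pd_eq_hessian_add (baseMetric γ τ) u j i y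
  rw [h.hessian_symm hu hy j i] at hH
  simp only [h.conn_symm hy _ j i] at hH
  simp only [mul_assoc, ← Finset.mul_sum, hS] at h1 h2
  have hc : ∑ l, christoffel (baseMetric γ τ) l i j y * pd l u y =
      ∑ l, pd l u y * christoffel (baseMetric γ τ) l i j y :=
    Finset.sum_congr rfl fun l _ => mul_comm _ _
  rw [hc] at hH
  simp only [ricci, hp, h.christoffel_staticMetric hu hinv hy, add_mul, mul_add,
    Finset.sum_add_distrib, Finset.sum_sub_distrib, htr, hsq, h1, h2] at hdiv ⊢
  rw [hH]
  simp only [wickForm] at *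
  linear_combination hdiv

/-- The curvature annihilates a parallel vector field: `0 = (∇ₖ∇ⱼ - ∇ⱼ∇ₖ) ξᵏ = Rᵢⱼ ξⁱ`. -/
theorem ricci_base_ξ (hy : y ∈ s) (j : Fin 4) :
    ∑ i, ricci (baseMetric γ τ) i j y * ξ i y = 0 := by
  have hd : ∀ {f : E4 → ℝ}, ContDiffOn ℝ ∞ f s → DifferentiableAt ℝ f y := fun hf =>
    differentiableAt_of_contDiffOn h.isOpen hf hy
  have hdc : ∀ k i j, DifferentiableAt ℝ (christoffel (baseMetric γ τ) k i j) y := fun k i j =>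
    hd (contDiffOn_christoffel h.isOpen h.base_smooth h.nondeg k i j)
  -- differentiate `∂ⱼ ξᵏ = - Γᵏⱼᵢ ξⁱ`
  have hpp : ∀ a b k, pd a (pd b (ξ k)) y = ∑ i, (christoffel (baseMetric γ τ) k b i y *
      (∑ l, christoffel (baseMetric γ τ) i a l y * ξ l y) -
      ξ i y * pd a (christoffel (baseMetric γ τ) k b i) y) := by
    intro a b k
    rw [pd_congr_on h.isOpen (fun z hz => h.pd_ξ hz b k) hy, pd_neg,
      pd_sum _ _ fun i _ => (hdc k b i).fun_mul (h.diff_ξ hy i), ← Finset.sum_neg_distrib]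
    refine Finset.sum_congr rfl fun i _ => ?_
    rw [pd_mul a (hdc k b i) (h.diff_ξ hy i), h.pd_ξ hy]
    ring
  have hsy : ∀ a k i j, pd a (christoffel (baseMetric γ τ) k i j) y =
      pd a (christoffel (baseMetric γ τ) k j i) y := fun a k i j =>
    pd_congr_on h.isOpen (fun z hz => h.conn_symm hz k i j) hy a
  have hk : ∀ k, ∑ i, ((pd k (christoffel (baseMetric γ τ) k i j) y -
        pd j (christoffel (baseMetric γ τ) k i k) y) +
      ∑ l, (christoffel (baseMetric γ τ) k k l y * christoffel (baseMetric γ τ) l i j y -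
        christoffel (baseMetric γ τ) k j l y * christoffel (baseMetric γ τ) l i k y)) * ξ i y
      = 0 := by
    intro k
    have h1 := hpp k j k
    have h2 := hpp j k k
    rw [pd_comm h.isOpen (h.smooth_ξ k) hy j k, h1] at h2
    simp only [hsy _ _ _ j, hsy _ _ _ k, h.conn_symm hy _ _ j, h.conn_symm hy _ _ k] at *
    simp only [Fin.sum_univ_four] at *
    linear_combination -h2
  calc ∑ i, ricci (baseMetric γ τ) i j y * ξ i y = ∑ k, ∑ i, _ := by
        rw [Finset.sum_comm]
        refine Finset.sum_congr rfl fun i _ => ?_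
        rw [← Finset.sum_mul, Finset.sum_add_distrib]
        rfl
    _ = 0 := Finset.sum_eq_zero fun k _ => hk k

end StaticFrame

/-! ### The field equations for functions of the gravitational potential -/

/-- A curve `t ↦ (U(t), V(t), W(t))` of values of the potentials `u`, `φ`, `Φ`, parametrised by the
value `t` of the vacuum potential `χ`, that satisfies the ordinary differential equations to which
the field equations reduce, and that starts at the values of flat space. -/
structure GeneratingCurve (α c : ℝ) (I : Set ℝ) (U V W : ℝ → ℝ) : Prop where
  isOpen : IsOpen I
  zero_mem : (0 : ℝ) ∈ I
  smooth_U : ContDiffOn ℝ ∞ U I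
  smooth_V : ContDiffOn ℝ ∞ V I
  smooth_W : ContDiffOn ℝ ∞ W I
  U_zero : U 0 = 0
  V_zero : V 0 = 0
  W_zero : W 0 = 0
  second_U : ∀ t ∈ I, deriv (deriv U) t = c ^ 2 * Real.exp (2 * (U t + α * V t))
  second_V : ∀ t ∈ I, deriv (deriv V) t = α * (c ^ 2 * Real.exp (2 * (U t + α * V t)))
  first_W : ∀ t ∈ I, deriv W t = c * Real.exp (2 * (U t + α * V t))
  energy : ∀ t ∈ I, deriv U t ^ 2 + deriv V t ^ 2 =
    1 + c ^ 2 * Real.exp (2 * (U t + α * V t))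

/-- The components of `τ ∧ dΦ`. -/
def electricForm (τ : Fin 4 → E4 → ℝ) (Φ : E4 → ℝ) (y : E4) : Matrix (Fin 4) (Fin 4) ℝ :=
  Matrix.of fun i j => τ i y * pd j Φ y - τ j y * pd i Φ y

section Composition

variable {s : Set E4} {I : Set ℝ} {Ψ : ℝ → ℝ} {χ : E4 → ℝ} {y : E4}

lemma hasDerivAt_of_contDiffOn (hI : IsOpen I) (hΨ : ContDiffOn ℝ ∞ Ψ I) {t : ℝ} (ht : t ∈ I) :
    HasDerivAt Ψ (deriv Ψ t) t :=
  ((hΨ.differentiableOn (by simp)).differentiableAt (hI.mem_nhds ht)).hasDerivAt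

lemma contDiffOn_deriv (hI : IsOpen I) (hΨ : ContDiffOn ℝ ∞ Ψ I) : ContDiffOn ℝ ∞ (deriv Ψ) I :=
  hΨ.deriv_of_isOpen hI (m := ∞) (by simp)

lemma pd_comp_deriv (hs : IsOpen s) (hI : IsOpen I) (hΨ : ContDiffOn ℝ ∞ Ψ I)
    (hχ : ContDiffOn ℝ ∞ χ s) (hm : ∀ z ∈ s, χ z ∈ I) (hy : y ∈ s) (i : Fin 4) :
    pd i (fun z => Ψ (χ z)) y = deriv Ψ (χ y) * pd i χ y :=
  pd_comp i (hasDerivAt_of_contDiffOn hI hΨ (hm y hy)) (differentiableAt_of_contDiffOn hs hχ hy)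

lemma hessian_comp (B : E4 → Matrix (Fin 4) (Fin 4) ℝ) (hs : IsOpen s) (hI : IsOpen I)
    (hΨ : ContDiffOn ℝ ∞ Ψ I) (hχ : ContDiffOn ℝ ∞ χ s) (hm : ∀ z ∈ s, χ z ∈ I) (hy : y ∈ s)
    (i j : Fin 4) : hessian B (fun z => Ψ (χ z)) i j y =
      deriv Ψ (χ y) * hessian B χ i j y + deriv (deriv Ψ) (χ y) * (pd i χ y * pd j χ y) := by
  have hd := contDiffOn_deriv hI hΨ
  simp only [hessian]
  rw [pd_congr_on hs (fun z hz => pd_comp_deriv hs hI hΨ hχ hm hz j) hy,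
    pd_mul i (differentiableAt_of_contDiffOn (f := fun z => deriv Ψ (χ z)) hs (hd.comp hχ hm) hy)
      (differentiableAt_of_contDiffOn hs (contDiffOn_pd hs hχ j) hy),
    pd_comp_deriv hs hI hd hχ hm hy]
  simp only [pd_comp_deriv hs hI hΨ hχ hm hy, Fin.sum_univ_four]
  ring

end Composition

lemma sum_symm_mul_antisymm {A H : Fin 4 → Fin 4 → ℝ} (hA : ∀ i j, A i j = A j i)
    (hH : ∀ i j, H i j = -H j i) : ∑ i, ∑ j, A i j * H i j = 0 := by
  have : ∑ i, ∑ j, A i j * H i j = -∑ i, ∑ j, A i j * H i j := by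
    conv_lhs => rw [Finset.sum_comm]
    simp only [← Finset.sum_neg_distrib]
    refine Finset.sum_congr rfl fun i _ => Finset.sum_congr rfl fun j _ => ?_
    rw [hA j i, hH j i]; ring
  linarith

namespace StaticFrame

variable {s : Set E4} {γ : E4 → Matrix (Fin 4) (Fin 4) ℝ} {τ ξ : Fin 4 → E4 → ℝ}
  (h : StaticFrame s γ τ ξ) {y : E4} {f u χ Φ : E4 → ℝ}
include h

lemma inv_static_τ (hy : y ∈ s) (i : Fin 4) :
    ∑ k, (staticMetric γ τ u y)⁻¹ i k * τ k y = Real.exp (-2 * u y) * ξ i y := by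
  have h1 := h.inv_mul_τ hy i
  have h2 := h.pairing y hy
  simp only [h.staticMetric_inv hy]
  simp only [Fin.sum_univ_four] at *
  linear_combination Real.exp (2 * u y) * h1 +
    (Real.exp (2 * u y) - Real.exp (-2 * u y)) * ξ i y * h2

lemma inv_static_pd (hinv : ∀ z ∈ s, ∑ k, ξ k z * pd k f z = 0) (hy : y ∈ s) (i : Fin 4) :
    ∑ k, (staticMetric γ τ u y)⁻¹ i k * pd k f y =
      Real.exp (2 * u y) * gradient (baseMetric γ τ) f i y := by
  have h2 := hinv y hy
  simp only [h.staticMetric_inv hy, gradient]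
  simp only [Fin.sum_univ_four] at *
  linear_combination (Real.exp (2 * u y) - Real.exp (-2 * u y)) * ξ i y * h2

/-- The metrics `e^{-2u} γ - e^{2u} τ ⊗ τ` all have, up to the factor `e^{2u}`, the same wave
operator on static functions. -/
lemma box_staticMetric (hu : ContDiffOn ℝ ∞ u s) (hinvu : ∀ z ∈ s, ∑ k, ξ k z * pd k u z = 0)
    (hf : ContDiffOn ℝ ∞ f s) (hinv : ∀ z ∈ s, ∑ k, ξ k z * pd k f z = 0) (hy : y ∈ s) :
    box (staticMetric γ τ u) f y = Real.exp (2 * u y) *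
      ∑ k, ∑ l, (baseMetric γ τ y)⁻¹ k l * hessian (baseMetric γ τ) f k l y := by
  have hH : ∀ i j, pd i (pd j f) y - ∑ l, christoffel (staticMetric γ τ u) l i j y * pd l f y =
      hessian (baseMetric γ τ) f i j y + pd i u y * pd j f y + pd i f y * pd j u y -
        (∑ l, gradient (baseMetric γ τ) u l y * pd l f y) * wickForm γ τ u i j y := by
    intro i j
    have h1 := reflection_pd τ (hinv y hy) j
    have h2 := reflection_pd τ (hinv y hy) i
    simp only [h.christoffel_staticMetric hu hinvu hy, hessian, connectionShift]
    simp only [Fin.sum_univ_four] at *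
    linear_combination pd i u y * h1 + pd j u y * h2
  have h1 : ∑ i, ∑ j, (staticMetric γ τ u y)⁻¹ i j * hessian (baseMetric γ τ) f i j y =
      Real.exp (2 * u y) *
        ∑ i, ∑ j, (baseMetric γ τ y)⁻¹ i j * hessian (baseMetric γ τ) f i j y := by
    rw [Finset.mul_sum]
    refine Finset.sum_congr rfl fun i _ => ?_
    have h2 := h.hessian_ξ hf hinv hy i
    simp only [h.staticMetric_inv hy]
    simp only [Fin.sum_univ_four] at *
    linear_combination (Real.exp (2 * u y) - Real.exp (-2 * u y)) * ξ i y * h2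
  have h2 : ∑ i, ∑ j, (staticMetric γ τ u y)⁻¹ i j * (pd i u y * pd j f y) =
      Real.exp (2 * u y) * ∑ l, gradient (baseMetric γ τ) f l y * pd l u y := by
    rw [Finset.mul_sum]
    refine Finset.sum_congr rfl fun i _ => ?_
    have h2 := h.inv_static_pd (u := u) hinv hy i
    simp only [Fin.sum_univ_four] at *
    linear_combination pd i u y * h2
  have h3 : ∑ i, ∑ j, (staticMetric γ τ u y)⁻¹ i j * (pd i f y * pd j u y) =
      Real.exp (2 * u y) * ∑ l, gradient (baseMetric γ τ) u l y * pd l f y := by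
    rw [Finset.mul_sum]
    refine Finset.sum_congr rfl fun i _ => ?_
    have h2 := h.inv_static_pd (u := u) hinvu hy i
    simp only [Fin.sum_univ_four] at *
    linear_combination pd i f y * h2
  have h4 : ∑ l, gradient (baseMetric γ τ) f l y * pd l u y =
      ∑ l, gradient (baseMetric γ τ) u l y * pd l f y := by
    simp only [gradient, Finset.sum_mul]
    rw [Finset.sum_comm]
    refine Finset.sum_congr rfl fun i _ => Finset.sum_congr rfl fun j _ => ?_
    rw [h.inv_base_symm hy i j]; ring
  have h5 : ∑ i, ∑ j, (staticMetric γ τ u y)⁻¹ i j * wickForm γ τ u i j y =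
      2 * Real.exp (2 * u y) := by
    -- on `γ` the static metric and the form `e^{-2u} γ + e^{2u} τ ⊗ τ` agree
    have hrow : ∀ i, ∑ j, (staticMetric γ τ u y)⁻¹ i j * wickForm γ τ u i j y =
        Real.exp (2 * u y) * (1 + 2 * (ξ i y * τ i y)) := by
      intro i
      have h6 : ∑ j, (staticMetric γ τ u y)⁻¹ i j * staticMetric γ τ u y j i = 1 := by
        rw [← Matrix.mul_apply, Matrix.nonsing_inv_mul _
          (isUnit_iff_ne_zero.2 (h.staticMetric_det_ne_zero hy)), Matrix.one_apply_eq]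
      have h7 := h.inv_static_τ (u := u) hy i
      have hx : Real.exp (2 * u y) * Real.exp (-2 * u y) = 1 := by
        rw [← Real.exp_add]; simp
      have hx2 : Real.exp (4 * u y) = Real.exp (2 * u y) * Real.exp (2 * u y) := by
        rw [← Real.exp_add]; ring_nf
      simp only [show ∀ j, staticMetric γ τ u y j i = Real.exp (-2 * u y) * γ y j i -
        Real.exp (2 * u y) * (τ j y * τ i y) from fun _ => rfl, h.symm y hy _ i] at h6
      simp only [wickForm, hx2]
      generalize (staticMetric γ τ u y)⁻¹ = K at *
      simp only [Fin.sum_univ_four] at *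
      linear_combination Real.exp (2 * u y) * h6 +
        2 * Real.exp (2 * u y) ^ 2 * τ i y * h7 + (2 * Real.exp (2 * u y) * ξ i y * τ i y -
        (K i 0 * γ y i 0 + K i 1 * γ y i 1 + K i 2 * γ y i 2 + K i 3 * γ y i 3)) * hx
    rw [Finset.sum_congr rfl fun i _ => hrow i]
    have h8 := h.pairing y hy
    simp only [Fin.sum_univ_four] at *
    linear_combination 2 * Real.exp (2 * u y) * h8
  rw [h4] at h2
  simp only [box, hH]
  have h6 : ∀ i j, (staticMetric γ τ u y)⁻¹ i j * (hessian (baseMetric γ τ) f i j y +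
      pd i u y * pd j f y + pd i f y * pd j u y -
        (∑ l, gradient (baseMetric γ τ) u l y * pd l f y) * wickForm γ τ u i j y) =
      (staticMetric γ τ u y)⁻¹ i j * hessian (baseMetric γ τ) f i j y +
      (staticMetric γ τ u y)⁻¹ i j * (pd i u y * pd j f y) +
      (staticMetric γ τ u y)⁻¹ i j * (pd i f y * pd j u y) -
      (∑ l, gradient (baseMetric γ τ) u l y * pd l f y) *
        ((staticMetric γ τ u y)⁻¹ i j * wickForm γ τ u i j y) := fun i j => by ring
  simp only [h6, Finset.sum_sub_distrib, Finset.sum_add_distrib, ← Finset.mul_sum, h1, h2, h3, h5]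
  ring

lemma raise_electricForm (hinv : ∀ z ∈ s, ∑ k, ξ k z * pd k Φ z = 0) (hy : y ∈ s) (i j : Fin 4) :
    raise (staticMetric γ τ u) (electricForm τ Φ) y i j =
      ξ i y * gradient (baseMetric γ τ) Φ j y - ξ j y * gradient (baseMetric γ τ) Φ i y := by
  have h1 := h.inv_static_τ (u := u) hy i
  have h2 := h.inv_static_τ (u := u) hy j
  have h3 := h.inv_static_pd (u := u) hinv hy i
  have h4 := h.inv_static_pd (u := u) hinv hy j
  have hx : Real.exp (2 * u y) * Real.exp (-2 * u y) = 1 := by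
    rw [← Real.exp_add]; simp
  have h5 : raise (staticMetric γ τ u) (electricForm τ Φ) y i j =
      (∑ k, (staticMetric γ τ u y)⁻¹ i k * τ k y) *
        (∑ k, (staticMetric γ τ u y)⁻¹ j k * pd k Φ y) -
      (∑ k, (staticMetric γ τ u y)⁻¹ j k * τ k y) *
        (∑ k, (staticMetric γ τ u y)⁻¹ i k * pd k Φ y) := by
    simp only [raise, electricForm, Matrix.of_apply, Fin.sum_univ_four]
    ring
  rw [h5, h1, h2, h3, h4]
  linear_combination (ξ i y * gradient (baseMetric γ τ) Φ j y -
    ξ j y * gradient (baseMetric γ τ) Φ i y) * hx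

lemma normSq_electricForm (hinv : ∀ z ∈ s, ∑ k, ξ k z * pd k Φ z = 0) (hy : y ∈ s) :
    normSq (staticMetric γ τ u) (electricForm τ Φ) y =
      -2 * ∑ k, pd k Φ y * gradient (baseMetric γ τ) Φ k y := by
  have h1 := h.pairing y hy
  have h2 := hinv y hy
  have h3 : normSq (staticMetric γ τ u) (electricForm τ Φ) y =
      2 * ((∑ i, τ i y * ξ i y) * (∑ k, pd k Φ y * gradient (baseMetric γ τ) Φ k y) -
        (∑ k, ξ k y * pd k Φ y) * (∑ k, τ k y * gradient (baseMetric γ τ) Φ k y)) := by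
    simp only [normSq, h.raise_electricForm hinv hy]
    simp only [electricForm, Matrix.of_apply, Fin.sum_univ_four]
    ring
  rw [h3, h1, h2]
  ring

lemma sq_electricForm (hinv : ∀ z ∈ s, ∑ k, ξ k z * pd k Φ z = 0) (hy : y ∈ s) (i j : Fin 4) :
    ∑ k, ∑ l, (staticMetric γ τ u y)⁻¹ k l * electricForm τ Φ y i k * electricForm τ Φ y j l =
      Real.exp (2 * u y) * (τ i y * τ j y) *
        (∑ k, pd k Φ y * gradient (baseMetric γ τ) Φ k y) -
      Real.exp (-2 * u y) * (pd i Φ y * pd j Φ y) := by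
  have h0 : ∀ k, ∑ l, (staticMetric γ τ u y)⁻¹ k l * electricForm τ Φ y i k *
      electricForm τ Φ y j l = electricForm τ Φ y i k * (τ j y *
        (Real.exp (2 * u y) * gradient (baseMetric γ τ) Φ k y) -
        Real.exp (-2 * u y) * ξ k y * pd j Φ y) := by
    intro k
    have h1 := h.inv_static_τ (u := u) hy k
    have h2 := h.inv_static_pd (u := u) hinv hy k
    rw [← h1, ← h2]
    simp only [electricForm, Matrix.of_apply, Fin.sum_univ_four]
    ring
  rw [Finset.sum_congr rfl fun k _ => h0 k]
  have h1 := h.pairing y hy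
  have h2 := hinv y hy
  have h3 := h.τ_gradient hinv hy
  simp only [electricForm, Matrix.of_apply, Fin.sum_univ_four] at *
  linear_combination -τ i y * Real.exp (-2 * u y) * pd j Φ y * h2 -
    pd i Φ y * τ j y * Real.exp (2 * u y) * h3 +
    pd i Φ y * Real.exp (-2 * u y) * pd j Φ y * h1

/-- The divergence of `f ξ ∧ grad χ`, for harmonic `χ`, with respect to the static metric of
potential `u`. -/
lemma divergence_electric (hu : ContDiffOn ℝ ∞ u s)
    (hinvu : ∀ z ∈ s, ∑ k, ξ k z * pd k u z = 0) (hχ : ContDiffOn ℝ ∞ χ s)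
    (hinv : ∀ z ∈ s, ∑ k, ξ k z * pd k χ z = 0) (hy : y ∈ s)
    (hbox : ∑ k, ∑ l, (baseMetric γ τ y)⁻¹ k l * hessian (baseMetric γ τ) χ k l y = 0)
    (c : ℝ) {H : E4 → Matrix (Fin 4) (Fin 4) ℝ}
    (hH : ∀ z ∈ s, ∀ i j, H z i j = c * Real.exp (2 * u z) *
      (ξ i z * gradient (baseMetric γ τ) χ j z - ξ j z * gradient (baseMetric γ τ) χ i z))
    (j : Fin 4) : divergence (staticMetric γ τ u) H j y = 0 := by
  have hd : ∀ {f : E4 → ℝ}, ContDiffOn ℝ ∞ f s → DifferentiableAt ℝ f y := fun hf =>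
    differentiableAt_of_contDiffOn h.isOpen hf hy
  have hg := fun a => hd (h.gradient_smooth hχ a)
  have hξ := fun a => h.diff_ξ hy a
  have hant : ∀ i j, H y i j = -H y j i := fun i j => by rw [hH y hy, hH y hy]; ring
  -- the Christoffel symbols contracted with both indices of an antisymmetric tensor vanish
  have h1 : ∑ i, ∑ l, christoffel (staticMetric γ τ u) j i l y * H y i l = 0 :=
    sum_symm_mul_antisymm (fun i l => christoffel_symm h.isOpen
      (fun z hz => h.staticMetric_symm hz) hy j i l) hant
  have h2 : ∑ i, ∑ l, christoffel (baseMetric γ τ) j i l y *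
      (ξ i y * gradient (baseMetric γ τ) χ l y - ξ l y * gradient (baseMetric γ τ) χ i y) = 0 :=
    sum_symm_mul_antisymm (fun i l => h.conn_symm hy j i l) fun i l => by ring
  have h3 : ∑ i, ∑ l, connectionShift γ τ ξ u i i l y * H y l j =
      -2 * ∑ l, pd l u y * H y l j := by
    rw [Finset.sum_comm]
    simp only [← Finset.sum_mul, h.connectionShift_trace hinvu hy, Finset.mul_sum]
    exact Finset.sum_congr rfl fun _ _ => by ring
  have h4 : ∑ i, ∑ l, (baseMetric γ τ y)⁻¹ j l * hessian (baseMetric γ τ) χ i l y * ξ i y = 0 := by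
    rw [Finset.sum_comm]
    refine Finset.sum_eq_zero fun l _ => ?_
    have h5 := h.hessian_ξ hχ hinv hy l
    simp only [h.hessian_symm hχ hy l] at h5
    simp only [mul_assoc, ← Finset.mul_sum, h5, mul_zero]
  have hpe : ∀ i, pd i (fun z => c * Real.exp (2 * u z)) y =
      c * Real.exp (2 * u y) * (2 * pd i u y) := fun i => by
    rw [pd_comp i (Ψ := fun t => c * Real.exp (2 * t)) (f := u)
      (Ψ' := c * (Real.exp (2 * u y) * 2))
      (by simpa using (((hasDerivAt_id (u y)).const_mul 2).exp).const_mul c) (hd hu)]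
    ring
  have hpH : ∀ i, pd i (fun z => H z i j) y = 2 * (pd i u y * H y i j) +
      c * Real.exp (2 * u y) * ((ξ i y * pd i (gradient (baseMetric γ τ) χ j) y +
        gradient (baseMetric γ τ) χ j y * pd i (ξ i) y) -
        (ξ j y * pd i (gradient (baseMetric γ τ) χ i) y +
        gradient (baseMetric γ τ) χ i y * pd i (ξ j) y)) := by
    intro i
    have hE : DifferentiableAt ℝ (fun z => c * Real.exp (2 * u z)) y :=
      (((hd hu).const_mul 2).exp).const_mul c
    have e1 := (hξ i).fun_mul (hg j)
    have e2 := (hξ j).fun_mul (hg i)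
    rw [pd_congr_on h.isOpen (fun z hz => hH z hz i j) hy, pd_mul i hE (e1.fun_sub e2),
      pd_sub i e1 e2, pd_mul i (hξ i) (hg j), pd_mul i (hξ j) (hg i), hpe, hH y hy]
    ring
  simp only [divergence, Finset.sum_add_distrib, h1, hpH]
  simp only [h.christoffel_staticMetric hu hinvu hy, add_mul, Finset.sum_add_distrib, h3]
  simp only [h.pd_gradient hχ hy, h.pd_ξ hy, hH y hy]
  simp only [Fin.sum_univ_four] at *
  linear_combination c * Real.exp (2 * u y) * (h4 - ξ j y * hbox - h2)

end StaticFrame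

namespace StaticFrame

variable {s : Set E4} {γ : E4 → Matrix (Fin 4) (Fin 4) ℝ} {τ ξ : Fin 4 → E4 → ℝ}
  (h : StaticFrame s γ τ ξ) {y : E4} {χ : E4 → ℝ}
include h

/-- In vacuum the potential `χ` is harmonic: the contraction of the vacuum equations with `ξ` twice
leaves only the wave operator, since `ξ` is parallel for the base metric. -/
lemma harmonic_of_vacuum (hχ : ContDiffOn ℝ ∞ χ s)
    (hinv : ∀ z ∈ s, ∑ k, ξ k z * pd k χ z = 0) (hy : y ∈ s)
    (hvac : ∀ i j, ricci (staticMetric γ τ χ) i j y = 0) :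
    ∑ k, ∑ l, (baseMetric γ τ y)⁻¹ k l * hessian (baseMetric γ τ) χ k l y = 0 := by
  set L := ∑ k, ∑ l, (baseMetric γ τ y)⁻¹ k l * hessian (baseMetric γ τ) χ k l y with hL
  have h1 : ∀ j, L * (Real.exp (4 * χ y) * τ j y) = 0 := by
    intro j
    have hr := h.ricci_base_ξ hy j
    have e : ∀ i, ricci (baseMetric γ τ) i j y =
        2 * (pd i χ y * pd j χ y) - L * wickForm γ τ χ i j y := fun i => by
      have := h.ricci_staticMetric hχ hinv hy i j
      rw [hvac] at this
      linarith
    have hk := h.ker' hy j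
    have hp := h.pairing y hy
    have hi := hinv y hy
    simp only [e, wickForm] at hr
    simp only [Fin.sum_univ_four] at hr hk hp hi
    linear_combination hr - 2 * pd j χ y * hi + L * hk + L * Real.exp (4 * χ y) * τ j y * hp
  by_contra hne
  have h2 : ∀ j, τ j y = 0 := fun j => by
    have := h1 j
    simpa [hne, Real.exp_ne_zero] using this
  have hp := h.pairing y hy
  simp [h2] at hp

/-- The field equations hold for the fields generated from a vacuum solution of potential `χ` by
a generating curve. The vacuum equations enter as `□χ = 0` and `Ric(B) = 2 dχ ⊗ dχ`; with
`N = |dχ|²` every remaining term is a function of `χ` times `N` or times `dχ ⊗ dχ`. -/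
theorem fieldEquations {α c : ℝ} {I : Set ℝ} {U V W : ℝ → ℝ} (C : GeneratingCurve α c I U V W)
    (hχ : ContDiffOn ℝ ∞ χ s) (hinv : ∀ z ∈ s, ∑ k, ξ k z * pd k χ z = 0)
    (hm : ∀ z ∈ s, χ z ∈ I) (hvac : ∀ z ∈ s, ∀ i j, ricci (staticMetric γ τ χ) i j z = 0)
    (hy : y ∈ s) :
    FieldEquationsAt α (staticMetric γ τ fun z => U (χ z))
      (electricForm τ fun z => W (χ z)) (fun z => V (χ z)) y := by
  have hs := h.isOpen
  have hI := C.isOpen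
  have smooth : ∀ {Ψ : ℝ → ℝ}, ContDiffOn ℝ ∞ Ψ I → ContDiffOn ℝ ∞ (fun z => Ψ (χ z)) s :=
    fun hΨ => hΨ.comp hχ hm
  have hpd : ∀ {Ψ : ℝ → ℝ}, ContDiffOn ℝ ∞ Ψ I → ∀ z ∈ s, ∀ i,
      pd i (fun z => Ψ (χ z)) z = deriv Ψ (χ z) * pd i χ z := fun hΨ z hz i =>
    pd_comp_deriv hs hI hΨ hχ hm hz i
  have inv : ∀ {Ψ : ℝ → ℝ}, ContDiffOn ℝ ∞ Ψ I →
      ∀ z ∈ s, ∑ k, ξ k z * pd k (fun z => Ψ (χ z)) z = 0 := by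
    intro Ψ hΨ z hz
    have := hinv z hz
    simp only [hpd hΨ z hz, Fin.sum_univ_four] at this ⊢
    linear_combination deriv Ψ (χ z) * this
  have grad : ∀ {Ψ : ℝ → ℝ}, ContDiffOn ℝ ∞ Ψ I → ∀ z ∈ s, ∀ i,
      gradient (baseMetric γ τ) (fun z => Ψ (χ z)) i z =
        deriv Ψ (χ z) * gradient (baseMetric γ τ) χ i z := by
    intro Ψ hΨ z hz i
    simp only [gradient, hpd hΨ z hz, Fin.sum_univ_four]
    ring
  have hbox := h.harmonic_of_vacuum hχ hinv hy (hvac y hy)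
  set N := ∑ k, pd k χ y * gradient (baseMetric γ τ) χ k y with hN
  have lap : ∀ {Ψ : ℝ → ℝ}, ContDiffOn ℝ ∞ Ψ I →
      ∑ k, ∑ l, (baseMetric γ τ y)⁻¹ k l *
        hessian (baseMetric γ τ) (fun z => Ψ (χ z)) k l y = deriv (deriv Ψ) (χ y) * N := by
    intro Ψ hΨ
    simp only [hessian_comp (baseMetric γ τ) hs hI hΨ hχ hm hy]
    simp only [hN, gradient, Fin.sum_univ_four] at hbox ⊢
    linear_combination deriv Ψ (χ y) * hbox
  have hNW : ∑ k, pd k (fun z => W (χ z)) y *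
      gradient (baseMetric γ τ) (fun z => W (χ z)) k y = deriv W (χ y) ^ 2 * N := by
    simp only [hpd C.smooth_W y hy, grad C.smooth_W y hy, hN, Fin.sum_univ_four]
    ring
  have hU2 := C.second_U _ (hm y hy)
  have hV2 := C.second_V _ (hm y hy)
  have hE := C.energy _ (hm y hy)
  have hW1 := C.first_W _ (hm y hy)
  -- the coefficient `e^{-2αφ}` of the Maxwell term balances `W'²`
  have hexp : Real.exp (-2 * α * V (χ y)) * Real.exp (2 * (U (χ y) + α * V (χ y))) =
      Real.exp (2 * U (χ y)) := by
    rw [← Real.exp_add]; ring_nf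
  have hexp2 : Real.exp (-2 * U (χ y)) * Real.exp (2 * U (χ y)) = 1 := by
    rw [← Real.exp_add]; simp
  refine ⟨fun i j => ?_, fun j => ?_, ?_⟩
  · have hric := h.ricci_staticMetric (smooth C.smooth_U) (inv C.smooth_U) hy i j
    have hvac' := h.ricci_staticMetric hχ hinv hy i j
    rw [hvac y hy, hbox] at hvac'
    rw [lap C.smooth_U] at hric
    have hexp4 : Real.exp (4 * U (χ y)) = Real.exp (2 * U (χ y)) ^ 2 := by
      rw [← Real.exp_nat_mul]; ring_nf
    rw [hric, h.sq_electricForm (inv C.smooth_W) hy, h.normSq_electricForm (inv C.smooth_W) hy,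
      hNW, hpd C.smooth_W y hy, hpd C.smooth_W y hy, hpd C.smooth_V y hy, hpd C.smooth_V y hy,
      hpd C.smooth_U y hy, hpd C.smooth_U y hy, hU2, hW1]
    simp only [wickForm, staticMetric, Matrix.of_apply, hexp4]
    generalize Real.exp (2 * (U (χ y) + α * V (χ y))) = P at *
    generalize Real.exp (-2 * α * V (χ y)) = R at *
    generalize Real.exp (2 * U (χ y)) = x at *
    generalize Real.exp (-2 * U (χ y)) = x' at *
    have hRx : R * P * x' = 1 := by rw [hexp, mul_comm, hexp2]
    linear_combination -hvac' - 2 * (pd i χ y * pd j χ y) * hE -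
      c ^ 2 * N * P * γ y i j * hRx - c ^ 2 * N * P * x * (τ i y * τ j y) * hexp +
      2 * c ^ 2 * P * (pd i χ y * pd j χ y) * hRx
  · refine h.divergence_electric (smooth C.smooth_U) (inv C.smooth_U) hχ hinv hy hbox c ?_ j
    intro z hz i j
    have hexpz : Real.exp (-2 * α * V (χ z)) * Real.exp (2 * (U (χ z) + α * V (χ z))) =
        Real.exp (2 * U (χ z)) := by
      rw [← Real.exp_add]; ring_nf
    rw [Matrix.smul_apply, h.raise_electricForm (inv C.smooth_W) hz, grad C.smooth_W z hz,
      grad C.smooth_W z hz, C.first_W _ (hm z hz), ← hexpz, smul_eq_mul]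
    ring
  · rw [h.box_staticMetric (smooth C.smooth_U) (inv C.smooth_U) (smooth C.smooth_V)
      (inv C.smooth_V) hy, lap C.smooth_V, h.normSq_electricForm (inv C.smooth_W) hy, hNW, hV2,
      hW1, ← hexp]
    ring

end StaticFrame

/-! ### Components in smooth charts -/

section Charts

variable {M : Type*} [TopologicalSpace M] [ChartedSpace E4 M]
  {e : OpenPartialHomeomorph M E4}

lemma mdifferentiable_of_mem_smoothCharts (he : e ∈ smoothCharts M) :
    e.MDifferentiable (𝓡 4) (𝓡 4) :=
  ⟨(contMDiffOn_of_mem_maximalAtlas he).mdifferentiableOn (by simp),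
    (contMDiffOn_symm_of_mem_maximalAtlas he).mdifferentiableOn (by simp)⟩

/-- A tangent vector is the sum of its components times the coordinate vectors. -/
lemma eq_sum_coordVec (he : e ∈ smoothCharts M) {y : E4} (hy : y ∈ e.target)
    (v : TangentSpace (𝓡 4) (e.symm y)) :
    v = ∑ i, (show E4 from mfderiv (𝓡 4) (𝓡 4) e (e.symm y) v) i • coordVec e i y := by
  have h1 := (mdifferentiable_of_mem_smoothCharts he).symm_comp_deriv (e.map_target hy)
  have h2 := congrArg (fun L => L v) h1
  rw [e.right_inv hy] at h2
  set w : E4 := mfderiv (𝓡 4) (𝓡 4) e (e.symm y) v with hw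
  have h3 : w = ∑ i, w i • EuclideanSpace.single i (1 : ℝ) := by
    ext j; simp [Pi.single_apply]
  have h4 : v = mfderiv (𝓡 4) (𝓡 4) e.symm y w := h2.symm
  conv_lhs => rw [h4, h3]
  exact map_sum (mfderiv (𝓡 4) (𝓡 4) e.symm y) _ _ |>.trans
    (Finset.sum_congr rfl fun i _ => map_smul (mfderiv (𝓡 4) (𝓡 4) e.symm y) _ _)

lemma vectorField_eq_sum (he : e ∈ smoothCharts M) {y : E4} (hy : y ∈ e.target)
    (X : VectorField M) : X (e.symm y) = ∑ i, vecComp e X i y • coordVec e i y :=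
  eq_sum_coordVec he hy _

lemma sum_coordVec_eq_zero (he : e ∈ smoothCharts M) {y : E4} (hy : y ∈ e.target) {w : Fin 4 → ℝ}
    (hw : ∑ i, w i • coordVec e i y = 0) : w = 0 := by
  have h1 := (mdifferentiable_of_mem_smoothCharts he).comp_symm_deriv hy
  set w' : E4 := WithLp.toLp 2 w with hw'
  have h3 : w' = ∑ i, w i • EuclideanSpace.single i (1 : ℝ) := by
    ext j; simp [Pi.single_apply, hw']
  have h4 : mfderiv (𝓡 4) (𝓡 4) e.symm y w' = 0 := by
    rw [← hw, h3]
    exact map_sum (mfderiv (𝓡 4) (𝓡 4) e.symm y) _ _ |>.trans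
      (Finset.sum_congr rfl fun i _ => map_smul (mfderiv (𝓡 4) (𝓡 4) e.symm y) _ _)
  have h2 : mfderiv (𝓡 4) (𝓡 4) e (e.symm y) (mfderiv (𝓡 4) (𝓡 4) e.symm y w') = w' :=
    congrArg (fun L => L w') h1
  rw [h4, map_zero] at h2
  funext i
  exact (congrArg (fun v : E4 => v i) h2).symm

lemma formComp_lower (he : e ∈ smoothCharts M) {y : E4} (hy : y ∈ e.target) (g : TwoTensor M)
    (X : VectorField M) (i : Fin 4) :
    formComp e (lower g X) i y = ∑ k, vecComp e X k y * tensorComp e g y k i := by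
  simp only [formComp, lower]
  rw [vectorField_eq_sum he hy X]
  simp [tensorComp]

lemma form_apply (he : e ∈ smoothCharts M) {y : E4} (hy : y ∈ e.target) (η : OneForm M)
    (X : VectorField M) :
    η (e.symm y) (X (e.symm y)) = ∑ k, vecComp e X k y * formComp e η k y := by
  rw [vectorField_eq_sum he hy X]
  simp [formComp]

lemma funComp_contDiffOn (he : e ∈ smoothCharts M) {f : M → ℝ}
    (hf : ContMDiff (𝓡 4) 𝓘(ℝ, ℝ) ∞ f) : ContDiffOn ℝ ∞ (funComp e f) e.target := by
  have := hf.comp_contMDiffOn (contMDiffOn_symm_of_mem_maximalAtlas he)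
  exact contMDiffOn_iff_contDiffOn.1 this

lemma contMDiff_of_funComp [IsManifold (𝓡 4) ∞ M] {f : M → ℝ}
    (hf : ∀ e ∈ smoothCharts M, ContDiffOn ℝ ∞ (funComp e f) e.target) :
    ContMDiff (𝓡 4) 𝓘(ℝ, ℝ) ∞ f := by
  intro p
  have he : chartAt E4 p ∈ smoothCharts M := IsManifold.chart_mem_maximalAtlas p
  have h1 := (contMDiffOn_iff_contDiffOn.2 (hf _ he)).comp
    (contMDiffOn_of_mem_maximalAtlas he) (fun q hq => (chartAt E4 p).map_source hq)
  refine (h1.congr ?_).contMDiffAt ((chartAt E4 p).open_source.mem_nhds (mem_chart_source E4 p))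
  intro q hq
  simp [funComp, (chartAt E4 p).left_inv hq]

lemma formComp_differential (he : e ∈ smoothCharts M) {f : M → ℝ}
    (hf : ContMDiff (𝓡 4) 𝓘(ℝ, ℝ) ∞ f) {y : E4} (hy : y ∈ e.target) (i : Fin 4) :
    formComp e (differential f) i y = pd i (funComp e f) y := by
  have h1 := (mdifferentiable_of_mem_smoothCharts he).mdifferentiableAt_symm hy
  have h2 : MDifferentiableAt (𝓡 4) 𝓘(ℝ, ℝ) f (e.symm y) := (hf _).mdifferentiableAt (by simp)
  have h3 := mfderiv_comp y h2 h1
  have h4 : mfderiv (𝓡 4) 𝓘(ℝ, ℝ) (f ∘ e.symm) y = fderiv ℝ (funComp e f) y := mfderiv_eq_fderiv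
  rw [h4] at h3
  simp only [pd, h3]
  rfl

lemma exists_chart_point [IsManifold (𝓡 4) ∞ M] (p : M) :
    ∃ e ∈ smoothCharts M, ∃ y ∈ e.target, e.symm y = p :=
  ⟨chartAt E4 p, IsManifold.chart_mem_maximalAtlas p, chartAt E4 p p,
    (chartAt E4 p).map_source (mem_chart_source E4 p),
    (chartAt E4 p).left_inv (mem_chart_source E4 p)⟩

end Charts

/-! ### The static frame of a static metric -/

section Frame

variable {s : Set E4} {G : E4 → Matrix (Fin 4) (Fin 4) ℝ} {ξ η : Fin 4 → E4 → ℝ} {χ : E4 → ℝ}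
  {y : E4}

/-- The one-form `τ = e^{-2χ} η`. -/
def timeComp (η : Fin 4 → E4 → ℝ) (χ : E4 → ℝ) (i : Fin 4) (y : E4) : ℝ :=
  Real.exp (-2 * χ y) * η i y

/-- The conformal spatial metric `γ = e^{2χ} G + e^{4χ} τ ⊗ τ`, so that
`G = e^{-2χ} γ - e^{2χ} τ ⊗ τ`. -/
def spatialComp (G : E4 → Matrix (Fin 4) (Fin 4) ℝ) (η : Fin 4 → E4 → ℝ) (χ : E4 → ℝ) (y : E4) :
    Matrix (Fin 4) (Fin 4) ℝ :=
  Matrix.of fun i j => Real.exp (2 * χ y) * G y i j +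
    Real.exp (4 * χ y) * (timeComp η χ i y * timeComp η χ j y)

lemma staticMetric_spatialComp : staticMetric (spatialComp G η χ) (timeComp η χ) χ = G := by
  funext y
  ext i j
  have h1 : Real.exp (2 * χ y) * Real.exp (-2 * χ y) = 1 := by
    rw [← Real.exp_add]; simp
  have h4 : Real.exp (4 * χ y) = Real.exp (2 * χ y) ^ 2 := by
    rw [← Real.exp_nat_mul]; ring_nf
  simp only [staticMetric, spatialComp, Matrix.of_apply, h4]
  generalize timeComp η χ i y = a
  generalize timeComp η χ j y = b
  linear_combination (G y i j + Real.exp (2 * χ y) * (a * b)) * h1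

lemma pd_exp_mul (c : ℝ) (hχ : DifferentiableAt ℝ χ y) (i : Fin 4) :
    pd i (fun z => Real.exp (c * χ z)) y = Real.exp (c * χ y) * (c * pd i χ y) := by
  rw [pd_comp i (Ψ := fun t => Real.exp (c * t)) (Ψ' := Real.exp (c * χ y) * c)
    (by simpa using ((hasDerivAt_id (χ y)).const_mul c).exp) hχ]
  ring

/-- Invariance of a combination `a T + b τ ⊗ τ` of invariant objects. -/
lemma lieDeriv_combination {a b : E4 → ℝ} {T : E4 → Matrix (Fin 4) (Fin 4) ℝ}
    {τ : Fin 4 → E4 → ℝ} (ha : DifferentiableAt ℝ a y) (hb : DifferentiableAt ℝ b y)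
    (hT : ∀ i j, DifferentiableAt ℝ (fun z => T z i j) y) (hτ : ∀ i, DifferentiableAt ℝ (τ i) y)
    (ha0 : ∑ k, ξ k y * pd k a y = 0) (hb0 : ∑ k, ξ k y * pd k b y = 0)
    (hT0 : ∀ i j, lieDeriv ξ T i j y = 0)
    (hτ0 : ∀ i, ∑ k, (ξ k y * pd k (τ i) y + τ k y * pd i (ξ k) y) = 0) (i j : Fin 4) :
    lieDeriv ξ (fun z => Matrix.of fun i j => a z * T z i j + b z * (τ i z * τ j z)) i j y = 0 := by
  have h1 : ∀ k, pd k (fun z => a z * T z i j + b z * (τ i z * τ j z)) y =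
      a y * pd k (fun z => T z i j) y + T y i j * pd k a y +
      (b y * (τ i y * pd k (τ j) y + τ j y * pd k (τ i) y) + τ i y * τ j y * pd k b y) := by
    intro k
    have ht := (hτ i).fun_mul (hτ j)
    rw [pd_add k (ha.fun_mul (hT i j)) (hb.fun_mul ht), pd_mul k ha (hT i j), pd_mul k hb ht,
      pd_mul k (hτ i) (hτ j)]
  have h2 := hT0 i j
  have h3 := hτ0 i
  have h4 := hτ0 j
  simp only [lieDeriv, Matrix.of_apply, h1] at h2 ⊢
  simp only [Fin.sum_univ_four] at *
  linear_combination T y i j * ha0 + τ i y * τ j y * hb0 + a y * h2 + b y * τ i y * h4 +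
    b y * τ j y * h3

variable (hs : IsOpen s) (hG : ∀ i j, ContDiffOn ℝ ∞ (fun y => G y i j) s)
  (hξ : ∀ i, ContDiffOn ℝ ∞ (ξ i) s) (hχ : ContDiffOn ℝ ∞ χ s)
  (hη : ∀ y ∈ s, ∀ i, η i y = ∑ k, ξ k y * G y k i)
  (hnorm : ∀ y ∈ s, ∑ k, ξ k y * η k y = -Real.exp (2 * χ y))
  (hkill : ∀ y ∈ s, ∀ i j, lieDeriv ξ G i j y = 0)
include hG hξ hη

lemma lowered_smooth (i : Fin 4) : ContDiffOn ℝ ∞ (η i) s :=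
  ContDiffOn.congr (ContDiffOn.sum fun k _ => (hξ k).mul (hG k i)) fun z hz => hη z hz i

include hs

/-- The one-form dual to a Killing field is invariant. -/
lemma lie_lowered (hkill : ∀ y ∈ s, ∀ i j, lieDeriv ξ G i j y = 0) (hy : y ∈ s) (j : Fin 4) :
    ∑ k, (ξ k y * pd k (η j) y + η k y * pd j (ξ k) y) = 0 := by
  have hd : ∀ {f : E4 → ℝ}, ContDiffOn ℝ ∞ f s → DifferentiableAt ℝ f y := fun hf =>
    differentiableAt_of_contDiffOn hs hf hy
  have h1 : ∀ i, pd i (η j) y = ∑ k, (ξ k y * pd i (fun z => G z k j) y +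
      G y k j * pd i (ξ k) y) := by
    intro i
    rw [pd_congr_on hs (fun z hz => hη z hz j) hy,
      pd_sum _ _ fun k _ => (hd (hξ k)).fun_mul (hd (hG k j))]
    exact Finset.sum_congr rfl fun k _ => pd_mul i (hd (hξ k)) (hd (hG k j))
  have h2 : ∑ k, ξ k y * lieDeriv ξ G k j y = 0 := by simp [hkill y hy]
  simp only [lieDeriv] at h2
  simp only [h1, hη y hy]
  simp only [Fin.sum_univ_four] at *
  linear_combination h2

include hχ hnorm

lemma pd_norm (hy : y ∈ s) (j : Fin 4) :
    ∑ k, (ξ k y * pd j (η k) y + η k y * pd j (ξ k) y) =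
      -(2 * Real.exp (2 * χ y) * pd j χ y) := by
  have hd : ∀ {f : E4 → ℝ}, ContDiffOn ℝ ∞ f s → DifferentiableAt ℝ f y := fun hf =>
    differentiableAt_of_contDiffOn hs hf hy
  have hdη := fun k => hd (lowered_smooth hG hξ hη k)
  have h1 := pd_congr_on hs hnorm hy j
  rw [pd_sum _ _ fun k _ => (hd (hξ k)).fun_mul (hdη k), pd_neg, pd_exp_mul 2 (hd hχ)] at h1
  simp only [pd_mul j (hd (hξ _)) (hdη _)] at h1
  rw [h1]; ring

include hkill

/-- The potential of a static metric is invariant. -/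
lemma potential_invariant (hy : y ∈ s) : ∑ k, ξ k y * pd k χ y = 0 := by
  have h1 : ∀ j, ξ j y * ∑ k, (ξ k y * pd j (η k) y + η k y * pd j (ξ k) y) =
      ξ j y * -(2 * Real.exp (2 * χ y) * pd j χ y) := fun j => by
    rw [pd_norm hs hG hξ hχ hη hnorm hy]
  have h2 : ∀ j, ξ j y * ∑ k, (ξ k y * pd k (η j) y + η k y * pd j (ξ k) y) = 0 := fun j => by
    rw [lie_lowered hs hG hξ hη hkill hy, mul_zero]
  have h3 := Finset.sum_congr (rfl : (Finset.univ : Finset (Fin 4)) = _) fun j _ => h1 j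
  have h4 := Finset.sum_eq_zero (s := (Finset.univ : Finset (Fin 4))) fun j _ => h2 j
  have he := Real.exp_ne_zero (2 * χ y)
  have h5 : Real.exp (2 * χ y) * ∑ k, ξ k y * pd k χ y = 0 := by
    simp only [Fin.sum_univ_four] at *
    linear_combination (1/2) * h3 - (1/2) * h4
  exact (mul_eq_zero.1 h5).resolve_left he

/-- A static metric defines a static frame: for a hypersurface-orthogonal Killing field `ξ` of norm
`-e^{2χ}` the one-form `e^{-2χ} ξ♭` is closed. -/
theorem staticFrame_of_static
    (hsymm : ∀ y ∈ s, ∀ i j, G y i j = G y j i) (hdet : ∀ y ∈ s, (G y).det ≠ 0)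
    (horth : ∀ y ∈ s, ∀ i j k, η i y * (pd j (η k) y - pd k (η j) y) +
      η j y * (pd k (η i) y - pd i (η k) y) + η k y * (pd i (η j) y - pd j (η i) y) = 0) :
    StaticFrame s (spatialComp G η χ) (timeComp η χ) ξ := by
  have hη' := lowered_smooth hG hξ hη
  have hexp : ∀ c : ℝ, ContDiffOn ℝ ∞ (fun z => Real.exp (c * χ z)) s := fun c =>
    (contDiffOn_const.mul hχ).exp
  have hτ : ∀ i, ContDiffOn ℝ ∞ (timeComp η χ i) s := fun i => (hexp _).mul (hη' i)
  have hx : ∀ z, Real.exp (2 * χ z) * Real.exp (-2 * χ z) = 1 := fun z => by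
    rw [← Real.exp_add]; simp
  have hx4 : ∀ z, Real.exp (4 * χ z) = Real.exp (2 * χ z) ^ 2 := fun z => by
    rw [← Real.exp_nat_mul]; ring_nf
  have hpair : ∀ y ∈ s, ∑ i, timeComp η χ i y * ξ i y = -1 := by
    intro y hy
    have h1 := hnorm y hy
    have h2 := hx y
    simp only [timeComp, Fin.sum_univ_four] at *
    linear_combination Real.exp (-2 * χ y) * h1 - h2
  have hker : ∀ y ∈ s, ∀ i, ∑ j, spatialComp G η χ y i j * ξ j y = 0 := by
    intro y hy i
    have h1 := hpair y hy
    have h2 := hη y hy i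
    simp only [hsymm y hy _ i] at h2
    have h3 : timeComp η χ i y = Real.exp (-2 * χ y) * η i y := rfl
    have h4 := hx y
    simp only [spatialComp, Matrix.of_apply, hx4]
    simp only [Fin.sum_univ_four] at *
    linear_combination -Real.exp (2 * χ y) * h2 +
      Real.exp (2 * χ y) ^ 2 * timeComp η χ i y * h1 - Real.exp (2 * χ y) ^ 2 * h3 -
      Real.exp (2 * χ y) * η i y * h4
  have hclosed : ∀ y ∈ s, ∀ i j, pd i (timeComp η χ j) y = pd j (timeComp η χ i) y := by
    intro y hy j k
    have hd : ∀ {f : E4 → ℝ}, ContDiffOn ℝ ∞ f s → DifferentiableAt ℝ f y := fun hf =>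
      differentiableAt_of_contDiffOn hs hf hy
    have hpd : ∀ i j, pd i (timeComp η χ j) y =
        Real.exp (-2 * χ y) * (pd i (η j) y - 2 * pd i χ y * η j y) := fun i j => by
      unfold timeComp
      rw [pd_mul i (hd (hexp _)) (hd (hη' j)), pd_exp_mul _ (hd hχ)]
      ring
    -- contract `ξ♭ ∧ dξ♭ = 0` with `ξ`
    have h1 : ∑ i, ξ i y * (η i y * (pd j (η k) y - pd k (η j) y) +
      η j y * (pd k (η i) y - pd i (η k) y) + η k y * (pd i (η j) y - pd j (η i) y)) = 0 := by
      simp [horth y hy]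
    have h2 := hnorm y hy
    have h3 := lie_lowered hs hG hξ hη hkill hy j
    have h4 := lie_lowered hs hG hξ hη hkill hy k
    have h5 := pd_norm hs hG hξ hχ hη hnorm hy j
    have h6 := pd_norm hs hG hξ hχ hη hnorm hy k
    have h7 : Real.exp (2 * χ y) * ((pd j (η k) y - 2 * pd j χ y * η k y) -
        (pd k (η j) y - 2 * pd k χ y * η j y)) = 0 := by
      simp only [Fin.sum_univ_four] at *
      linear_combination -h1 + (pd j (η k) y - pd k (η j) y) * h2 + η j y * (h6 - h4) -
        η k y * (h5 - h3)
    have h8 := (mul_eq_zero.1 h7).resolve_left (Real.exp_ne_zero _)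
    rw [hpd, hpd]
    linear_combination Real.exp (-2 * χ y) * h8
  refine ⟨hs, fun i j => ((hexp _).mul (hG i j)).add ((hexp _).mul ((hτ i).mul (hτ j))), hτ, hξ,
    fun y hy i j => ?_, hker, hpair, hclosed, fun y hy i j => ?_, fun y hy => ?_⟩
  · simp only [spatialComp, Matrix.of_apply, hsymm y hy i j]; ring
  · have hd : ∀ {f : E4 → ℝ}, ContDiffOn ℝ ∞ f s → DifferentiableAt ℝ f y := fun hf =>
      differentiableAt_of_contDiffOn hs hf hy
    have hinv := potential_invariant hs hG hξ hχ hη hnorm hkill hy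
    have hinv' : ∀ c : ℝ, ∑ k, ξ k y * pd k (fun z => Real.exp (c * χ z)) y = 0 := by
      intro c
      simp only [pd_exp_mul c (hd hχ)]
      simp only [Fin.sum_univ_four] at *
      linear_combination Real.exp (c * χ y) * c * hinv
    refine lieDeriv_combination (hd (hexp 2)) (hd (hexp 4)) (fun i j => hd (hG i j))
      (fun i => hd (hτ i)) (hinv' 2) (hinv' 4) (hkill y hy) (fun i => ?_) i j
    have h0 : pd i (fun z => ∑ k, timeComp η χ k z * ξ k z) y = 0 := by
      rw [pd_congr_on hs (f' := fun _ => -1) hpair hy, pd_const]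
    rw [pd_sum _ _ fun k _ => (hd (hτ k)).fun_mul (hd (hξ k))] at h0
    rw [← h0]
    refine Finset.sum_congr rfl fun k _ => ?_
    rw [pd_mul i (hd (hτ k)) (hd (hξ k)), hclosed y hy k i]
    ring
  · -- a vector in the kernel of `γ - τ ⊗ τ` is in the kernel of `G`
    intro h0
    obtain ⟨v, hv, hv0⟩ := Matrix.exists_mulVec_eq_zero_iff.2 h0
    refine hdet y hy (Matrix.exists_mulVec_eq_zero_iff.1 ⟨v, hv, ?_⟩)
    have hb : ∀ i, ∑ j, (spatialComp G η χ y i j - timeComp η χ i y * timeComp η χ j y) * v j = 0 :=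
      fun i => congrFun hv0 i
    have hτv : ∑ j, timeComp η χ j y * v j = 0 := by
      have h1 : ∑ i, ξ i y * ∑ j, (spatialComp G η χ y i j -
          timeComp η χ i y * timeComp η χ j y) * v j = 0 := by simp [hb]
      have h2 : ∀ j, ∑ i, spatialComp G η χ y i j * ξ i y = 0 := by
        intro j
        rw [← hker y hy j]
        refine Finset.sum_congr rfl fun i _ => ?_
        simp only [spatialComp, Matrix.of_apply, hsymm y hy i j]; ring
      have h3 := hpair y hy
      have h20 := h2 0
      have h21 := h2 1
      have h22 := h2 2
      have h23 := h2 3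
      simp only [Fin.sum_univ_four] at *
      linear_combination h1 - v 0 * h20 - v 1 * h21 - v 2 * h22 - v 3 * h23 +
        (timeComp η χ 0 y * v 0 + timeComp η χ 1 y * v 1 + timeComp η χ 2 y * v 2 +
          timeComp η χ 3 y * v 3) * h3
    funext i
    have h1 := hb i
    have h2 : Real.exp (2 * χ y) * ∑ j, G y i j * v j = 0 := by
      simp only [show ∀ j, spatialComp G η χ y i j = Real.exp (2 * χ y) * G y i j +
        Real.exp (4 * χ y) * (timeComp η χ i y * timeComp η χ j y) from fun _ => rfl] at h1
      simp only [Fin.sum_univ_four] at *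
      linear_combination h1 + (1 - Real.exp (4 * χ y)) * timeComp η χ i y * hτv
    exact (mul_eq_zero.1 h2).resolve_left (Real.exp_ne_zero _)

end Frame

/-! ### The three families as generating curves -/

/-- The potential `u` along the curve with profile `w` and linear coefficient `a`. -/
def profileU (α a : ℝ) (w : ℝ → ℝ) (t : ℝ) : ℝ := a * t - 1 / (1 + α ^ 2) * Real.log (w t)

/-- The dilaton along the curve with profile `w` and linear coefficient `b`. -/
def profileV (α b : ℝ) (w : ℝ → ℝ) (t : ℝ) : ℝ := b * t - α / (1 + α ^ 2) * Real.log (w t)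

lemma exp_profileU {α a t : ℝ} {w : ℝ → ℝ} (hw : 0 < w t) :
    Real.exp (2 * profileU α a w t) = Real.exp (2 * a * t) / w t ^ (2 / (1 + α ^ 2)) := by
  rw [Real.rpow_def_of_pos hw, ← Real.exp_sub]
  congr 1
  simp only [profileU]; ring

lemma exp_profileV {α b t : ℝ} {w : ℝ → ℝ} (hw : 0 < w t) :
    Real.exp (2 * profileV α b w t) = Real.exp (2 * b * t) / w t ^ (2 * α / (1 + α ^ 2)) := by
  rw [Real.rpow_def_of_pos hw, ← Real.exp_sub]
  congr 1
  simp only [profileV]; ring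

/-- The powers of `w` combine to `-2`, as `2 / (1 + α²) + α · 2α / (1 + α²) = 2`. -/
lemma exp_profile {α a b t : ℝ} {w : ℝ → ℝ} (hw : 0 < w t) :
    Real.exp (2 * (profileU α a w t + α * profileV α b w t)) =
      Real.exp (2 * ((a + α * b) * t)) / w t ^ 2 := by
  have hK : (1 + α ^ 2) ≠ 0 := by positivity
  have h1 : 2 * (profileU α a w t + α * profileV α b w t) =
      2 * ((a + α * b) * t) - 2 * Real.log (w t) := by
    simp only [profileU, profileV]; field_simp; ring
  rw [h1, Real.exp_sub]
  congr 1
  rw [two_mul, Real.exp_add, Real.exp_log hw, sq]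

/-- A profile `w` with `w'² - w w'' = (1 + α²) c² e^{2mt}`, where `m = a + α b`, and a
compatible first integral define a generating curve on the set where `w` is positive: there
`e^{2(U+αV)} = e^{2mt} / w²` and `U'' = (w'² - w w'') / ((1 + α²) w²)`. -/
theorem generatingCurve_of_profile {α a b c : ℝ} {w w₁ w₂ W : ℝ → ℝ} (hw : ContDiff ℝ ∞ w)
    (hw0 : w 0 = 1) (hw₁ : ∀ t, HasDerivAt w (w₁ t) t) (hw₂ : ∀ t, HasDerivAt w₁ (w₂ t) t)
    (hW : ContDiffOn ℝ ∞ W {t | 0 < w t}) (hW0 : W 0 = 0)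
    (hW₁ : ∀ t, 0 < w t → HasDerivAt W (c * (Real.exp (2 * ((a + α * b) * t)) / w t ^ 2)) t)
    (hsecond : ∀ t, w₁ t ^ 2 - w t * w₂ t =
      (1 + α ^ 2) * c ^ 2 * Real.exp (2 * ((a + α * b) * t)))
    (hfirst : ∀ t, (a ^ 2 + b ^ 2 - 1) * (1 + α ^ 2) * w t ^ 2 -
      2 * (a + α * b) * (w t * w₁ t) + w₁ t ^ 2 =
      (1 + α ^ 2) * c ^ 2 * Real.exp (2 * ((a + α * b) * t))) :
    GeneratingCurve α c {t | 0 < w t} (profileU α a w) (profileV α b w) W := by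
  have hK : (1 + α ^ 2) ≠ 0 := by positivity
  have hI : IsOpen {t | 0 < w t} := isOpen_lt continuous_const hw.continuous
  have hlog : ContDiffOn ℝ ∞ (fun t => Real.log (w t)) {t | 0 < w t} :=
    hw.contDiffOn.log fun t ht => (ne_of_gt ht)
  have hU : ∀ q l t, 0 < w t → HasDerivAt (fun t => l * t - q * Real.log (w t))
      (l - q * (w₁ t / w t)) t := fun q l t ht => by
    simpa using ((hasDerivAt_id t).const_mul l).fun_sub (((hw₁ t).log (ne_of_gt ht)).const_mul q)
  have hUU : ∀ q l t, 0 < w t → deriv (deriv fun t => l * t - q * Real.log (w t)) t =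
      q * ((w₁ t ^ 2 - w t * w₂ t) / w t ^ 2) := by
    intro q l t ht
    have h1 : deriv (fun t => l * t - q * Real.log (w t)) =ᶠ[nhds t]
        fun t => l - q * (w₁ t / w t) :=
      Filter.eventually_of_mem (hI.mem_nhds ht) fun r hr => (hU q l r hr).deriv
    rw [h1.deriv_eq, ((((hw₂ t).fun_div (hw₁ t) (ne_of_gt ht)).const_mul q).const_sub l).deriv]
    ring
  refine ⟨hI, by simp [hw0], ?_, ?_, hW, by simp [profileU, hw0], by simp [profileV, hw0], hW0,
    ?_, ?_, ?_, ?_⟩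
  · exact (contDiffOn_const.mul contDiffOn_id).sub (contDiffOn_const.mul hlog)
  · exact (contDiffOn_const.mul contDiffOn_id).sub (contDiffOn_const.mul hlog)
  · intro t ht
    have ht' : w t ≠ 0 := ne_of_gt ht
    rw [exp_profile ht]
    refine (hUU _ _ t ht).trans ?_
    rw [hsecond]; field_simp
  · intro t ht
    have ht' : w t ≠ 0 := ne_of_gt ht
    rw [exp_profile ht]
    refine (hUU _ _ t ht).trans ?_
    rw [hsecond]; field_simp
  · intro t ht
    rw [exp_profile ht]
    exact (hW₁ t ht).deriv
  · intro t ht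
    have ht' : w t ≠ 0 := ne_of_gt ht
    rw [exp_profile ht]
    have e1 : deriv (profileU α a w) t = _ := (hU _ _ t ht).deriv
    have e2 : deriv (profileV α b w) t = _ := (hU _ _ t ht).deriv
    rw [e1, e2]
    have h := hfirst t
    generalize Real.exp (2 * ((a + α * b) * t)) = E at *
    field_simp
    linear_combination h * (1 + α ^ 2)

lemma sq_sqrt_one_add_sq (α : ℝ) : √(1 + α ^ 2) ^ 2 = 1 + α ^ 2 :=
  Real.sq_sqrt (by positivity)

lemma sqrt_one_add_sq_pos (α : ℝ) : 0 < √(1 + α ^ 2) := Real.sqrt_pos.2 (by positivity)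

/-- The profile of the first family, normalized to `1` at `t = 0`. -/
def firstProfile (α Γ θ t : ℝ) : ℝ :=
  (1 - Γ ^ 2 * Real.exp (2 * (√(1 + α ^ 2) * Real.cos θ * t))) / (1 - Γ ^ 2)

/-- The profile of the third family, normalized to `1` at `t = 0`. -/
def thirdProfile (α ψ ϑ t : ℝ) : ℝ :=
  Real.cos (t * √(1 + α ^ 2) * Real.sinh ψ + ϑ) / Real.cos ϑ

/-- With `θ_α = arcsin (α / √(1 + α²))` the vector `(1, α)` is `√(1 + α²) (cos θ_α, sin θ_α)`, so
these are the addition formulas for `θ = (θ - θ_α) + θ_α`. -/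
lemma angle_identities (α θ : ℝ) :
    Real.cos (θ - Real.arcsin (α / √(1 + α ^ 2))) -
        α * Real.sin (θ - Real.arcsin (α / √(1 + α ^ 2))) = √(1 + α ^ 2) * Real.cos θ ∧
      α * Real.cos (θ - Real.arcsin (α / √(1 + α ^ 2))) +
        Real.sin (θ - Real.arcsin (α / √(1 + α ^ 2))) = √(1 + α ^ 2) * Real.sin θ := by
  have hk := sqrt_one_add_sq_pos α
  have hk2 := sq_sqrt_one_add_sq α
  set k := √(1 + α ^ 2) with hkdef
  have habs : |α / k| ≤ 1 := by
    rw [← sq_le_one_iff_abs_le_one, div_pow, div_le_one (by positivity), hk2]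
    linarith
  have hs : Real.sin (Real.arcsin (α / k)) = α / k :=
    Real.sin_arcsin (abs_le.1 habs).1 (abs_le.1 habs).2
  have hc : Real.cos (Real.arcsin (α / k)) = 1 / k := by
    rw [Real.cos_arcsin]
    have : 1 - (α / k) ^ 2 = (1 / k) ^ 2 := by field_simp; linarith
    rw [this, Real.sqrt_sq (by positivity)]
  rw [Real.cos_sub, Real.sin_sub, hs, hc]
  constructor
  · field_simp
    linear_combination -Real.cos θ * hk2
  · field_simp
    linear_combination -Real.sin θ * hk2

section Families

variable {M : Type*} {α : ℝ} {χ u φ Φ : M → ℝ}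

lemma eq_of_exp_two_mul {x y : ℝ} (h : Real.exp (2 * x) = Real.exp (2 * y)) : x = y := by
  have := Real.exp_injective h
  linarith

lemma firstClass_eq {Γ θ : ℝ} (h : FirstClass α Γ θ χ u φ Φ) (p : M) :
    0 < firstProfile α Γ θ (χ p) ∧
    u p = profileU α (Real.cos (θ - Real.arcsin (α / √(1 + α ^ 2)))) (firstProfile α Γ θ) (χ p) ∧
    φ p = profileV α (-Real.sin (θ - Real.arcsin (α / √(1 + α ^ 2)))) (firstProfile α Γ θ) (χ p) ∧
    Φ p = Γ / √(1 + α ^ 2) * ((1 - Real.exp (2 * (√(1 + α ^ 2) * Real.cos θ * χ p))) /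
      (1 - Γ ^ 2 * Real.exp (2 * (√(1 + α ^ 2) * Real.cos θ * χ p)))) := by
  obtain ⟨hΓ, h⟩ := h
  obtain ⟨hD, hu, hφ, hΦ⟩ := h p
  have he : 2 * χ p * √(1 + α ^ 2) * Real.cos θ = 2 * (√(1 + α ^ 2) * Real.cos θ * χ p) := by ring
  rw [he] at hD hu hφ hΦ
  have hδ : 0 < 1 - Γ ^ 2 := by linarith
  have hw : 0 < firstProfile α Γ θ (χ p) := div_pos hD hδ
  refine ⟨hw, eq_of_exp_two_mul ?_, eq_of_exp_two_mul ?_, hΦ⟩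
  · rw [hu, exp_profileU hw, firstProfile, Real.div_rpow hD.le hδ.le]
    have := Real.rpow_pos_of_pos hD (2 / (1 + α ^ 2))
    have := Real.rpow_pos_of_pos hδ (2 / (1 + α ^ 2))
    rw [mul_right_comm 2]
    field_simp
  · rw [hφ, exp_profileV hw, firstProfile, Real.div_rpow hD.le hδ.le]
    have := Real.rpow_pos_of_pos hD (2 * α / (1 + α ^ 2))
    have := Real.rpow_pos_of_pos hδ (2 * α / (1 + α ^ 2))
    rw [show 2 * -Real.sin (θ - Real.arcsin (α / √(1 + α ^ 2))) * χ p =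
      -2 * χ p * Real.sin (θ - Real.arcsin (α / √(1 + α ^ 2))) by ring]
    field_simp

lemma secondClass_eq {b : ℝ} (h : SecondClass α b χ u φ Φ) (p : M) :
    0 < 1 - b * χ p ∧
    u p = profileU α (α / √(1 + α ^ 2)) (fun t => 1 - b * t) (χ p) ∧
    φ p = profileV α (-(1 / √(1 + α ^ 2))) (fun t => 1 - b * t) (χ p) ∧
    Φ p = -(1 / √(1 + α ^ 2)) * (b * χ p / (1 - b * χ p)) := by
  obtain ⟨hw, hu, hφ, hΦ⟩ := h p
  refine ⟨hw, eq_of_exp_two_mul ?_, eq_of_exp_two_mul ?_, hΦ⟩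
  · rw [hu, exp_profileU (w := fun t => 1 - b * t) hw]; ring_nf
  · rw [hφ, exp_profileV (w := fun t => 1 - b * t) hw]; ring_nf

lemma thirdClass_eq {ψ ϑ : ℝ} (h : ThirdClass α ψ ϑ χ u φ Φ) (p : M) :
    0 < thirdProfile α ψ ϑ (χ p) ∧
    u p = profileU α (α / √(1 + α ^ 2) * Real.cosh ψ) (thirdProfile α ψ ϑ) (χ p) ∧
    φ p = profileV α (-(1 / √(1 + α ^ 2) * Real.cosh ψ)) (thirdProfile α ψ ϑ) (χ p) ∧
    Φ p = -(1 / √(1 + α ^ 2)) * (Real.sin (χ p * √(1 + α ^ 2) * Real.sinh ψ) /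
      Real.cos (χ p * √(1 + α ^ 2) * Real.sinh ψ + ϑ)) := by
  obtain ⟨hϑ, h⟩ := h
  obtain ⟨hC, hu, hφ, hΦ⟩ := h p
  have hw : 0 < thirdProfile α ψ ϑ (χ p) := div_pos hC hϑ
  refine ⟨hw, eq_of_exp_two_mul ?_, eq_of_exp_two_mul ?_, hΦ⟩
  · rw [hu, exp_profileU hw, thirdProfile, Real.div_rpow hC.le hϑ.le]
    have := Real.rpow_pos_of_pos hC (2 / (1 + α ^ 2))
    have := Real.rpow_pos_of_pos hϑ (2 / (1 + α ^ 2))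
    rw [show 2 * (α / √(1 + α ^ 2) * Real.cosh ψ) * χ p =
      2 * α * χ p / √(1 + α ^ 2) * Real.cosh ψ by ring]
    field_simp
  · rw [hφ, exp_profileV hw, thirdProfile, Real.div_rpow hC.le hϑ.le]
    have := Real.rpow_pos_of_pos hC (2 * α / (1 + α ^ 2))
    have := Real.rpow_pos_of_pos hϑ (2 * α / (1 + α ^ 2))
    rw [show 2 * -(1 / √(1 + α ^ 2) * Real.cosh ψ) * χ p =
      -(2 * χ p / √(1 + α ^ 2)) * Real.cosh ψ by ring]
    field_simp

lemma firstClass_curve {Γ : ℝ} (hΓ : Γ ^ 2 < 1) (α θ : ℝ) :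
    GeneratingCurve α (-2 * (√(1 + α ^ 2) * Real.cos θ) * Γ / (√(1 + α ^ 2) * (1 - Γ ^ 2)))
      {t | 0 < firstProfile α Γ θ t}
      (profileU α (Real.cos (θ - Real.arcsin (α / √(1 + α ^ 2)))) (firstProfile α Γ θ))
      (profileV α (-Real.sin (θ - Real.arcsin (α / √(1 + α ^ 2)))) (firstProfile α Γ θ))
      (fun t => Γ / √(1 + α ^ 2) * ((1 - Real.exp (2 * (√(1 + α ^ 2) * Real.cos θ * t))) /
        (1 - Γ ^ 2 * Real.exp (2 * (√(1 + α ^ 2) * Real.cos θ * t))))) := by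
  have hδ : 0 < 1 - Γ ^ 2 := by linarith
  have hk := sqrt_one_add_sq_pos α
  have hk2 := sq_sqrt_one_add_sq α
  have hm := (angle_identities α θ).1
  have hcs := Real.cos_sq_add_sin_sq (θ - Real.arcsin (α / √(1 + α ^ 2)))
  set k := √(1 + α ^ 2) with hkdef
  set m := k * Real.cos θ with hmdef
  set a := Real.cos (θ - Real.arcsin (α / k)) with ha
  set b := Real.sin (θ - Real.arcsin (α / k)) with hb
  have hm' : a + α * -b = m := by rw [← hm]; ring
  have hE : ∀ t, HasDerivAt (fun t => Real.exp (2 * (m * t))) (2 * m * Real.exp (2 * (m * t))) t :=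
    fun t => by
      have := (((hasDerivAt_id t).const_mul m).const_mul 2).exp
      simp only [id, mul_one] at this
      convert this using 1; ring
  have hEs : ContDiff ℝ ∞ (fun t => Real.exp (2 * (m * t))) :=
    (contDiff_const.mul (contDiff_const.mul contDiff_id)).exp
  have hpos : ∀ t, 0 < firstProfile α Γ θ t → 0 < 1 - Γ ^ 2 * Real.exp (2 * (m * t)) :=
    fun t ht => by
      have : 0 < (1 - Γ ^ 2 * Real.exp (2 * (m * t))) / (1 - Γ ^ 2) := ht
      rwa [div_pos_iff_of_pos_right hδ] at this
  refine generatingCurve_of_profile (w₁ := fun t => -(Γ ^ 2 * (2 * m * Real.exp (2 * (m * t)))) /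
      (1 - Γ ^ 2)) (w₂ := fun t => -(Γ ^ 2 * (2 * m * (2 * m * Real.exp (2 * (m * t))))) /
      (1 - Γ ^ 2)) ?_ ?_ ?_ ?_ ?_ ?_ ?_ ?_ ?_
  · exact (contDiff_const.sub (contDiff_const.mul hEs)).div_const _
  · simp [firstProfile, hδ.ne']
  · exact fun t => (((hE t).const_mul (Γ ^ 2)).const_sub 1).div_const _
  · exact fun t => ((((hE t).const_mul (2 * m)).const_mul (Γ ^ 2)).fun_neg).div_const _
  · exact contDiffOn_const.mul ((contDiff_const.sub hEs).contDiffOn.div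
      (contDiff_const.sub (contDiff_const.mul hEs)).contDiffOn fun t ht => (hpos t ht).ne')
  · simp
  · intro t ht
    have hD := hpos t ht
    have h1 := ((((hE t).const_sub 1).fun_div (((hE t).const_mul (Γ ^ 2)).const_sub 1)
      hD.ne').const_mul (Γ / k))
    refine h1.congr_deriv ?_
    rw [hm', firstProfile, ← hkdef, ← hmdef]
    generalize Real.exp (2 * (m * t)) = E at *
    have := hD.ne'
    field_simp
    ring
  · intro t
    rw [hm', firstProfile, ← hkdef, ← hmdef, ← hk2]
    generalize Real.exp (2 * (m * t)) = E at *
    field_simp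
    ring
  · intro t
    rw [hm', firstProfile, ← hkdef, ← hmdef, ← hk2]
    have hab : a ^ 2 + (-b) ^ 2 - 1 = 0 := by rw [neg_sq]; linarith
    rw [hab]
    generalize Real.exp (2 * (m * t)) = E at *
    field_simp
    ring

lemma secondClass_curve (α b : ℝ) :
    GeneratingCurve α (-(b / √(1 + α ^ 2))) {t | 0 < 1 - b * t}
      (profileU α (α / √(1 + α ^ 2)) (fun t => 1 - b * t))
      (profileV α (-(1 / √(1 + α ^ 2))) (fun t => 1 - b * t))
      (fun t => -(1 / √(1 + α ^ 2)) * (b * t / (1 - b * t))) := by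
  have hk := sqrt_one_add_sq_pos α
  have hk2 := sq_sqrt_one_add_sq α
  set k := √(1 + α ^ 2) with hkdef
  have hm : α / k + α * -(1 / k) = 0 := by ring
  have hl : ∀ t, HasDerivAt (fun t => b * t) b t := fun t => by
    simpa using (hasDerivAt_id t).const_mul b
  have hw : ContDiff ℝ ∞ fun t : ℝ => 1 - b * t :=
    contDiff_const.sub (contDiff_const.mul contDiff_id)
  refine generatingCurve_of_profile (w₁ := fun _ => -b) (w₂ := fun _ => 0) hw (by simp)
    (fun t => (hl t).const_sub 1) (fun t => hasDerivAt_const t _) ?_ (by simp) ?_ ?_ ?_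
  · exact contDiffOn_const.mul ((contDiff_const.mul contDiff_id).contDiffOn.div hw.contDiffOn
      fun t ht => ne_of_gt ht)
  · intro t ht
    have h1 := ((hl t).fun_div ((hl t).const_sub 1) ht.ne').const_mul (-(1 / k))
    refine h1.congr_deriv ?_
    rw [hm]
    have := ht.ne'
    simp only [zero_mul, mul_zero, Real.exp_zero]
    field_simp
    ring
  · intro t
    rw [hm, ← hk2]
    simp only [zero_mul, mul_zero, Real.exp_zero]
    field_simp
    ring
  · intro t
    have hab : (α / k) ^ 2 + (-(1 / k)) ^ 2 - 1 = 0 := by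
      field_simp; linarith
    rw [hm, hab, ← hk2]
    simp only [zero_mul, mul_zero, Real.exp_zero]
    field_simp
    ring

lemma thirdClass_curve {ϑ : ℝ} (hϑ : 0 < Real.cos ϑ) (α ψ : ℝ) :
    GeneratingCurve α (-(Real.sinh ψ / Real.cos ϑ)) {t | 0 < thirdProfile α ψ ϑ t}
      (profileU α (α / √(1 + α ^ 2) * Real.cosh ψ) (thirdProfile α ψ ϑ))
      (profileV α (-(1 / √(1 + α ^ 2) * Real.cosh ψ)) (thirdProfile α ψ ϑ))
      (fun t => -(1 / √(1 + α ^ 2)) * (Real.sin (t * √(1 + α ^ 2) * Real.sinh ψ) /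
        Real.cos (t * √(1 + α ^ 2) * Real.sinh ψ + ϑ))) := by
  have hk := sqrt_one_add_sq_pos α
  have hk2 := sq_sqrt_one_add_sq α
  have hch := Real.cosh_sq ψ
  unfold thirdProfile
  set k := √(1 + α ^ 2) with hkdef
  have hm : α / k * Real.cosh ψ + α * -(1 / k * Real.cosh ψ) = 0 := by ring
  have hl : ∀ t, HasDerivAt (fun t => t * k * Real.sinh ψ) (k * Real.sinh ψ) t := fun t => by
    simpa using ((hasDerivAt_id t).mul_const k).mul_const (Real.sinh ψ)
  have hl' : ∀ t, HasDerivAt (fun t => t * k * Real.sinh ψ + ϑ) (k * Real.sinh ψ) t := fun t =>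
    (hl t).add_const ϑ
  have hls : ContDiff ℝ ∞ fun t : ℝ => t * k * Real.sinh ψ :=
    (contDiff_id.mul contDiff_const).mul contDiff_const
  have hcs : ContDiff ℝ ∞ fun t : ℝ => Real.cos (t * k * Real.sinh ψ + ϑ) :=
    (hls.add contDiff_const).cos
  have hpos : ∀ t, 0 < Real.cos (t * k * Real.sinh ψ + ϑ) / Real.cos ϑ →
      0 < Real.cos (t * k * Real.sinh ψ + ϑ) := fun t ht => by
    rwa [div_pos_iff_of_pos_right hϑ] at ht
  refine generatingCurve_of_profile
    (w₁ := fun t => -Real.sin (t * k * Real.sinh ψ + ϑ) * (k * Real.sinh ψ) / Real.cos ϑ)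
    (w₂ := fun t => -(Real.cos (t * k * Real.sinh ψ + ϑ) * (k * Real.sinh ψ)) *
      (k * Real.sinh ψ) / Real.cos ϑ) (hcs.div_const _) (by simp [hϑ.ne'])
    (fun t => (hl' t).cos.div_const _) (fun t => (((hl' t).sin.fun_neg).mul_const _).div_const _)
    ?_ (by simp) ?_ ?_ ?_
  · exact contDiffOn_const.mul (hls.sin.contDiffOn.div hcs.contDiffOn
      fun t ht => (hpos t ht).ne')
  · intro t ht
    have hC := (hpos t ht).ne'
    have h1 := ((hl t).sin.fun_div (hl' t).cos hC).const_mul (-(1 / k))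
    refine h1.congr_deriv ?_
    rw [hm]
    simp only [zero_mul, mul_zero, Real.exp_zero]
    have hc : Real.cos ϑ = Real.cos (t * k * Real.sinh ψ + ϑ) * Real.cos (t * k * Real.sinh ψ) +
        Real.sin (t * k * Real.sinh ψ + ϑ) * Real.sin (t * k * Real.sinh ψ) := by
      rw [← Real.cos_sub]; ring_nf
    generalize t * k * Real.sinh ψ = x at *
    field_simp
    rw [hc]; ring
  · intro t
    rw [hm, ← hk2]
    simp only [zero_mul, mul_zero, Real.exp_zero]
    have h := Real.sin_sq_add_cos_sq (t * k * Real.sinh ψ + ϑ)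
    generalize t * k * Real.sinh ψ + ϑ = x at *
    field_simp
    linear_combination Real.sinh ψ ^ 2 * h
  · intro t
    have hab : (α / k * Real.cosh ψ) ^ 2 + (-(1 / k * Real.cosh ψ)) ^ 2 - 1 =
        Real.sinh ψ ^ 2 := by
      field_simp; rw [hch]; linear_combination (Real.sinh ψ ^ 2 + 1) * (-hk2)
    rw [hm, hab, ← hk2]
    simp only [zero_mul, mul_zero, Real.exp_zero]
    have h := Real.sin_sq_add_cos_sq (t * k * Real.sinh ψ + ϑ)
    generalize t * k * Real.sinh ψ + ϑ = x at *
    field_simp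
    linear_combination Real.sinh ψ ^ 2 * k ^ 2 * h

/-- The potentials of each of the three families are the values of a generating curve at the vacuum
potential. -/
theorem exists_generatingCurve
    (hclass : (∃ Γ θ, FirstClass α Γ θ χ u φ Φ) ∨ (∃ b, SecondClass α b χ u φ Φ) ∨
      (∃ ψ ϑ, ThirdClass α ψ ϑ χ u φ Φ)) :
    ∃ c I U V W, GeneratingCurve α c I U V W ∧
      ∀ p, χ p ∈ I ∧ u p = U (χ p) ∧ φ p = V (χ p) ∧ Φ p = W (χ p) := by
  rcases hclass with ⟨Γ, θ, h⟩ | ⟨b, h⟩ | ⟨ψ, ϑ, h⟩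
  · exact ⟨_, _, _, _, _, firstClass_curve h.1 α θ, firstClass_eq h⟩
  · exact ⟨_, _, _, _, _, secondClass_curve α b, secondClass_eq h⟩
  · exact ⟨_, _, _, _, _, thirdClass_curve h.1 α ψ, thirdClass_eq h⟩

end Families

/-! ### The matrix of the potentials -/

section MatrixExponential

/-- The exponential of `t (n + μ N)` for `N² = ε`, in terms of solutions of `A' = μ ε B`,
`B' = μ A`: hyperbolic, affine or trigonometric functions, according to the sign of `ε`. -/
lemma exp_smul_of_sq {𝔸 : Type*} [NormedRing 𝔸] [NormedAlgebra ℝ 𝔸] [CompleteSpace 𝔸]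
    {N : 𝔸} {n μ ε : ℝ} (hN : N * N = ε • (1 : 𝔸)) {A B : ℝ → ℝ}
    (hA : ∀ t, HasDerivAt A (μ * ε * B t) t) (hB : ∀ t, HasDerivAt B (μ * A t) t)
    (hA0 : A 0 = 1) (hB0 : B 0 = 0) (t : ℝ) :
    NormedSpace.exp (t • (n • (1 : 𝔸) + μ • N)) =
      Real.exp (n * t) • (A t • (1 : 𝔸) + B t • N) := by
  set Q : 𝔸 := n • (1 : 𝔸) + μ • N with hQ
  let X : ℝ → 𝔸 := fun t => Real.exp (n * t) • (A t • (1 : 𝔸) + B t • N)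
  have hX : ∀ t, HasDerivAt X (X t * Q) t := by
    intro t
    have he : HasDerivAt (fun t => Real.exp (n * t)) (n * Real.exp (n * t)) t := by
      have := ((hasDerivAt_id t).const_mul n).exp
      simp only [id, mul_one] at this
      exact this.congr_deriv (by ring)
    have h1 := he.fun_smul (((hA t).smul_const (1 : 𝔸)).fun_add ((hB t).smul_const N))
    refine h1.congr_deriv ?_
    simp only [X, hQ, mul_add, add_mul, smul_mul_assoc, mul_smul_comm, mul_one, one_mul, hN,
      smul_add, smul_smul]
    module
  -- `X e^{-tQ}` is constant
  have hY : ∀ t, HasDerivAt (fun t => X t * NormedSpace.exp (t • (-Q))) 0 t := by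
    intro t
    have h1 := (hX t).fun_mul (hasDerivAt_exp_smul_const' (𝕂 := ℝ) (-Q) t)
    refine h1.congr_deriv ?_
    simp [mul_assoc]
  have hc : X t * NormedSpace.exp (t • (-Q)) = X 0 * NormedSpace.exp ((0 : ℝ) • (-Q)) :=
    is_const_of_deriv_eq_zero (fun t => (hY t).differentiableAt) (fun t => (hY t).deriv) t 0
  have h0 : X 0 = 1 := by simp [X, hA0, hB0]
  rw [h0, zero_smul, NormedSpace.exp_zero, mul_one] at hc
  let _ : NormedAlgebra ℚ 𝔸 := NormedAlgebra.restrictScalars ℚ ℝ 𝔸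
  have hi : NormedSpace.exp (t • (-Q)) * NormedSpace.exp (t • Q) = 1 := by
    rw [← NormedSpace.exp_add_of_commute
      (((Commute.refl Q).neg_left.smul_left t).smul_right t)]
    simp
  calc NormedSpace.exp (t • Q)
      = (X t * NormedSpace.exp (t • (-Q))) * NormedSpace.exp (t • Q) := by rw [hc, one_mul]
    _ = X t := by rw [mul_assoc, hi, mul_one]

-- the exponential of matrices depends only on their topology, so that any norm will do
attribute [local instance] Matrix.linftyOpNormedRing Matrix.linftyOpNormedAlgebra in
lemma matrix_exp_smul_of_sq {N : Matrix (Fin 2) (Fin 2) ℝ} {n μ ε : ℝ}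
    (hN : N * N = ε • (1 : Matrix (Fin 2) (Fin 2) ℝ)) {A B : ℝ → ℝ}
    (hA : ∀ t, HasDerivAt A (μ * ε * B t) t) (hB : ∀ t, HasDerivAt B (μ * A t) t)
    (hA0 : A 0 = 1) (hB0 : B 0 = 0) (t : ℝ) :
    NormedSpace.exp (t • (n • (1 : Matrix (Fin 2) (Fin 2) ℝ) + μ • N)) =
      Real.exp (n * t) • (A t • (1 : Matrix (Fin 2) (Fin 2) ℝ) + B t • N) :=
  exp_smul_of_sq hN hA hB hA0 hB0 t

end MatrixExponential

/-- The first exponential in the matrix of the potentials, along a curve with profile `w`. -/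
lemma exp_profile_add {α a b t : ℝ} {w : ℝ → ℝ} (hw : 0 < w t) :
    Real.exp ((1 + α) * profileU α a w t + (α - 1) * profileV α b w t) =
      Real.exp ((α * a - b) * t) * (Real.exp ((a + α * b) * t) / w t) := by
  have hK : (1 + α ^ 2) ≠ 0 := by positivity
  have h1 : (1 + α) * profileU α a w t + (α - 1) * profileV α b w t =
      (α * a - b) * t + ((a + α * b) * t - Real.log (w t)) := by
    simp only [profileU, profileV]; field_simp; ring
  rw [h1, Real.exp_add, Real.exp_sub, Real.exp_log hw]

/-- The second exponential in the matrix of the potentials, along a curve with profile `w`. -/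
lemma exp_profile_sub {α a b t : ℝ} {w : ℝ → ℝ} (hw : 0 < w t) :
    Real.exp ((α - 1) * profileU α a w t - (1 + α) * profileV α b w t) =
      Real.exp ((α * a - b) * t) * (Real.exp (-((a + α * b) * t)) * w t) := by
  have hK : (1 + α ^ 2) ≠ 0 := by positivity
  have h1 : (α - 1) * profileU α a w t - (1 + α) * profileV α b w t =
      (α * a - b) * t + (-((a + α * b) * t) + Real.log (w t)) := by
    simp only [profileU, profileV]; field_simp; ring
  rw [h1, Real.exp_add, Real.exp_add, Real.exp_log hw]

/-- Identification of the matrix of the potentials with `σ₃ e^{tQ}`, `Q = n + μ N`, where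
`N = !![x, z; -z, -x]`. -/
lemma potentialMatrix_eq {α a b t P : ℝ} {w : ℝ → ℝ} (hw : 0 < w t) {n μ ε x z : ℝ}
    (hn : n = α * a - b) (hN : x ^ 2 - z ^ 2 = ε) {A B : ℝ → ℝ}
    (hA : ∀ t, HasDerivAt A (μ * ε * B t) t) (hB : ∀ t, HasDerivAt B (μ * A t) t)
    (hA0 : A 0 = 1) (hB0 : B 0 = 0)
    (h11 : Real.exp ((a + α * b) * t) / w t -
      (1 + α ^ 2) * P ^ 2 * (Real.exp (-((a + α * b) * t)) * w t) = A t + B t * x)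
    (h12 : -√(1 + α ^ 2) * P * (Real.exp (-((a + α * b) * t)) * w t) = B t * z)
    (h22 : Real.exp (-((a + α * b) * t)) * w t = A t - B t * x) :
    potentialMatrix α (profileU α a w t) (profileV α b w t) P =
      !![1, 0; 0, -1] * NormedSpace.exp (t • !![n + μ * x, μ * z; -(μ * z), n - μ * x]) := by
  have hQ : (!![n + μ * x, μ * z; -(μ * z), n - μ * x] : Matrix (Fin 2) (Fin 2) ℝ) =
      n • (1 : Matrix (Fin 2) (Fin 2) ℝ) + μ • !![x, z; -z, -x] := by
    ext i j; fin_cases i <;> fin_cases j <;> simp [sub_eq_add_neg]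
  have hNN : (!![x, z; -z, -x] : Matrix (Fin 2) (Fin 2) ℝ) * !![x, z; -z, -x] =
      ε • (1 : Matrix (Fin 2) (Fin 2) ℝ) := by
    subst hN
    ext i j; fin_cases i <;> fin_cases j <;> simp [Matrix.mul_apply] <;> ring
  rw [hQ, matrix_exp_smul_of_sq hNN hA hB hA0 hB0, potentialMatrix, exp_profile_add hw,
    exp_profile_sub hw, hn]
  generalize Real.exp ((α * a - b) * t) = e
  ext i j
  fin_cases i <;> fin_cases j <;> simp [Matrix.mul_apply]
  · linear_combination e * h11
  · linear_combination e * h12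
  · linear_combination e * h12
  · linear_combination -e * h22

section Families

variable {M : Type*} {α : ℝ} {χ u φ Φ : M → ℝ}

theorem firstClass_isGeneratedBy {Γ θ : ℝ} (h : FirstClass α Γ θ χ u φ Φ) :
    ∃ Q, IsGeneratedBy α Q χ u φ Φ ∧ (Real.cos θ ≠ 0 → Q.det < 1 + α ^ 2) := by
  have hδ : 0 < 1 - Γ ^ 2 := by linarith [h.1]
  have hk := sqrt_one_add_sq_pos α
  have hk2 := sq_sqrt_one_add_sq α
  obtain ⟨hm, hn⟩ := angle_identities α θ
  have hmem := firstClass_eq h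
  set k := √(1 + α ^ 2) with hkdef
  have hcs := Real.cos_sq_add_sin_sq θ
  set m := k * Real.cos θ with hmdef
  set n := k * Real.sin θ with hndef
  have hmn : m ^ 2 + n ^ 2 = 1 + α ^ 2 := by
    rw [hmdef, hndef, ← hk2]; linear_combination k ^ 2 * hcs
  -- the traceless part of `Q`, divided by `m`, is read off from `S' = σ₃ Q` at `χ = 0`
  set x := (1 + Γ ^ 2) / (1 - Γ ^ 2) with hx
  set z := 2 * Γ / (1 - Γ ^ 2) with hz
  have hxz : x ^ 2 - z ^ 2 = 1 := by rw [hx, hz]; field_simp; ring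
  refine ⟨!![n + m * x, m * z; -(m * z), n - m * x], ⟨⟨_, _, _, rfl⟩, ?_, fun p => ?_⟩,
    fun hc => ?_⟩
  · simp [Matrix.trace_fin_two]
    linear_combination 2 * hmn + 2 * m ^ 2 * hxz
  · obtain ⟨hw, hu, hφ, hΦ⟩ := hmem p
    rw [hu, hφ]
    have hD : 0 < 1 - Γ ^ 2 * Real.exp (2 * (m * χ p)) := by
      have : 0 < (1 - Γ ^ 2 * Real.exp (2 * (m * χ p))) / (1 - Γ ^ 2) := hw
      rwa [div_pos_iff_of_pos_right hδ] at this
    have hm' :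
        Real.cos (θ - Real.arcsin (α / k)) + α * -Real.sin (θ - Real.arcsin (α / k)) = m := by
      rw [← hm]; ring
    have hml : ∀ t, HasDerivAt (fun t => m * t) m t := fun t => by
      simpa using (hasDerivAt_id t).const_mul m
    have hE2 : Real.exp (2 * (m * χ p)) = Real.exp (m * χ p) ^ 2 := by
      rw [← Real.exp_nat_mul]; norm_num
    have hE := Real.exp_pos (m * χ p)
    refine potentialMatrix_eq (ε := 1) (A := fun t => Real.cosh (m * t))
      (B := fun t => Real.sinh (m * t)) hw (by rw [← hn]; ring) hxz
      (fun t => ((hml t).cosh).congr_deriv (by ring))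
      (fun t => ((hml t).sinh).congr_deriv (by ring)) (by simp) (by simp) ?_ ?_ ?_
    · rw [hm', hΦ, firstProfile, ← hkdef, ← hmdef, ← hk2, Real.cosh_eq, Real.sinh_eq, Real.exp_neg,
        hx]
      rw [hE2] at hD ⊢
      generalize Real.exp (m * χ p) = E at *
      have : 1 - E ^ 2 * Γ ^ 2 ≠ 0 := by rw [mul_comm]; exact hD.ne'
      field_simp
      ring
    · rw [hm', hΦ, firstProfile, ← hkdef, ← hmdef, Real.sinh_eq, Real.exp_neg, hz]
      rw [hE2] at hD ⊢
      generalize Real.exp (m * χ p) = E at *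
      have := hD.ne'
      field_simp
      ring
    · rw [hm', firstProfile, ← hkdef, ← hmdef, Real.cosh_eq, Real.sinh_eq, Real.exp_neg, hx]
      rw [hE2] at hD ⊢
      generalize Real.exp (m * χ p) = E at *
      field_simp
      ring
  · have hmp : 0 < m ^ 2 := by
      have : m ≠ 0 := mul_ne_zero hk.ne' hc
      positivity
    rw [Matrix.det_fin_two_of]
    have : (n + m * x) * (n - m * x) - m * z * -(m * z) = n ^ 2 - m ^ 2 := by
      linear_combination -m ^ 2 * hxz
    rw [this]
    linarith

theorem secondClass_isGeneratedBy {b : ℝ} (h : SecondClass α b χ u φ Φ) :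
    ∃ Q, IsGeneratedBy α Q χ u φ Φ ∧ Q.det = 1 + α ^ 2 := by
  have hk := sqrt_one_add_sq_pos α
  have hk2 := sq_sqrt_one_add_sq α
  have hmem := secondClass_eq h
  set k := √(1 + α ^ 2) with hkdef
  refine ⟨!![k + 1 * b, 1 * b; -(1 * b), k - 1 * b], ⟨⟨_, _, _, rfl⟩, ?_, fun p => ?_⟩, ?_⟩
  · simp [Matrix.trace_fin_two]
    linear_combination 2 * hk2
  · obtain ⟨hw, hu, hφ, hΦ⟩ := hmem p
    rw [hu, hφ]
    have hm : α / k + α * -(1 / k) = 0 := by ring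
    refine potentialMatrix_eq (w := fun t => 1 - b * t) (ε := 0) (A := fun _ => 1)
      (B := fun t => t) hw (by field_simp; linarith) (by ring)
      (fun t => (hasDerivAt_const t _).congr_deriv (by ring))
      (fun t => (hasDerivAt_id t).congr_deriv (by ring)) rfl rfl ?_ ?_ ?_
    · simp only [hm, hΦ, ← hk2, zero_mul, neg_zero, Real.exp_zero]
      field_simp
      ring
    · simp only [hm, hΦ, ← hkdef, zero_mul, neg_zero, Real.exp_zero]
      field_simp
    · simp only [hm, zero_mul, neg_zero, Real.exp_zero]
      ring
  · rw [Matrix.det_fin_two_of]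
    linear_combination hk2

theorem thirdClass_isGeneratedBy {ψ ϑ : ℝ} (h : ThirdClass α ψ ϑ χ u φ Φ) :
    ∃ Q, IsGeneratedBy α Q χ u φ Φ ∧ (ψ ≠ 0 → 1 + α ^ 2 < Q.det) := by
  have hϑ := h.1
  have hk := sqrt_one_add_sq_pos α
  have hk2 := sq_sqrt_one_add_sq α
  have hmem := thirdClass_eq h
  have hch := Real.cosh_sq ψ
  have hsc := Real.sin_sq_add_cos_sq ϑ
  set k := √(1 + α ^ 2) with hkdef
  set s := k * Real.sinh ψ with hs
  set n := k * Real.cosh ψ with hn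
  set x := Real.sin ϑ / Real.cos ϑ with hx
  set z := 1 / Real.cos ϑ with hz
  have hxz : x ^ 2 - z ^ 2 = -1 := by rw [hx, hz]; field_simp; linarith
  have hns : n ^ 2 - s ^ 2 = 1 + α ^ 2 := by rw [hn, hs, ← hk2]; linear_combination k ^ 2 * hch
  refine ⟨!![n + s * x, s * z; -(s * z), n - s * x], ⟨⟨_, _, _, rfl⟩, ?_, fun p => ?_⟩,
    fun hψ => ?_⟩
  · simp [Matrix.trace_fin_two]
    linear_combination 2 * hns + 2 * s ^ 2 * hxz
  · obtain ⟨hw, hu, hφ, hΦ⟩ := hmem p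
    rw [hu, hφ]
    have hC : 0 < Real.cos (χ p * k * Real.sinh ψ + ϑ) := by
      have : 0 < Real.cos (χ p * k * Real.sinh ψ + ϑ) / Real.cos ϑ := hw
      rwa [div_pos_iff_of_pos_right hϑ] at this
    have hm : α / k * Real.cosh ψ + α * -(1 / k * Real.cosh ψ) = 0 := by ring
    have hl : ∀ t, HasDerivAt (fun t => t * k * Real.sinh ψ) s t := fun t => by
      simpa [hs] using ((hasDerivAt_id t).mul_const k).mul_const (Real.sinh ψ)
    refine potentialMatrix_eq (ε := -1) (A := fun t => Real.cos (t * k * Real.sinh ψ))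
      (B := fun t => Real.sin (t * k * Real.sinh ψ)) hw ?_ hxz
      (fun t => ((hl t).cos).congr_deriv (by ring))
      (fun t => ((hl t).sin).congr_deriv (by ring)) (by simp) (by simp) ?_ ?_ ?_
    · rw [hn]; field_simp; linear_combination hk2
    · rw [hm, hΦ, thirdProfile, ← hkdef, ← hk2, hx]
      have hadd := Real.cos_add (χ p * k * Real.sinh ψ) ϑ
      have hsq := Real.sin_sq_add_cos_sq (χ p * k * Real.sinh ψ)
      simp only [zero_mul, neg_zero, Real.exp_zero]
      generalize χ p * k * Real.sinh ψ = r at *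
      field_simp
      rw [hadd]
      linear_combination Real.sin r ^ 2 * hsc - Real.cos ϑ ^ 2 * hsq
    · rw [hm, hΦ, thirdProfile, ← hkdef, hz]
      simp only [zero_mul, neg_zero, Real.exp_zero]
      generalize χ p * k * Real.sinh ψ = r at *
      field_simp
    · rw [hm, thirdProfile, ← hkdef, hx, Real.cos_add]
      simp only [zero_mul, neg_zero, Real.exp_zero]
      field_simp
  · have hsp : 0 < s ^ 2 := by
      have : s ≠ 0 := mul_ne_zero hk.ne' (by simpa using hψ)
      positivity
    rw [Matrix.det_fin_two_of]
    have : (n + s * x) * (n - s * x) - s * z * -(s * z) = n ^ 2 + s ^ 2 := by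
      linear_combination -s ^ 2 * hxz
    rw [this]
    linarith

end Families

/-! ### Functions with fall-off at infinity -/

section FallOff

/-- The exterior region `r > R`. -/
def exterior (R : ℝ) : Set E4 := {y | R < radius y}

lemma continuous_radius : Continuous radius := by
  unfold radius
  fun_prop

lemma isOpen_exterior (R : ℝ) : IsOpen (exterior R) :=
  isOpen_lt continuous_const continuous_radius

lemma eventually_exterior (R : ℝ) :
    ∀ᶠ y in Filter.comap radius Filter.atTop, y ∈ exterior R :=
  Filter.tendsto_comap.eventually (Filter.eventually_gt_atTop R)

variable {R : ℝ} {f f' : E4 → ℝ} {k n m : ℕ}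

lemma FallsOff.isBigO (h : FallsOff k n f) :
    f =O[Filter.comap radius Filter.atTop] fun y => (radius y ^ n)⁻¹ := by
  cases k with
  | zero => exact h
  | succ k => exact h.1

lemma FallsOff.congr (h : FallsOff k n f) (he : ∀ y ∈ exterior R, f' y = f y) :
    FallsOff k n f' := by
  induction k generalizing n f f' with
  | zero =>
    exact h.isBigO.congr' ((eventually_exterior R).mono fun y hy => (he y hy).symm)
      Filter.EventuallyEq.rfl
  | succ k ih =>
    exact ⟨h.1.congr' ((eventually_exterior R).mono fun y hy => (he y hy).symm)
      Filter.EventuallyEq.rfl,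
      fun i => ih (h.2 i) fun y hy => pd_congr_on (isOpen_exterior R) he hy i⟩

lemma FallsOff.of_succ (h : FallsOff (k + 1) n f) : FallsOff k n f := by
  induction k generalizing n f with
  | zero => exact h.1
  | succ k ih => exact ⟨h.1, fun i => ih (h.2 i)⟩

lemma FallsOff.of_add_one (h : FallsOff k (n + 1) f) : FallsOff k n f := by
  have hO : ∀ n, (fun y => (radius y ^ (n + 1))⁻¹) =O[Filter.comap radius Filter.atTop]
      fun y => (radius y ^ n)⁻¹ := fun n => by
    refine Asymptotics.IsBigO.of_bound 1 ((eventually_exterior 1).mono fun y hy => ?_)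
    have hr : 1 ≤ radius y := le_of_lt hy
    have hr0 : 0 < radius y := by linarith
    rw [one_mul, Real.norm_of_nonneg (by positivity), Real.norm_of_nonneg (by positivity)]
    exact inv_anti₀ (by positivity) (pow_le_pow_right₀ hr (Nat.le_succ n))
  induction k generalizing n f with
  | zero => exact Asymptotics.IsBigO.trans h (hO n)
  | succ k ih => exact ⟨h.1.trans (hO n), fun i => ih (h.2 i)⟩

lemma fallsOff_zero : FallsOff k n fun _ => 0 := by
  induction k generalizing n with
  | zero => exact Asymptotics.isBigO_zero _ _
  | succ k ih =>
    refine ⟨Asymptotics.isBigO_zero _ _, fun i => ?_⟩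
    have : pd i (fun _ => (0 : ℝ)) = fun _ => 0 := by funext y; simp
    rw [this]
    exact ih

lemma fallsOff_const (c : ℝ) : FallsOff k 0 fun _ => c := by
  have hO : (fun _ : E4 => c) =O[Filter.comap radius Filter.atTop]
      fun y => (radius y ^ 0)⁻¹ := by
    simpa using Asymptotics.isBigO_const_const c (one_ne_zero (α := ℝ)) _
  cases k with
  | zero => exact hO
  | succ k =>
    refine ⟨hO, fun i => ?_⟩
    have : pd i (fun _ => c) = fun _ => 0 := by funext y; simp
    rw [this]
    exact fallsOff_zero

lemma FallsOff.add (hf : ContDiffOn ℝ ∞ f (exterior R)) (hf' : ContDiffOn ℝ ∞ f' (exterior R))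
    (h : FallsOff k n f) (h' : FallsOff k n f') : FallsOff k n fun y => f y + f' y := by
  induction k generalizing n f f' with
  | zero => exact Asymptotics.IsBigO.add h h'
  | succ k ih =>
    refine ⟨h.1.add h'.1, fun i => ?_⟩
    have hs := isOpen_exterior R
    exact (ih (contDiffOn_pd hs hf i) (contDiffOn_pd hs hf' i) (h.2 i) (h'.2 i)).congr
      fun y hy => pd_add i (differentiableAt_of_contDiffOn hs hf hy)
        (differentiableAt_of_contDiffOn hs hf' hy)

lemma FallsOff.mul (hf : ContDiffOn ℝ ∞ f (exterior R)) (hf' : ContDiffOn ℝ ∞ f' (exterior R))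
    (h : FallsOff k n f) (h' : FallsOff k m f') : FallsOff k (n + m) fun y => f y * f' y := by
  have hO : ∀ {k n m : ℕ} {f f' : E4 → ℝ}, FallsOff k n f → FallsOff k m f' →
      (fun y => f y * f' y) =O[Filter.comap radius Filter.atTop]
        fun y => (radius y ^ (n + m))⁻¹ := fun h h' =>
    (h.isBigO.mul h'.isBigO).congr_right fun y => by rw [pow_add, mul_inv]
  induction k generalizing n m f f' with
  | zero => exact hO h h'
  | succ k ih =>
    refine ⟨hO h h', fun i => ?_⟩
    have hs := isOpen_exterior R
    have hp := contDiffOn_pd hs hf i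
    have hp' := contDiffOn_pd hs hf' i
    have h1 : FallsOff k (n + m + 1) fun y => f y * pd i f' y :=
      ih (m := m + 1) hf hp' h.of_succ (h'.2 i)
    have h2 : FallsOff k (n + m + 1) fun y => f' y * pd i f y := by
      have := ih hf' hp h'.of_succ (h.2 i)
      rwa [show m + (n + 1) = n + m + 1 by ring] at this
    exact ((h1.add (hf.mul hp') (hf'.mul hp) h2)).congr fun y hy =>
      pd_mul i (differentiableAt_of_contDiffOn hs hf hy)
        (differentiableAt_of_contDiffOn hs hf' hy)

lemma FallsOff.tendsto_zero (h : FallsOff k 1 f) :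
    Filter.Tendsto f (Filter.comap radius Filter.atTop) (nhds 0) := by
  refine h.isBigO.trans_tendsto ?_
  have : Filter.Tendsto (fun r : ℝ => (r ^ 1)⁻¹) Filter.atTop (nhds 0) := by
    simpa using tendsto_inv_atTop_zero
  exact this.comp Filter.tendsto_comap

variable {I : Set ℝ} {Ψ : ℝ → ℝ} (hI : IsOpen I) (h0 : (0 : ℝ) ∈ I) (hΨ : ContDiffOn ℝ ∞ Ψ I)
  (hf : ContDiffOn ℝ ∞ f (exterior R)) (hm : ∀ y ∈ exterior R, f y ∈ I) (h : FallsOff k 1 f)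
include hI h0 hΨ hf hm h

/-- A smooth function of a decaying function is bounded, with decaying derivatives. -/
lemma FallsOff.comp : FallsOff k 0 fun y => Ψ (f y) := by
  induction k generalizing Ψ with
  | zero =>
    have hc : Filter.Tendsto (fun y => Ψ (f y)) (Filter.comap radius Filter.atTop)
        (nhds (Ψ 0)) :=
      (hΨ.continuousOn.continuousAt (hI.mem_nhds h0)).tendsto.comp h.tendsto_zero
    simpa [FallsOff] using hc.isBigO_one ℝ
  | succ k ih =>
    have hc : Filter.Tendsto (fun y => Ψ (f y)) (Filter.comap radius Filter.atTop)
        (nhds (Ψ 0)) :=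
      (hΨ.continuousOn.continuousAt (hI.mem_nhds h0)).tendsto.comp h.tendsto_zero
    refine ⟨by simpa using hc.isBigO_one ℝ, fun i => ?_⟩
    have hs := isOpen_exterior R
    have hd := contDiffOn_deriv hI hΨ
    have h1 := (ih hd h.of_succ).mul (hd.comp hf hm) (contDiffOn_pd hs hf i) (h.2 i)
    exact (h1.congr fun y hy => pd_comp_deriv hs hI hΨ hf hm hy i).of_add_one

/-- A smooth function, vanishing at `0`, of a decaying function decays at the same rate. -/
lemma FallsOff.comp_of_zero (hz : Ψ 0 = 0) : FallsOff k 1 fun y => Ψ (f y) := by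
  have hO : (fun y => Ψ (f y)) =O[Filter.comap radius Filter.atTop]
      fun y => (radius y ^ 1)⁻¹ := by
    have h1 := (hasDerivAt_of_contDiffOn hI hΨ h0).isBigO_sub
    have h2 := (h1.comp_tendsto h.tendsto_zero).trans (by simpa [Function.comp_def] using h.isBigO)
    simpa [Function.comp_def, hz] using h2
  cases k with
  | zero => exact hO
  | succ k =>
    refine ⟨hO, fun i => ?_⟩
    have hs := isOpen_exterior R
    have hd := contDiffOn_deriv hI hΨ
    have h1 := (FallsOff.comp hI h0 hd hf hm h.of_succ).mul (hd.comp hf hm)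
      (contDiffOn_pd hs hf i) (h.2 i)
    rw [zero_add] at h1
    exact h1.congr fun y hy => pd_comp_deriv hs hI hΨ hf hm hy i

end FallOff

/-! ### The generated fields in charts -/

/-- A vector orthogonal to a timelike vector of a Lorentzian form is spacelike. -/
lemma pos_of_orthogonal_timelike {E : Type*} [AddCommGroup E] [Module ℝ E]
    {B : E →ₗ[ℝ] E →ₗ[ℝ] ℝ} (hB : ∀ v w, B v w = B w v) {v : E} (hv : B v v < 0)
    (hpos : ∀ w, B v w = 0 → w ≠ 0 → 0 < B w w) {x w : E} (hx : B x x < 0) (hxw : B x w = 0)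
    (hw : w ≠ 0) : 0 < B w w := by
  have hvne := hv.ne
  -- split off the components along `v`
  obtain ⟨a, x', rfl, hx'⟩ : ∃ a x', x = a • v + x' ∧ B v x' = 0 :=
    ⟨B v x / B v v, x - (B v x / B v v) • v, by simp, by
      simp only [map_sub, map_smul, smul_eq_mul]; field_simp; ring⟩
  obtain ⟨b, w', rfl, hw'⟩ : ∃ b w', w = b • v + w' ∧ B v w' = 0 :=
    ⟨B v w / B v v, w - (B v w / B v v) • v, by simp, by
      simp only [map_sub, map_smul, smul_eq_mul]; field_simp; ring⟩
  simp only [map_add, map_smul, LinearMap.add_apply, LinearMap.smul_apply, smul_eq_mul, hx', hw',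
    hB x' v, hB w' v] at hx hxw ⊢
  have hnonneg : ∀ z, B v z = 0 → 0 ≤ B z z := fun z hz => by
    by_cases h0 : z = 0
    · simp [h0]
    · exact (hpos z hz h0).le
  have ha : a ≠ 0 := by
    rintro rfl
    have := hnonneg x' hx'
    simp only [zero_mul, zero_add] at hx
    linarith
  have hw0 : w' ≠ 0 := by
    rintro rfl
    simp only [map_zero, mul_zero, add_zero] at hxw
    have hb : b = 0 := by
      have : a * (b * B v v) = 0 := by linarith
      simpa [ha, hvne] using this
    exact hw (by simp [hb])
  have hww := hpos w' hw' hw0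
  -- the Cauchy-Schwarz inequality on the orthogonal complement of `v`
  have hcs : B x' w' ^ 2 ≤ B x' x' * B w' w' := by
    have h1 := hnonneg (B w' w' • x' - B x' w' • w') (by simp [hx', hw'])
    simp only [map_sub, map_smul, LinearMap.sub_apply, LinearMap.smul_apply, smul_eq_mul,
      hB w' x'] at h1
    have h2 : 0 ≤ B w' w' * (B x' x' * B w' w' - B x' w' ^ 2) := by linarith
    have := nonneg_of_mul_nonneg_right h2 hww
    linarith
  have ha2 : 0 < a ^ 2 := by positivity
  have h3 : B x' w' = -(a * b * B v v) := by linarith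
  rw [h3] at hcs
  have h4 : 0 < a ^ 2 * (-(B v v)) * (b * (b * B v v) + B w' w') := by
    have h5 : 0 < (-(a ^ 2 * B v v) - B x' x') * B w' w' :=
      mul_pos (by linarith) hww
    linarith
  have h6 := pos_of_mul_pos_right h4 (by nlinarith)
  linarith

lemma FieldEquationsAt.congr {α : ℝ} {G F F' : E4 → Matrix (Fin 4) (Fin 4) ℝ} {φ : E4 → ℝ}
    {s : Set E4} {y : E4} (h : FieldEquationsAt α G F φ y) (hs : IsOpen s)
    (hF : ∀ z ∈ s, F' z = F z) (hy : y ∈ s) : FieldEquationsAt α G F' φ y := by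
  have hr : ∀ z ∈ s, raise G F' z = raise G F z := fun z hz => by
    funext i j; simp only [raise, hF z hz]
  have hn : normSq G F' y = normSq G F y := by simp only [normSq, hF y hy, hr y hy]
  refine ⟨fun i j => ?_, fun j => ?_, ?_⟩
  · rw [h.einstein i j, hF y hy, hn]
  · rw [← h.maxwell j]
    simp only [divergence, hr y hy]
    refine Finset.sum_congr rfl fun i _ => ?_
    rw [pd_congr_on hs (fun z hz => by rw [hr z hz]) hy]
  · rw [h.dilaton, hn]

namespace StaticFrame

variable {s : Set E4} {γ : E4 → Matrix (Fin 4) (Fin 4) ℝ} {τ ξ : Fin 4 → E4 → ℝ}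
  (h : StaticFrame s γ τ ξ) {y : E4} {u Φ : E4 → ℝ}
include h

lemma lie_staticMetric (hu : ContDiffOn ℝ ∞ u s) (hinv : ∀ z ∈ s, ∑ k, ξ k z * pd k u z = 0)
    (hy : y ∈ s) (i j : Fin 4) : lieDeriv ξ (staticMetric γ τ u) i j y = 0 := by
  have hu' := differentiableAt_of_contDiffOn h.isOpen hu hy
  have he : ∀ c : ℝ, DifferentiableAt ℝ (fun z => Real.exp (c * u z)) y := fun c =>
    (hu'.const_mul c).exp
  have hi := hinv y hy
  have h1 : staticMetric γ τ u = fun z => Matrix.of fun i j => Real.exp (-2 * u z) * γ z i j +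
      -Real.exp (2 * u z) * (τ i z * τ j z) := by
    funext z; ext i j; simp only [staticMetric, Matrix.of_apply]; ring
  rw [h1]
  refine lieDeriv_combination (he _) (he 2).fun_neg (h.diff_γ hy) (h.diff_τ hy) ?_ ?_
    (h.invariant y hy) (h.lie_τ hy) i j
  · simp only [pd_exp_mul _ hu', Fin.sum_univ_four] at hi ⊢
    linear_combination Real.exp (-2 * u y) * (-2) * hi
  · simp only [pd_neg, pd_exp_mul _ hu', Fin.sum_univ_four] at hi ⊢
    linear_combination -Real.exp (2 * u y) * 2 * hi

lemma lie_electricForm (hΦ : ContDiffOn ℝ ∞ Φ s) (hinv : ∀ z ∈ s, ∑ k, ξ k z * pd k Φ z = 0)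
    (hy : y ∈ s) (i j : Fin 4) : lieDeriv ξ (electricForm τ Φ) i j y = 0 := by
  have hp : ∀ l, DifferentiableAt ℝ (pd l Φ) y := fun l =>
    differentiableAt_of_contDiffOn h.isOpen (contDiffOn_pd h.isOpen hΦ l) hy
  have hpd : ∀ k, pd k (fun z => electricForm τ Φ z i j) y =
      τ i y * pd k (pd j Φ) y + pd j Φ y * pd k (τ i) y -
        (τ j y * pd k (pd i Φ) y + pd i Φ y * pd k (τ j) y) := fun k => by
    simp only [electricForm, Matrix.of_apply]
    rw [pd_sub k ((h.diff_τ hy i).fun_mul (hp j)) ((h.diff_τ hy j).fun_mul (hp i)),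
      pd_mul k (h.diff_τ hy i) (hp j), pd_mul k (h.diff_τ hy j) (hp i)]
  -- the differential of an invariant function is invariant
  have hlie : ∀ j, ∑ k, (ξ k y * pd k (pd j Φ) y + pd k Φ y * pd j (ξ k) y) = 0 := by
    intro j
    have h1 : pd j (fun z => ∑ k, ξ k z * pd k Φ z) y = 0 := by
      rw [pd_congr_on h.isOpen hinv hy, pd_const]
    rw [pd_sum _ _ fun k _ => (h.diff_ξ hy k).fun_mul (hp k)] at h1
    rw [← h1]
    refine Finset.sum_congr rfl fun k _ => ?_
    rw [pd_mul j (h.diff_ξ hy k) (hp k), pd_comm h.isOpen hΦ hy k j]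
  have h1 := h.lie_τ hy i
  have h2 := h.lie_τ hy j
  have h3 := hlie i
  have h4 := hlie j
  simp only [lieDeriv, hpd]
  simp only [electricForm, Matrix.of_apply, Fin.sum_univ_four] at *
  linear_combination pd j Φ y * h1 - pd i Φ y * h2 - τ j y * h3 + τ i y * h4

end StaticFrame

lemma funComp_comp_contDiffOn {M : Type*} [TopologicalSpace M]
    {e : OpenPartialHomeomorph M E4} {χ : M → ℝ} {I : Set ℝ} {Ψ : ℝ → ℝ}
    (hΨ : ContDiffOn ℝ ∞ Ψ I)
    (hI : ∀ p, χ p ∈ I) (h : ContDiffOn ℝ ∞ (funComp e χ) e.target) :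
    ContDiffOn ℝ ∞ (funComp e fun p => Ψ (χ p)) e.target :=
  hΨ.comp h fun y _ => hI (e.symm y)

section Manifold

variable {M : Type*} [TopologicalSpace M] [ChartedSpace E4 M] {gE : TwoTensor M}
  {ξ : VectorField M} {χ : M → ℝ} {e : OpenPartialHomeomorph M E4} {y : E4}

/-- The one-form `τ = e^{-2χ} ξ♭` in a chart. -/
abbrev chartTime (e : OpenPartialHomeomorph M E4) (gE : TwoTensor M) (ξ : VectorField M)
    (χ : M → ℝ) : Fin 4 → E4 → ℝ :=
  timeComp (formComp e (lower gE ξ)) (funComp e χ)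

/-- The conformal spatial metric `γ` in a chart. -/
abbrev chartSpace (e : OpenPartialHomeomorph M E4) (gE : TwoTensor M) (ξ : VectorField M)
    (χ : M → ℝ) : E4 → Matrix (Fin 4) (Fin 4) ℝ :=
  spatialComp (tensorComp e gE) (formComp e (lower gE ξ)) (funComp e χ)

lemma tensorComp_newMetric (u : M → ℝ) : tensorComp e (newMetric gE ξ χ u) =
    staticMetric (chartSpace e gE ξ χ) (chartTime e gE ξ χ) (funComp e u) := by
  funext y
  ext i j
  have h1 : tensorComp e (newMetric gE ξ χ u) y i j =
      Real.exp (2 * funComp e χ y - 2 * funComp e u y) * tensorComp e gE y i j +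
      (Real.exp (-2 * funComp e u y) - Real.exp (2 * funComp e u y - 4 * funComp e χ y)) *
        (formComp e (lower gE ξ) i y * formComp e (lower gE ξ) j y) := rfl
  rw [h1]
  have h2 : Real.exp (2 * funComp e χ y - 2 * funComp e u y) =
      Real.exp (-2 * funComp e u y) * Real.exp (2 * funComp e χ y) := by
    rw [← Real.exp_add]; ring_nf
  have h3 : Real.exp (2 * funComp e u y - 4 * funComp e χ y) =
      Real.exp (2 * funComp e u y) * Real.exp (-2 * funComp e χ y) ^ 2 := by
    rw [← Real.exp_nat_mul, ← Real.exp_add]; ring_nf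
  have h4 : Real.exp (4 * funComp e χ y) * Real.exp (-2 * funComp e χ y) ^ 2 = 1 := by
    rw [← Real.exp_nat_mul, ← Real.exp_add]; ring_nf; exact Real.exp_zero
  rw [h2, h3]
  simp only [staticMetric, spatialComp, timeComp, Matrix.of_apply]
  linear_combination -Real.exp (-2 * funComp e u y) *
    (formComp e (lower gE ξ) i y * formComp e (lower gE ξ) j y) * h4

lemma chart_det_ne_zero (hgE : IsLorentzMetric gE) (he : e ∈ smoothCharts M) (hy : y ∈ e.target) :
    (tensorComp e gE y).det ≠ 0 := by
  intro h0
  obtain ⟨v, hv, hv0⟩ := Matrix.exists_mulVec_eq_zero_iff.2 h0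
  obtain ⟨x, hx, hpos⟩ := hgE.signature (e.symm y)
  set w : TangentSpace (𝓡 4) (e.symm y) := ∑ j, v j • coordVec e j y with hw
  have hwne : w ≠ 0 := fun h => hv (sum_coordVec_eq_zero he hy h)
  have h1 : ∀ i, gE (e.symm y) (coordVec e i y) w = 0 := by
    intro i
    have h2 : ∑ j, tensorComp e gE y i j * v j = 0 := congrFun hv0 i
    rw [hw, map_sum, ← h2]
    refine Finset.sum_congr rfl fun j _ => ?_
    rw [map_smul, smul_eq_mul, mul_comm]
    rfl
  have h2 : ∀ x, gE (e.symm y) x w = 0 := by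
    intro x
    rw [eq_sum_coordVec he hy x]
    simp [h1]
  exact (hpos w (h2 x) hwne).ne' (h2 w)

variable (hχ : ∀ p, Real.exp (2 * χ p) = -gE p (ξ p) (ξ p))
include hχ

/-- Lowering the index of `ξ` with the new metric rescales the one-form `ξ♭`. -/
lemma newMetric_apply (u : M → ℝ) (p : M) (v : TangentSpace (𝓡 4) p) :
    newMetric gE ξ χ u p (ξ p) v = Real.exp (2 * u p - 2 * χ p) * gE p (ξ p) v := by
  have h1 : newMetric gE ξ χ u p (ξ p) v = Real.exp (2 * χ p - 2 * u p) * gE p (ξ p) v +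
      (Real.exp (-2 * u p) - Real.exp (2 * u p - 4 * χ p)) * (gE p (ξ p) (ξ p) * gE p (ξ p) v) :=
    rfl
  have h2 : gE p (ξ p) (ξ p) = -Real.exp (2 * χ p) := by rw [hχ p, neg_neg]
  have h3 : Real.exp (2 * χ p - 2 * u p) = Real.exp (-2 * u p) * Real.exp (2 * χ p) := by
    rw [← Real.exp_add]; ring_nf
  have h4 : Real.exp (2 * u p - 2 * χ p) = Real.exp (2 * u p - 4 * χ p) * Real.exp (2 * χ p) := by
    rw [← Real.exp_add]; ring_nf
  rw [h1, h2, h3, h4]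
  ring

lemma neg_newMetric_ξ (u : M → ℝ) (p : M) :
    Real.exp (2 * u p) = -newMetric gE ξ χ u p (ξ p) (ξ p) := by
  rw [newMetric_apply hχ, ← mul_neg, ← hχ p, ← Real.exp_add]
  ring_nf

lemma formComp_newMetric (u : M → ℝ) (i : Fin 4) (y : E4) :
    formComp e (lower (newMetric gE ξ χ u) ξ) i y =
      Real.exp (2 * funComp e u y) * chartTime e gE ξ χ i y := by
  have h1 : formComp e (lower (newMetric gE ξ χ u) ξ) i y =
      Real.exp (2 * u (e.symm y) - 2 * χ (e.symm y)) * formComp e (lower gE ξ) i y :=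
    newMetric_apply hχ u _ _
  have h2 : chartTime e gE ξ χ i y =
      Real.exp (-2 * funComp e χ y) * formComp e (lower gE ξ) i y := rfl
  rw [h1, h2, ← mul_assoc, ← Real.exp_add]
  simp only [funComp]
  ring_nf

lemma tensorComp_electricField (u Φ : M → ℝ) (i j : Fin 4) (y : E4) :
    tensorComp e (electricField (newMetric gE ξ χ u) ξ u Φ) y i j =
      chartTime e gE ξ χ i y * formComp e (differential Φ) j y -
        chartTime e gE ξ χ j y * formComp e (differential Φ) i y := by
  have h1 : tensorComp e (electricField (newMetric gE ξ χ u) ξ u Φ) y i j =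
      Real.exp (-2 * funComp e u y) *
        (formComp e (lower (newMetric gE ξ χ u) ξ) i y * formComp e (differential Φ) j y -
          formComp e (differential Φ) i y * formComp e (lower (newMetric gE ξ χ u) ξ) j y) := rfl
  have h2 : Real.exp (-2 * funComp e u y) * Real.exp (2 * funComp e u y) = 1 := by
    rw [← Real.exp_add]; simp
  rw [h1, formComp_newMetric hχ, formComp_newMetric hχ]
  linear_combination (chartTime e gE ξ χ i y * formComp e (differential Φ) j y -
    chartTime e gE ξ χ j y * formComp e (differential Φ) i y) * h2

variable (hgE : IsLorentzMetric gE) (hstatic : IsStatic gE ξ)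

lemma chart_norm (he : e ∈ smoothCharts M) (hy : y ∈ e.target) :
    ∑ k, vecComp e ξ k y * formComp e (lower gE ξ) k y = -Real.exp (2 * funComp e χ y) := by
  rw [← form_apply he hy]
  simp only [lower, funComp, hχ, neg_neg]

include hgE hstatic

lemma potential_contDiffOn (he : e ∈ smoothCharts M) :
    ContDiffOn ℝ ∞ (funComp e χ) e.target := by
  have hη : ∀ k, ContDiffOn ℝ ∞ (formComp e (lower gE ξ) k) e.target :=
    lowered_smooth (hgE.smooth e he) (hstatic.smooth e he)
      (fun y hy i => formComp_lower he hy gE ξ i)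
  have h1 : ContDiffOn ℝ ∞ (fun y => (1 / 2) * Real.log
      (-∑ k, vecComp e ξ k y * formComp e (lower gE ξ) k y)) e.target := by
    refine contDiffOn_const.mul (ContDiffOn.log
      (ContDiffOn.sum fun k _ => (hstatic.smooth e he k).mul (hη k)).neg fun y hy => ?_)
    rw [chart_norm hχ he hy, neg_neg]
    exact Real.exp_ne_zero _
  refine h1.congr fun y hy => ?_
  rw [chart_norm hχ he hy, neg_neg, Real.log_exp]
  ring

/-- In every smooth chart a static metric defines a static frame. -/
theorem chart_staticFrame (he : e ∈ smoothCharts M) :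
    StaticFrame e.target (chartSpace e gE ξ χ) (chartTime e gE ξ χ) (vecComp e ξ) :=
  staticFrame_of_static e.open_target (hgE.smooth e he) (hstatic.smooth e he)
    (potential_contDiffOn hχ hgE hstatic he) (fun _ hy i => formComp_lower he hy gE ξ i)
    (fun _ hy => chart_norm hχ he hy) (hstatic.killing e he)
    (fun _ _ _ _ => hgE.symm _ _ _) (fun _ hy => chart_det_ne_zero hgE he hy)
    (hstatic.orthogonal e he)

lemma chart_potential_invariant (he : e ∈ smoothCharts M) :
    ∀ y ∈ e.target, ∑ k, vecComp e ξ k y * pd k (funComp e χ) y = 0 := fun _ hy =>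
  potential_invariant e.open_target (hgE.smooth e he) (hstatic.smooth e he)
    (potential_contDiffOn hχ hgE hstatic he) (fun _ hy i => formComp_lower he hy gE ξ i)
    (fun _ hy => chart_norm hχ he hy) (hstatic.killing e he) hy

end Manifold

/-! ### The generated solution -/

section Solution

variable {M : Type*} [TopologicalSpace M] [ChartedSpace E4 M] {gE : TwoTensor M}
  {ξ : VectorField M} {χ u Φ : M → ℝ} {e : OpenPartialHomeomorph M E4} {y : E4}
  (hχ : ∀ p, Real.exp (2 * χ p) = -gE p (ξ p) (ξ p))
  (hgE : IsLorentzMetric gE) (hstatic : IsStatic gE ξ)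
include hχ hgE hstatic

/-- A vector orthogonal to `ξ` with respect to the new metric is orthogonal to `ξ` with respect to
the old one, and on such vectors the two metrics are proportional. -/
theorem isLorentzMetric_newMetric
    (hu : ∀ e ∈ smoothCharts M, ContDiffOn ℝ ∞ (funComp e u) e.target) :
    IsLorentzMetric (newMetric gE ξ χ u) where
  symm p v w := by
    have h1 : ∀ v w, newMetric gE ξ χ u p v w =
        Real.exp (2 * χ p - 2 * u p) * gE p v w +
        (Real.exp (-2 * u p) - Real.exp (2 * u p - 4 * χ p)) *
          (gE p (ξ p) v * gE p (ξ p) w) := fun v w => rfl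
    rw [h1, h1, hgE.symm p v w]
    ring
  signature p := by
    refine ⟨ξ p, ?_, fun w hw hw0 => ?_⟩
    · have h1 := neg_newMetric_ξ hχ u p
      have h2 := Real.exp_pos (2 * u p)
      linarith
    · rw [newMetric_apply hχ] at hw
      have h1 := (mul_eq_zero.1 hw).resolve_left (Real.exp_ne_zero _)
      have h2 : newMetric gE ξ χ u p w w =
        Real.exp (2 * χ p - 2 * u p) * gE p w w +
        (Real.exp (-2 * u p) - Real.exp (2 * u p - 4 * χ p)) *
          (gE p (ξ p) w * gE p (ξ p) w) := rfl
      obtain ⟨v, hv, hpos⟩ := hgE.signature p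
      have h3 : 0 < gE p w w :=
        pos_of_orthogonal_timelike (hgE.symm p) hv hpos (hstatic.timelike p) h1 hw0
      rw [h2, h1]
      simp only [mul_zero, add_zero]
      exact mul_pos (Real.exp_pos _) h3
  smooth e he i j := by
    have h := chart_staticFrame hχ hgE hstatic he
    have hexp : ∀ c : ℝ, ContDiffOn ℝ ∞ (fun z => Real.exp (c * funComp e u z)) e.target :=
      fun c => (contDiffOn_const.mul (hu e he)).exp
    rw [tensorComp_newMetric]
    exact ((hexp _).mul (h.smooth_γ i j)).sub
      ((hexp _).mul ((h.smooth_τ i).mul (h.smooth_τ j)))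

theorem isStatic_newMetric
    (hu : ∀ e ∈ smoothCharts M, ContDiffOn ℝ ∞ (funComp e u) e.target)
    (hinv : ∀ e ∈ smoothCharts M, ∀ z ∈ e.target,
      ∑ k, vecComp e ξ k z * pd k (funComp e u) z = 0) :
    IsStatic (newMetric gE ξ χ u) ξ where
  smooth := hstatic.smooth
  timelike p := by
    have h1 := neg_newMetric_ξ hχ u p
    have h2 := Real.exp_pos (2 * u p)
    linarith
  killing e he y hy i j := by
    rw [tensorComp_newMetric]
    exact (chart_staticFrame hχ hgE hstatic he).lie_staticMetric (hu e he) (hinv e he) hy i j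
  orthogonal e he y hy i j k := by
    have h := chart_staticFrame hχ hgE hstatic he
    have hu' := differentiableAt_of_contDiffOn e.open_target (hu e he) hy
    have h1 : ∀ i, formComp e (lower (newMetric gE ξ χ u) ξ) i =
        fun z => Real.exp (2 * funComp e u z) * chartTime e gE ξ χ i z := fun i =>
      funext fun z => formComp_newMetric hχ u i z
    have h2 : ∀ i k, pd i (formComp e (lower (newMetric gE ξ χ u) ξ) k) y =
        Real.exp (2 * funComp e u y) * (pd i (chartTime e gE ξ χ k) y +
          2 * pd i (funComp e u) y * chartTime e gE ξ χ k y) := fun i k => by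
      rw [h1, pd_mul i (hu'.const_mul 2).exp (h.diff_τ hy k), pd_exp_mul _ hu']
      ring
    have h3 := h.closed y hy
    simp only [h2]
    simp only [h1, h3 i j, h3 k i, h3 k j]
    ring

/-- The function `-Φ` is a potential of `F` with respect to the closed one-form `τ`. -/
theorem hasPotential_electricField (hΦ : ContMDiff (𝓡 4) 𝓘(ℝ, ℝ) ∞ Φ) :
    HasPotential (electricField (newMetric gE ξ χ u) ξ u Φ) := by
  refine ⟨fun p => (-(Φ p * Real.exp (-2 * χ p))) • lower gE ξ p, fun e he => ?_⟩
  have h := chart_staticFrame hχ hgE hstatic he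
  have h1 : ∀ i, formComp e (fun p => (-(Φ p * Real.exp (-2 * χ p))) • lower gE ξ p) i =
      fun z => -(funComp e Φ z * chartTime e gE ξ χ i z) := fun i => funext fun z => by
    have : formComp e (fun p => (-(Φ p * Real.exp (-2 * χ p))) • lower gE ξ p) i z =
      -(funComp e Φ z * Real.exp (-2 * funComp e χ z)) * formComp e (lower gE ξ) i z := rfl
    rw [this]
    simp only [timeComp]
    ring
  have hΦ' := funComp_contDiffOn he hΦ
  refine ⟨fun i => ?_, fun y hy i j => ?_⟩
  · rw [h1]
    exact (hΦ'.mul (h.smooth_τ i)).neg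
  · have hd := differentiableAt_of_contDiffOn e.open_target hΦ' hy
    rw [tensorComp_electricField hχ, formComp_differential he hΦ hy,
      formComp_differential he hΦ hy, h1, h1, pd_neg, pd_neg, pd_mul i hd (h.diff_τ hy j),
      pd_mul j hd (h.diff_τ hy i), h.closed y hy i j]
    ring

omit hgE hstatic in
lemma tensorComp_electricField_eq (he : e ∈ smoothCharts M)
    (hΦ : ContMDiff (𝓡 4) 𝓘(ℝ, ℝ) ∞ Φ) (hy : y ∈ e.target) :
    tensorComp e (electricField (newMetric gE ξ χ u) ξ u Φ) y =
      electricForm (chartTime e gE ξ χ) (funComp e Φ) y := by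
  ext i j
  rw [tensorComp_electricField hχ, formComp_differential he hΦ hy,
    formComp_differential he hΦ hy]
  rfl

section Curve

variable [IsManifold (𝓡 4) ∞ M] {α c : ℝ} {I : Set ℝ} {U V W : ℝ → ℝ}
  (C : GeneratingCurve α c I U V W) (hI : ∀ p, χ p ∈ I)
include hI

lemma comp_contMDiff {Ψ : ℝ → ℝ} (hΨ : ContDiffOn ℝ ∞ Ψ I) :
    ContMDiff (𝓡 4) 𝓘(ℝ, ℝ) ∞ fun p => Ψ (χ p) :=
  contMDiff_of_funComp fun _ he =>
    funComp_comp_contDiffOn hΨ hI (potential_contDiffOn hχ hgE hstatic he)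

omit [IsManifold (𝓡 4) ∞ M] in
lemma comp_invariant {Ψ : ℝ → ℝ} (hIo : IsOpen I) (hΨ : ContDiffOn ℝ ∞ Ψ I)
    (he : e ∈ smoothCharts M) (hy : y ∈ e.target) :
    ∑ k, vecComp e ξ k y * pd k (funComp e fun p => Ψ (χ p)) y = 0 := by
  have h1 : ∀ k, pd k (funComp e fun p => Ψ (χ p)) y =
      deriv Ψ (funComp e χ y) * pd k (funComp e χ) y := fun k =>
    pd_comp_deriv e.open_target hIo hΨ (potential_contDiffOn hχ hgE hstatic he)
      (fun z _ => hI (e.symm z)) hy k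
  have h2 := chart_potential_invariant hχ hgE hstatic he y hy
  simp only [h1, Fin.sum_univ_four] at h2 ⊢
  linear_combination deriv Ψ (funComp e χ y) * h2

include C

theorem isEMDSolution_of_curve (hvac : IsVacuum gE) :
    IsEMDSolution α (newMetric gE ξ χ fun p => U (χ p))
      (electricField (newMetric gE ξ χ fun p => U (χ p)) ξ (fun p => U (χ p)) fun p => W (χ p))
      fun p => V (χ p) where
  lorentz := isLorentzMetric_newMetric hχ hgE hstatic fun e he =>
    funComp_comp_contDiffOn C.smooth_U hI (potential_contDiffOn hχ hgE hstatic he)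
  potential := hasPotential_electricField hχ hgE hstatic
    (comp_contMDiff hχ hgE hstatic hI C.smooth_W)
  smooth := comp_contMDiff hχ hgE hstatic hI C.smooth_V
  equations e he y hy := by
    rw [tensorComp_newMetric]
    refine FieldEquationsAt.congr ((chart_staticFrame hχ hgE hstatic he).fieldEquations C
      (potential_contDiffOn hχ hgE hstatic he) (chart_potential_invariant hχ hgE hstatic he)
      (fun z _ => hI (e.symm z)) (fun z hz i j => ?_) hy) e.open_target (fun z hz => ?_) hy
    · have h1 : staticMetric (chartSpace e gE ξ χ) (chartTime e gE ξ χ) (funComp e χ) =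
          tensorComp e gE := staticMetric_spatialComp
      exact (congrArg (fun G => ricci G i j z) h1).trans (hvac e he z hz i j)
    · exact tensorComp_electricField_eq hχ he (comp_contMDiff hχ hgE hstatic hI C.smooth_W) hz

theorem isStaticSolution_of_curve :
    IsStaticSolution (newMetric gE ξ χ fun p => U (χ p))
      (electricField (newMetric gE ξ χ fun p => U (χ p)) ξ (fun p => U (χ p)) fun p => W (χ p))
      (fun p => V (χ p)) ξ where
  metric := isStatic_newMetric hχ hgE hstatic
    (fun e he => funComp_comp_contDiffOn C.smooth_U hI (potential_contDiffOn hχ hgE hstatic he))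
    fun e he z hz => comp_invariant hχ hgE hstatic hI C.isOpen C.smooth_U he hz
  maxwell e he y hy i j := by
    have hW := comp_contMDiff hχ hgE hstatic hI C.smooth_W
    have h1 := fun z (hz : z ∈ e.target) =>
      tensorComp_electricField_eq (u := fun p => U (χ p)) hχ he hW hz
    have h2 := (chart_staticFrame hχ hgE hstatic he).lie_electricForm (funComp_contDiffOn he hW)
      (fun z hz => comp_invariant hχ hgE hstatic hI C.isOpen C.smooth_W he hz) hy i j
    rw [← h2]
    simp only [lieDeriv, h1 y hy]
    refine Finset.sum_congr rfl fun k _ => ?_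
    rw [pd_congr_on e.open_target (fun z hz => by rw [h1 z hz]) hy]
  dilaton p := by
    obtain ⟨e, he, y, hy, rfl⟩ := exists_chart_point p
    rw [form_apply he hy, ← comp_invariant hχ hgE hstatic hI C.isOpen C.smooth_V he hy]
    refine Finset.sum_congr rfl fun k _ => ?_
    rw [formComp_differential he (comp_contMDiff hχ hgE hstatic hI C.smooth_V) hy]

end Curve

end Solution

/-! ### Asymptotic flatness of the generated solution -/

section Asymptotics

variable {M : Type*} [TopologicalSpace M] [ChartedSpace E4 M] {gE : TwoTensor M}
  {ξ : VectorField M} {χ : M → ℝ} {e : OpenPartialHomeomorph M E4} {y : E4} {R : ℝ}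

section End

variable (he : e ∈ smoothCharts M)
  (hR : ∀ y, R < radius y → y ∈ e.target ∧ ∀ i, vecComp e ξ i y = if i = 0 then 1 else 0)
include he hR

lemma formComp_lower_end (hy : y ∈ exterior R) (i : Fin 4) :
    formComp e (lower gE ξ) i y = tensorComp e gE y 0 i := by
  rw [formComp_lower he (hR y hy).1]
  simp [(hR y hy).2]

lemma tensorComp_zero_end (hχ : ∀ p, Real.exp (2 * χ p) = -gE p (ξ p) (ξ p))
    (hy : y ∈ exterior R) : tensorComp e gE y 0 0 = -Real.exp (2 * funComp e χ y) := by
  rw [← chart_norm hχ he (hR y hy).1]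
  simp [(hR y hy).2, formComp_lower_end he hR hy]

variable (hgE : IsLorentzMetric gE)
include hgE

lemma tensorComp_contDiffOn_end (i j : Fin 4) :
    ContDiffOn ℝ ∞ (fun y => tensorComp e gE y i j) (exterior R) :=
  (hgE.smooth e he i j).mono fun y hy => (hR y hy).1

variable (hflat : IsAsymptoticallyFlat e gE)
include hflat

/-- The components of an asymptotically flat metric are bounded, with decaying derivatives. -/
lemma tensorComp_fallsOff_end (i j : Fin 4) : FallsOff 2 0 fun y => tensorComp e gE y i j := by
  have hs := tensorComp_contDiffOn_end he hR hgE i j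
  refine (FallsOff.add (hs.sub contDiffOn_const) contDiffOn_const (hflat i j).of_add_one
    (fallsOff_const ((Matrix.diagonal ![-1, 1, 1, 1] : Matrix (Fin 4) (Fin 4) ℝ) i j))).congr
    (R := R) fun y _ => ?_
  ring

/-- The potential is `½ log (1 - f)`, where `f = g₀₀ + 1` decays. -/
lemma potential_fallsOff (hχ : ∀ p, Real.exp (2 * χ p) = -gE p (ξ p) (ξ p)) :
    FallsOff 2 1 (funComp e χ) := by
  have h1 : ∀ y ∈ exterior R, 1 - (tensorComp e gE y 0 0 -
      (Matrix.diagonal ![-1, 1, 1, 1] : Matrix (Fin 4) (Fin 4) ℝ) 0 0) =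
      Real.exp (2 * funComp e χ y) := fun y hy => by
    rw [tensorComp_zero_end he hR hχ hy]; simp
  have hΨ : ContDiffOn ℝ ∞ (fun t : ℝ => (1 / 2) * Real.log (1 - t)) (Set.Iio 1) :=
    contDiffOn_const.mul (ContDiffOn.log (contDiffOn_const.sub contDiffOn_id) fun t ht =>
      (sub_pos.2 ht).ne')
  refine (FallsOff.comp_of_zero isOpen_Iio (by norm_num) hΨ
    ((tensorComp_contDiffOn_end he hR hgE 0 0).sub contDiffOn_const) (fun y hy => ?_) (hflat 0 0)
    (by simp)).congr (R := R) fun y hy => ?_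
  · rw [Set.mem_Iio, ← sub_pos, h1 y hy]
    exact Real.exp_pos _
  · rw [h1 y hy, Real.log_exp]; ring

end End

variable (hχ : ∀ p, Real.exp (2 * χ p) = -gE p (ξ p) (ξ p))
  (hgE : IsLorentzMetric gE) (hstatic : IsStatic gE ξ) (hend : IsEnd e ξ)
  (hflat : IsAsymptoticallyFlat e gE) {α c : ℝ} {I : Set ℝ} {U V W : ℝ → ℝ}
  (C : GeneratingCurve α c I U V W) (hI : ∀ p, χ p ∈ I)
include hχ hgE hstatic hend hflat C hI

/-- All coefficients are smooth functions of `χ = O(1/r)`, normalized at `χ = 0`. -/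
theorem isAsymptoticallyFlat_of_curve [IsManifold (𝓡 4) ∞ M] :
    IsAsymptoticallyFlatSolution e (newMetric gE ξ χ fun p => U (χ p))
      (electricField (newMetric gE ξ χ fun p => U (χ p)) ξ (fun p => U (χ p)) fun p => W (χ p))
      (fun p => V (χ p)) := by
  obtain ⟨he, R, hR⟩ := hend
  have hsub : exterior R ⊆ e.target := fun y hy => (hR y hy).1
  have hs := isOpen_exterior R
  have hG := tensorComp_contDiffOn_end he hR hgE
  have hGf := tensorComp_fallsOff_end he hR hgE hflat
  have hχs : ContDiffOn ℝ ∞ (funComp e χ) (exterior R) :=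
    (potential_contDiffOn hχ hgE hstatic he).mono hsub
  have hχf := potential_fallsOff he hR hgE hflat hχ
  have hm : ∀ y ∈ exterior R, funComp e χ y ∈ I := fun y _ => hI _
  have hsm : ∀ {Ψ : ℝ → ℝ}, ContDiffOn ℝ ∞ Ψ I →
      ContDiffOn ℝ ∞ (fun y => Ψ (funComp e χ y)) (exterior R) := fun hΨ => hΨ.comp hχs hm
  have hbd : ∀ {Ψ : ℝ → ℝ}, ContDiffOn ℝ ∞ Ψ I → FallsOff 2 0 fun y => Ψ (funComp e χ y) :=
    fun hΨ => FallsOff.comp C.isOpen C.zero_mem hΨ hχs hm hχf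
  have hdec : ∀ {Ψ : ℝ → ℝ}, ContDiffOn ℝ ∞ Ψ I → Ψ 0 = 0 →
      FallsOff 2 1 fun y => Ψ (funComp e χ y) := fun hΨ h0 =>
    FallsOff.comp_of_zero C.isOpen C.zero_mem hΨ hχs hm hχf h0
  refine ⟨fun i j => ?_, fun i j => ?_, hdec C.smooth_V C.V_zero⟩
  · set η : ℝ := (Matrix.diagonal ![-1, 1, 1, 1] : Matrix (Fin 4) (Fin 4) ℝ) i j with hη
    have hA : ContDiffOn ℝ ∞ (fun t => Real.exp (2 * t - 2 * U t)) I :=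
      ((contDiffOn_const.mul contDiffOn_id).sub (contDiffOn_const.mul C.smooth_U)).exp
    have hB : ContDiffOn ℝ ∞ (fun t => Real.exp (-2 * U t) - Real.exp (2 * U t - 4 * t)) I :=
      (contDiffOn_const.mul C.smooth_U).exp.sub
        ((contDiffOn_const.mul C.smooth_U).sub (contDiffOn_const.mul contDiffOn_id)).exp
    have hA' : ContDiffOn ℝ ∞ (fun t => (Real.exp (2 * t - 2 * U t) - 1) * η) I :=
      (hA.sub contDiffOn_const).mul contDiffOn_const
    have s1 : ContDiffOn ℝ ∞ (fun y => Real.exp (2 * funComp e χ y - 2 * U (funComp e χ y)) *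
        (tensorComp e gE y i j - η)) (exterior R) :=
      (hsm hA).mul ((hG i j).sub contDiffOn_const)
    have f1 := (hbd hA).mul (hsm hA) ((hG i j).sub contDiffOn_const) (hflat i j)
    have s2 := (hG 0 i).mul (hG 0 j)
    have f2 := (hGf 0 i).mul (hG 0 i) (hG 0 j) (hGf 0 j)
    have f3 := (hdec hB (by simp [C.U_zero])).mul (hsm hB) s2 f2
    have f4 := hdec hA' (by simp [C.U_zero])
    have f5 := (f1.add s1 (hsm hA') f4).add (s1.add (hsm hA')) ((hsm hB).mul s2) f3
    refine f5.congr (R := R) fun y hy => ?_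
    have h1 : tensorComp e (newMetric gE ξ χ fun p => U (χ p)) y i j =
        Real.exp (2 * funComp e χ y - 2 * U (funComp e χ y)) * tensorComp e gE y i j +
        (Real.exp (-2 * U (funComp e χ y)) -
          Real.exp (2 * U (funComp e χ y) - 4 * funComp e χ y)) *
          (formComp e (lower gE ξ) i y * formComp e (lower gE ξ) j y) := rfl
    rw [h1, formComp_lower_end he hR hy, formComp_lower_end he hR hy]
    ring
  · have hE : ContDiffOn ℝ ∞ (fun t : ℝ => Real.exp (-2 * t)) I :=
      (contDiffOn_const.mul contDiffOn_id).exp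
    have hW := hsm C.smooth_W
    have hWf := hdec C.smooth_W C.W_zero
    -- each term of `F` is the product of a bounded component of `τ` and a derivative of `Φ`
    have s1 : ∀ i j, ContDiffOn ℝ ∞ (fun y => Real.exp (-2 * funComp e χ y) *
        tensorComp e gE y 0 i * pd j (fun y => W (funComp e χ y)) y) (exterior R) := fun i j =>
      ((hsm hE).mul (hG 0 i)).mul (contDiffOn_pd hs hW j)
    have f1 : ∀ i j, FallsOff 1 2 (fun y => Real.exp (-2 * funComp e χ y) *
        tensorComp e gE y 0 i * pd j (fun y => W (funComp e χ y)) y) := fun i j =>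
      ((hbd hE).mul (hsm hE) (hG 0 i) (hGf 0 i)).of_succ.mul ((hsm hE).mul (hG 0 i))
        (contDiffOn_pd hs hW j) (hWf.2 j)
    have f2 := (fallsOff_const (k := 1) (-1)).mul (n := 0) contDiffOn_const (s1 j i) (f1 j i)
    rw [zero_add] at f2
    have f3 := (f1 i j).add (s1 i j) (contDiffOn_const.mul (s1 j i)) f2
    refine f3.congr (R := R) fun y hy => ?_
    rw [tensorComp_electricField_eq hχ he (comp_contMDiff hχ hgE hstatic hI C.smooth_W) (hsub hy)]
    have h1 : ∀ i, chartTime e gE ξ χ i y =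
        Real.exp (-2 * funComp e χ y) * tensorComp e gE y 0 i := fun i => by
      rw [← formComp_lower_end he hR hy]; rfl
    simp only [electricForm, Matrix.of_apply, h1]
    change _ * pd j (fun y => W (funComp e χ y)) y - _ * pd i (fun y => W (funComp e χ y)) y = _
    ring

end Asymptotics

end EMD

end

theorem mainTheorem1 {M : Type*} [TopologicalSpace M] [ChartedSpace EMD.E4 M]
    [IsManifold (𝓡 4) ∞ M] (α : ℝ)
    (gE : EMD.TwoTensor M) (ξ : EMD.VectorField M) (e : OpenPartialHomeomorph M EMD.E4)
    (hgE : EMD.IsLorentzMetric gE) (hstatic : EMD.IsStatic gE ξ) (hvac : EMD.IsVacuum gE)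
    (hend : EMD.IsEnd e ξ) (hflat : EMD.IsAsymptoticallyFlat e gE)
    (χ u φ Φ : M → ℝ) (hχ : ∀ p, Real.exp (2 * χ p) = -gE p (ξ p) (ξ p))
    (hclass : (∃ Γ θ, EMD.FirstClass α Γ θ χ u φ Φ) ∨ (∃ b, EMD.SecondClass α b χ u φ Φ) ∨
      (∃ ψ ϑ, EMD.ThirdClass α ψ ϑ χ u φ Φ))
    (g F : EMD.TwoTensor M) (hg : g = EMD.newMetric gE ξ χ u)
    (hF : F = EMD.electricField g ξ u Φ) :
    EMD.IsEMDSolution α g F φ ∧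
    EMD.IsStaticSolution g F φ ξ ∧
    EMD.IsAsymptoticallyFlatSolution e g F φ ∧
    (∀ p, Real.exp (2 * u p) = -g p (ξ p) (ξ p)) ∧
    (∀ Γ θ, EMD.FirstClass α Γ θ χ u φ Φ → ∃ Q, EMD.IsGeneratedBy α Q χ u φ Φ ∧
      (Real.cos θ ≠ 0 → Q.det < 1 + α ^ 2)) ∧
    (∀ b, EMD.SecondClass α b χ u φ Φ → ∃ Q, EMD.IsGeneratedBy α Q χ u φ Φ ∧
      Q.det = 1 + α ^ 2) ∧
    (∀ ψ ϑ, EMD.ThirdClass α ψ ϑ χ u φ Φ → ∃ Q, EMD.IsGeneratedBy α Q χ u φ Φ ∧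
      (ψ ≠ 0 → 1 + α ^ 2 < Q.det)) := by
  refine ⟨?_, ?_, ?_, ?_, fun _ _ h => EMD.firstClass_isGeneratedBy h,
    fun _ h => EMD.secondClass_isGeneratedBy h, fun _ _ h => EMD.thirdClass_isGeneratedBy h⟩
  all_goals
    obtain ⟨c, I, U, V, W, C, hC⟩ := EMD.exists_generatingCurve hclass
    have hI : ∀ p, χ p ∈ I := fun p => (hC p).1
    obtain rfl : u = fun p => U (χ p) := funext fun p => (hC p).2.1
    obtain rfl : φ = fun p => V (χ p) := funext fun p => (hC p).2.2.1
    obtain rfl : Φ = fun p => W (χ p) := funext fun p => (hC p).2.2.2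
    subst hF hg
  · exact EMD.isEMDSolution_of_curve hχ hgE hstatic C hI hvac
  · exact EMD.isStaticSolution_of_curve hχ hgE hstatic C hI
  · exact EMD.isAsymptoticallyFlat_of_curve hχ hgE hstatic hend hflat C hI
  · exact EMD.neg_newMetric_ξ hχ _
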